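/- Let $V$ be a valuation ring of height $1$ and let $\pi\in V$ be a nonzero element of strictly positive valuation. A $\pi$-adic formal scheme is a formal scheme $\mathfrak Z$ over $\mathrm{Spf}(V)$ for which $\pi\mathcal O_{\mathfrak Z}$ is an ideal of definition; equivalently, a compatible family of schemes $Z_k$ over $V/\pi^kV$ ($k\ge 1$) with isomorphisms $Z_{k+1}\otimes V/\pi^k\simeq Z_k$. It is without $\pi$-torsion if multiplication by $\pi$ is injective on $\mathcal O_{\mathfrak Z}$. A morphism is affine if it is affine modulo $\pi^k$ for every $k\ge1$. For $\mathfrak Z$ without $\pi$-torsion: * An ideal $\mathcal I\subset\mathcal O_{\mathfrak Z}$ is admissible if, locally on $\mathfrak Z$, there is $N$ such that $\pi^N\mathcal O_{\mathfrak Z}\subset\mathcal I$ and $\mathcal I/\pi^N\mathcal O_{\mathfrak Z}$ is quasi-coherent of finite type. Its admissible formal blow-up is the $\pi$-adic formal $\mathfrak Z$-scheme $\varinjlim_k \mathrm{Proj}\bigl(\bigoplus_{n\ge0}\mathcal I^n/\pi^k\mathcal I^n\bigr)$; over an affine open $\mathrm{Spf}(R)\subset\mathfrak Z$ it is the $\pi$-adic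 completion of the blow-up $\mathrm{Proj}\bigl(\bigoplus_n I^n\bigr)$ of $\mathrm{Spec}(R)$ along $I=\Gamma(\mathrm{Spf}(R),\mathcal I)$. * The normalisation of $\mathfrak Z$ in its generic fibre is the affine formal $\mathfrak Z$-scheme $\mathfrak Z^{norm}$ whose reduction modulo $\pi^k$, over an affine open $\mathrm{Spf}(R)\subset\mathfrak Z$, is $\mathrm{Spec}(\overline R/\pi^k\overline R)$, where $\overline R$ is the integral closure of $R$ in $R[\frac1\pi]$. Let $I$ be a directed ordered set and let $(\mathfrak Z_i)_{i\in I}$, with transition morphisms $\varphi_{ij}:\mathfrak Z_i\to\mathfrak Z_j$ for $i\ge j$, be a projective system of quasi-separated $\pi$-adic formal schemes without $\pi$-torsion whose transition morphisms are affine. Fix $i_0\in I$ and an admissible ideal $\mathcal I\subset\mathcal O_{\mathfrak Z_{i_0}}$. For $i\ge i_0$ let $\widetilde{\mathfrak Z}_i$ be the admissible formal blow-up of the ideal $\mathcal O_{\mathfrak Z_i}\cdot\varphi_{ii_0}^{-1}\mathcal I$ of $\mathcal O_{\mathfrak Z_i}$ and let $\widetilde{\mathfrak Z}_i^{norm}$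 be its normalisation in its generic fibre. Then the limit $\mathfrak Z_\infty=\varprojlim_i\mathfrak Z_i$ exists in the category of $\pi$-adic formal schemes and is without $\pi$-torsion; the $\widetilde{\mathfrak Z}_i^{norm}$ exist and form a projective system over $(\mathfrak Z_i)_{i\ge i_0}$; and if $\mathfrak M\to\mathfrak Z_\infty$ is the normalisation in its generic fibre of the admissible formal blow-up of the inverse image ideal $\mathcal O_{\mathfrak Z_\infty}\cdot\mathcal I$ (which exists), there is a unique compatible family of morphisms $\mathfrak M\to\widetilde{\mathfrak Z}_i^{norm}$ ($i\ge i_0$) lying over the projections $\mathfrak Z_\infty\to\mathfrak Z_i$, and it identifies $\mathfrak M$ with the limit: $$\mathfrak M\;\xrightarrow{\;\sim\;}\;\varprojlim_{i\ge i_0}\widetilde{\mathfrak Z}_i^{norm}$$ in the category of $\pi$-adic formal schemes. -/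

import Mathlib

open CategoryTheory CategoryTheory.Limits AlgebraicGeometry

universe u

noncomputable section

/-! ## The blow-up of an affine scheme along an ideal -/

section Rees

variable {R : Type u} [CommRing R] (I : Ideal R)

/-- The summand `I ^ n` (in degree `n`) of the Rees algebra `⨁ I ^ n`. -/
def reesPiece (n : ℕ) : Submodule R (reesAlgebra I) :=
  (LinearMap.range (Polynomial.monomial n : R →ₗ[R] Polynomial R)).comap
    (reesAlgebra I).val.toLinearMap

variable {I} in
theorem mem_reesPiece {n : ℕ} {f : reesAlgebra I} :
    f ∈ reesPiece I n ↔ ∃ r : R, Polynomial.monomial n r = (f : Polynomial R) := by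
  rfl

/-- The degree `n` component of an element of the Rees algebra. -/
def reesComponent (f : reesAlgebra I) (n : ℕ) : reesPiece I n :=
  ⟨⟨Polynomial.monomial n ((f : Polynomial R).coeff n),
    reesAlgebra.monomial_mem.mpr ((mem_reesAlgebra_iff I _).mp f.2 n)⟩,
    mem_reesPiece.mpr ⟨_, rfl⟩⟩

instance reesPiece_gradedMonoid : SetLike.GradedMonoid (reesPiece I) where
  one_mem := mem_reesPiece.mpr ⟨1, by simp⟩
  mul_mem i j f g hf hg := by
    obtain ⟨r, hr⟩ := mem_reesPiece.mp hf
    obtain ⟨s, hs⟩ := mem_reesPiece.mp hg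
    exact mem_reesPiece.mpr ⟨r * s, by
      rw [MulMemClass.coe_mul, ← hr, ← hs, Polynomial.monomial_mul_monomial]⟩

theorem reesPiece_isInternal : DirectSum.IsInternal (reesPiece I) := by
  classical
  constructor
  · intro a b hab
    refine DFinsupp.ext fun n => Subtype.ext (Subtype.ext ?_)
    have key : ∀ c : DirectSum ℕ (fun n => reesPiece I n),
        ((DirectSum.coeAddMonoidHom (reesPiece I) c : reesAlgebra I) : Polynomial R).coeff n
          = ((c n : reesAlgebra I) : Polynomial R).coeff n := by
      intro c
      induction c using DirectSum.induction_on with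
      | zero => simp
      | of m x =>
        obtain ⟨r, hr⟩ := mem_reesPiece.mp x.2
        rw [DirectSum.coeAddMonoidHom_of]
        by_cases h : m = n
        · subst h; rw [DirectSum.of_eq_same]
        · rw [DirectSum.of_eq_of_ne _ _ _ (Ne.symm h), ← hr, Polynomial.coeff_monomial_of_ne]
          · simp
          · exact Ne.symm h
      | add x y hx hy =>
        rw [map_add, DirectSum.add_apply]
        simp only [Subalgebra.coe_add, Submodule.coe_add, Polynomial.coeff_add, hx, hy]
    have hm : ∀ x : reesPiece I n, ((x : reesAlgebra I) : Polynomial R)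
        = Polynomial.monomial n (((x : reesAlgebra I) : Polynomial R).coeff n) := by
      intro x
      obtain ⟨r, hr⟩ := mem_reesPiece.mp x.2
      rw [← hr, Polynomial.coeff_monomial_same]
    rw [hm (a n), hm (b n), ← key a, ← key b, hab]
  · intro f
    refine ⟨∑ n ∈ (f : Polynomial R).support,
      DirectSum.of (fun n => reesPiece I n) n (reesComponent I f n), Subtype.ext ?_⟩
    rw [map_sum]
    simp only [DirectSum.coeAddMonoidHom_of]
    rw [AddSubmonoidClass.coe_finsetSum]
    exact (Polynomial.as_sum_support (f : Polynomial R)).symm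

instance reesPiece_decomposition : DirectSum.Decomposition (reesPiece I) :=
  (reesPiece_isInternal I).chooseDecomposition

instance reesPiece_gradedAlgebra : GradedAlgebra (reesPiece I) where

/-- The blow-up of `Spec R` along the ideal `I`, i.e. `Proj (⨁ I ^ n)`. -/
def affineBlowup : Scheme.{u} := Proj (reesPiece I)

/-- The structure morphism of the blow-up. -/
def affineBlowupToSpec : affineBlowup I ⟶ Spec (CommRingCat.of R) :=
  Proj.toSpecZero (reesPiece I) ≫
    Spec.map (CommRingCat.ofHom (algebraMap R (reesPiece I 0)))

end Rees

/-! ## `π`-adic formal schemes -/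

/-- The ring `V / π ^ (n + 1)`. -/
abbrev TruncRing (V : Type u) [CommRing V] (π : V) (n : ℕ) : CommRingCat.{u} :=
  CommRingCat.of (V ⧸ Ideal.span {π ^ (n + 1)})

/-- The reduction map `V / π ^ (n + 2) → V / π ^ (n + 1)`. -/
def truncMap (V : Type u) [CommRing V] (π : V) (n : ℕ) :
    TruncRing V π (n + 1) ⟶ TruncRing V π n :=
  CommRingCat.ofHom (Ideal.Quotient.factor
    (Ideal.span_singleton_le_span_singleton.mpr (pow_dvd_pow π (Nat.le_succ (n + 1)))))

/-- A `π`-adic formal scheme over `Spf V`: a compatible family of schemes `Z_n` over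
`Spec (V / π ^ (n + 1))` together with isomorphisms of `Z_n` with the reduction of `Z_(n+1)`
(expressed by saying that the evident squares are cartesian). -/
structure PadicFormalScheme (V : Type u) [CommRing V] (π : V) where
  /-- the reduction modulo `π ^ (n + 1)` -/
  obj : ℕ → Scheme.{u}
  /-- the structure morphisms -/
  str : ∀ n, obj n ⟶ Spec (TruncRing V π n)
  /-- the closed immersions `Z_n ⟶ Z_(n+1)` -/
  trans : ∀ n, obj n ⟶ obj (n + 1)
  isPullback : ∀ n, IsPullback (trans n) (str n) (str (n + 1)) (Spec.map (truncMap V π n))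

namespace PadicFormalScheme

variable {V : Type u} [CommRing V] {π : V}

/-- A morphism of `π`-adic formal schemes over `Spf V`. -/
@[ext]
structure Hom (X Y : PadicFormalScheme V π) where
  /-- the reduction modulo `π ^ (n + 1)` -/
  app : ∀ n, X.obj n ⟶ Y.obj n
  trans_comp : ∀ n, X.trans n ≫ app (n + 1) = app n ≫ Y.trans n
  comp_str : ∀ n, app n ≫ Y.str n = X.str n

instance : Category (PadicFormalScheme V π) where
  Hom := Hom
  id X := { app := fun n => 𝟙 _, trans_comp := by simp, comp_str := by simp }
  comp f g :=
    { app := fun n => f.app n ≫ g.app n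
      trans_comp := fun n => by
        rw [← Category.assoc, f.trans_comp, Category.assoc, g.trans_comp, Category.assoc]
      comp_str := fun n => by rw [Category.assoc, g.comp_str, f.comp_str] }
  id_comp f := Hom.ext (funext fun n => Category.id_comp _)
  comp_id f := Hom.ext (funext fun n => Category.comp_id _)
  assoc f g h := Hom.ext (funext fun n => Category.assoc _ _ _)

/-- A formal scheme is quasi-separated if its underlying topological space is. -/
def QuasiSeparated (X : PadicFormalScheme V π) : Prop := QuasiSeparatedSpace (X.obj 0)

/-- A morphism is affine if it is so modulo every power of `π`. -/
def IsAffineMor {X Y : PadicFormalScheme V π} (f : X ⟶ Y) : Prop := ∀ n, IsAffineHom (f.app n)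

/-- An open subset of a formal scheme. The closed immersions `Z_n ⟶ Z_(n+1)` are
homeomorphisms; we record the open subset of each `Z_n`. -/
structure Open (X : PadicFormalScheme V π) where
  /-- the open subset of `Z_n` -/
  carrier : ∀ n, (X.obj n).Opens
  compat : ∀ n, X.trans n ⁻¹ᵁ carrier (n + 1) = carrier n

/-- An open subset is affine if it is so modulo every power of `π`. -/
def Open.IsAffine {X : PadicFormalScheme V π} (U : X.Open) : Prop :=
  ∀ n, IsAffineOpen (U.carrier n)

variable (X : PadicFormalScheme V π)

/-- The restriction `Γ(U, O_(Z_(n+1))) → Γ(U, O_(Z_n))`. -/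
def transApp (U : X.Open) (n : ℕ) :
    Γ(X.obj (n + 1), U.carrier (n + 1)) ⟶ Γ(X.obj n, U.carrier n) :=
  (X.trans n).appLE (U.carrier (n + 1)) (U.carrier n) (U.compat n).ge

/-- The ring of sections over `U` of the structure sheaf `lim O_(Z_n)` of a formal scheme. -/
def sections (U : X.Open) : Subring (∀ n, Γ(X.obj n, U.carrier n)) where
  carrier := {x | ∀ n, (X.transApp U n).hom (x (n + 1)) = x n}
  mul_mem' ha hb n := by simp [ha n, hb n]
  one_mem' n := by simp
  add_mem' ha hb n := by simp [ha n, hb n]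
  zero_mem' n := by simp
  neg_mem' ha n := by simp [ha n]

/-- The reduction map `Γ(U, O_Z) → Γ(U, O_(Z_n))`. -/
def reduction (U : X.Open) (n : ℕ) : X.sections U →+* Γ(X.obj n, U.carrier n) :=
  (Pi.evalRingHom _ n).comp (X.sections U).subtype

/-- The composite `Z_n ⟶ Spec (V / π ^ (n + 1)) ⟶ Spec V`. -/
def toBase (n : ℕ) : X.obj n ⟶ Spec (CommRingCat.of V) :=
  X.str n ≫ Spec.map (CommRingCat.ofHom (Ideal.Quotient.mk _))

theorem trans_toBase (n : ℕ) : X.trans n ≫ X.toBase (n + 1) = X.toBase n := by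
  have h : CommRingCat.ofHom (Ideal.Quotient.mk _) ≫ truncMap V π n =
      CommRingCat.ofHom (Ideal.Quotient.mk (Ideal.span {π ^ (n + 1)})) := by
    ext x; rfl
  rw [toBase, ← Category.assoc, (X.isPullback n).w, Category.assoc, ← Spec.map_comp, h, toBase]

theorem le_preimage_top (U : X.Open) (n : ℕ) : U.carrier n ≤ X.toBase n ⁻¹ᵁ ⊤ :=
  fun _ _ => trivial

/-- The structure map `V → Γ(U, O_(Z_n))`. -/
def baseMapLevel (U : X.Open) (n : ℕ) : CommRingCat.of V ⟶ Γ(X.obj n, U.carrier n) :=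
  (Scheme.ΓSpecIso (CommRingCat.of V)).inv ≫ (X.toBase n).appLE ⊤ (U.carrier n) (X.le_preimage_top U n)

theorem baseMapLevel_transApp (U : X.Open) (n : ℕ) :
    X.baseMapLevel U (n + 1) ≫ X.transApp U n = X.baseMapLevel U n := by
  have h := X.trans_toBase n
  rw [baseMapLevel, transApp, Category.assoc, Scheme.Hom.appLE_comp_appLE, baseMapLevel]
  simp only [h]

/-- The structure map from `V` to the sections of the structure sheaf. -/
def baseMap (U : X.Open) : V →+* X.sections U :=
  RingHom.codRestrict (RingHom.pi fun n => (X.baseMapLevel U n).hom) (X.sections U)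
    (fun v n => congr($(X.baseMapLevel_transApp U n).hom v))

instance (U : X.Open) : Algebra V (X.sections U) := (X.baseMap U).toAlgebra

/-- `X` is without `π`-torsion: multiplication by `π` is injective on the structure sheaf. -/
def TorsionFree : Prop :=
  ∀ (U : X.Open) (x : X.sections U), π • x = 0 → x = 0

variable {X} {Y : PadicFormalScheme V π}

/-- The preimage of an open subset. -/
def Open.preimage (f : X ⟶ Y) (U : Y.Open) : X.Open where
  carrier n := f.app n ⁻¹ᵁ U.carrier n
  compat n := by
    rw [← Scheme.Hom.comp_preimage, f.trans_comp, Scheme.Hom.comp_preimage, U.compat]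

/-- The map `Γ(U, O_(Y_n)) → Γ(f⁻¹ U, O_(X_n))`. -/
def sectionsMapLevel (f : X ⟶ Y) (U : Y.Open) (n : ℕ) :
    Γ(Y.obj n, U.carrier n) ⟶ Γ(X.obj n, (U.preimage f).carrier n) :=
  (f.app n).app (U.carrier n)

theorem sectionsMapLevel_transApp (f : X ⟶ Y) (U : Y.Open) (n : ℕ) :
    sectionsMapLevel f U (n + 1) ≫ X.transApp (U.preimage f) n =
      Y.transApp U n ≫ sectionsMapLevel f U n := by
  have h := f.trans_comp n
  simp only [sectionsMapLevel, transApp, Scheme.Hom.app_eq_appLE]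
  erw [Scheme.Hom.appLE_comp_appLE, Scheme.Hom.appLE_comp_appLE]
  simp only [h]
  rfl

/-- The map `Γ(U, O_Y) → Γ(f⁻¹ U, O_X)`. -/
def sectionsMap (f : X ⟶ Y) (U : Y.Open) : Y.sections U →+* X.sections (U.preimage f) :=
  RingHom.codRestrict
    (RingHom.pi fun n => (sectionsMapLevel f U n).hom.comp (Y.reduction U n))
    (X.sections (U.preimage f)) (fun x n =>
      (congr($(sectionsMapLevel_transApp f U n).hom (x.1 (n + 1)))).trans
        (congrArg (sectionsMapLevel f U n).hom (x.2 n)))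

/-! ## Ideals and admissible formal blow-ups -/

/-- A compatible family of quasi-coherent ideals `𝓘_n = 𝓘 · O_(Z_n)` of the `O_(Z_n)`; an
ideal `𝓘` of `O_Z` that locally contains a power of `π` and whose image in `O_Z / π ^ N` is then
quasi-coherent is the same thing as such a family with the local condition below. -/
structure IdealSystem (X : PadicFormalScheme V π) where
  /-- the ideal of `O_(Z_n)` -/
  ideal : ∀ n, (X.obj n).IdealSheafData
  compat : ∀ n, (ideal (n + 1)).comap (X.trans n) = ideal n

namespace IdealSystem

/-- The ideal of sections over an affine open subset. -/
def sectionIdeal (I : X.IdealSystem) (U : X.Open) (hU : U.IsAffine) : Ideal (X.sections U) :=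
  ⨅ n, ((I.ideal n).ideal ⟨U.carrier n, hU n⟩).comap (X.reduction U n)

/-- An admissible ideal: over every affine open subset it contains a power of `π` and it is of
finite type modulo powers of `π`. -/
def Admissible (I : X.IdealSystem) : Prop :=
  ∀ (U : X.Open) (hU : U.IsAffine),
    (∃ N : ℕ, algebraMap V (X.sections U) (π ^ N) ∈ I.sectionIdeal U hU) ∧
    ∀ n, ((I.ideal n).ideal ⟨U.carrier n, hU n⟩).FG

/-- The ideal `O_X · f⁻¹ 𝓘` generated by the inverse image of an ideal of `O_Y`. -/
def pullback (I : Y.IdealSystem) (f : X ⟶ Y) : X.IdealSystem where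
  ideal n := (I.ideal n).comap (f.app n)
  compat n := by
    rw [← Scheme.IdealSheafData.comap_comp, f.trans_comp, Scheme.IdealSheafData.comap_comp,
      I.compat]

end IdealSystem

/-- `b : W ⟶ X` is the admissible formal blow-up of the ideal `𝓘`: over every affine open
`U = Spf R` of `X`, with `I = Γ(U, 𝓘)`, the formal scheme `W` is the `π`-adic completion of the
blow-up `Proj (⨁ I ^ n)` of `Spec R`, i.e. `W_n` restricted to `U_n = Spec (R / π ^ (n + 1))` is,
compatibly in `n`, the reduction modulo `π ^ (n + 1)` of `Proj (⨁ I ^ n)`. -/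
def IsFormalBlowup (I : X.IdealSystem) {W : PadicFormalScheme V π} (b : W ⟶ X) : Prop :=
  ∀ (U : X.Open) (hU : U.IsAffine),
    ∃ e : ∀ n, ((U.preimage b).carrier n).toScheme ⟶ affineBlowup (I.sectionIdeal U hU),
      (∀ n, (W.trans n).resLE ((U.preimage b).carrier (n + 1)) ((U.preimage b).carrier n)
          ((U.preimage b).compat n).ge ≫ e (n + 1) = e n) ∧
      ∀ n, IsPullback (e n) (b.app n ∣_ U.carrier n)
        (affineBlowupToSpec (I.sectionIdeal U hU))
        ((U.carrier n).toSpecΓ ≫ Spec.map (CommRingCat.ofHom (X.reduction U n)))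

/-! ## Normalisation in the generic fibre -/

/-- The integral closure of `R = Γ(U, O_X)` in `R[1/π]`. -/
abbrev genericIntegralClosure (X : PadicFormalScheme V π) (U : X.Open) :
    Subalgebra (X.sections U) (Localization.Away (algebraMap V (X.sections U) π)) :=
  integralClosure (X.sections U) (Localization.Away (algebraMap V (X.sections U) π))

/-- `f : N ⟶ X` is the normalisation of `X` in its generic fibre: it is affine, and over every
affine open `U = Spf R` of `X` the scheme `N_n` is the spectrum of `R' / π ^ (n + 1) R'`, where
`R'` is the integral closure of `R` in `R[1/π]`. -/
structure IsGenericNormalization {N : PadicFormalScheme V π} (f : N ⟶ X) : Prop where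
  isAffine : IsAffineMor f
  chart : ∀ U : X.Open, U.IsAffine →
    ∃ θ : X.genericIntegralClosure U →+* N.sections (U.preimage f),
      θ.comp (algebraMap (X.sections U) (X.genericIntegralClosure U)) = sectionsMap f U ∧
      ∀ n, Function.Surjective ((N.reduction (U.preimage f) n).comp θ) ∧
        RingHom.ker ((N.reduction (U.preimage f) n).comp θ) =
          Ideal.span {algebraMap (X.sections U) (X.genericIntegralClosure U)
            (algebraMap V (X.sections U) (π ^ (n + 1)))}

/-- `p : N ⟶ X` is the normalisation in its generic fibre of the admissible formal blow-up of
the ideal `𝓘`. -/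
def IsNormalizedBlowup (I : X.IdealSystem) {N : PadicFormalScheme V π} (p : N ⟶ X) : Prop :=
  ∃ (W : PadicFormalScheme V π) (b : W ⟶ X) (f : N ⟶ W),
    IsFormalBlowup I b ∧ IsGenericNormalization f ∧ p = f ≫ b

end PadicFormalScheme

/-- The part above `i₀` of a projective system. -/
abbrev systemAbove {ι : Type u} [Preorder ι] {C : Type*} [Category C] (Z : ιᵒᵖ ⥤ C) (i₀ : ι) :
    (Set.Ici i₀)ᵒᵖ ⥤ C :=
  Functor.op (Monotone.functor (f := fun i : Set.Ici i₀ => (i : ι)) fun _ _ h => h) ⋙ Z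

end

/-!
# Projective limits of normalised admissible formal blow-ups

The proof characterises every object in sight by a universal property.

*Blow-ups.* The admissible formal blow-up of an open ideal `I` of a torsion-free formal scheme `X`
is universal among the morphisms `t : T ⟶ X` from torsion-free formal schemes `T` along which the
inverse image of `I` becomes locally principal (`IsFormalBlowup.exists_isUniversal`). Locally on
`T` such an inverse image is generated by a section `a` of `I` itself
(`exists_isExceptionalGenerator`), and as it contains a power of `π`, the image of `a` is a
nonzerodivisor; the morphism then factors uniquely through the chart of the blow-up on which `a`
generates the ideal, because this chart is the spectrum of the subring of `R[1/a]` generated by the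
fractions `r / a` with `r ∈ I` (`IsBlowupAlgebra.existsUnique_lift`).

*Normalisation.* The normalisation in the generic fibre is universal among the morphisms from
torsion-free formal schemes that are normal, in the sense that a section `b` is divisible by `π` as
soon as `b / π` is integral (`IsGenericNormalization.isUniversal`). Both conditions on test objects
have formulations in terms of the reductions modulo powers of `π` that are visibly local and can be
checked on a ring before its completion (`LevelTorsionFree`, `LevelNormal`). Composing the two
properties, the normalised blow-up is universal among the morphisms from torsion-free normal formal
schemes that make the ideal locally principal (`IsNormalizedBlowup.existsUnique_hom`). In
particular, the normalised blow-ups of the inverse images of an ideal along a projective system form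
a projective system.

*Limits.* The limit of a projective system with affine transition morphisms is, over an affine open
of the least member, the formal spectrum of the completion of the directed colimit of the rings of
sections (`exists_isUniversalOver_coneModuli`). Torsion-freeness and normality pass to directed
colimits, hence to such limits (`levelTorsionFree_of_isLimit`, `levelNormal_of_isLimit`). The
transition morphisms of the system of normalised blow-ups are affine
(`IsNormalizedBlowup.isAffineMor`): the inverse image of the chart of `a` is the chart of the inverse
image of `a`, and normalisations are affine. So this system has a limit `L`, which is torsion-free
and normal and on which the ideal is locally principal; therefore `L` maps to the normalised blow-up
`M` of the limit, and this map is inverse to the one from `M` to `L` by uniqueness on both sides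
(`nonempty_isLimit_toSystem`).

*Existence.* The same formalism constructs the objects. A `Moduli` problem over `X` that is a sheaf
and is representable over the affine opens of `X` is representable
(`Moduli.IsSheaf.exists_isUniversal`), and over affine opens the representing objects are completions
of the blow-up of a spectrum, of an integral closure, or of a directed colimit. That a formal scheme
has enough affine opens, with good rings of sections, rests on the invariance of affineness under
square-zero thickenings (`isAffineOpen_of_isAffineOpen_preimage`).
-/

noncomputable section

/-! ### Surjections and base change -/

section Pushout

variable {A A' B B' : CommRingCat.{u}} {f : A ⟶ B} {p : A ⟶ A'} {q : B ⟶ B'} {f' : A' ⟶ B'}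

/-- A commutative square of rings whose two parallel sides are surjective is cocartesian as soon
as the kernel of the second is generated by the kernel of the first. -/
theorem isPushout_of_surjective (w : f ≫ q = p ≫ f') (hp : Function.Surjective p.hom)
    (hq : Function.Surjective q.hom)
    (hk : RingHom.ker q.hom ≤ (RingHom.ker p.hom).map f.hom) : IsPushout f p q f' := by
  refine ⟨⟨w⟩, ⟨PushoutCocone.IsColimit.mk w
    (fun s => CommRingCat.ofHom (RingHom.liftOfSurjective q.hom hq ⟨s.inl.hom, ?_⟩)) ?_ ?_ ?_⟩⟩
  · refine hk.trans (Ideal.map_le_iff_le_comap.mpr fun x hx => ?_)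
    have h1 := congr($(s.condition).hom x)
    simp only [CommRingCat.hom_comp, RingHom.comp_apply] at h1
    rw [RingHom.mem_ker] at hx
    rw [Ideal.mem_comap, RingHom.mem_ker, h1, hx, map_zero]
  · intro s
    ext x
    exact RingHom.liftOfRightInverse_comp_apply q.hom _ (Function.rightInverse_surjInv hq) _ x
  · intro s
    ext x
    obtain ⟨y, rfl⟩ := hp x
    have h1 := congr($(s.condition).hom y)
    have h2 := congr(($w).hom y)
    simp only [CommRingCat.hom_comp, RingHom.comp_apply, CommRingCat.hom_ofHom] at h1 h2 ⊢
    rw [← h2, ← h1]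
    exact RingHom.liftOfRightInverse_comp_apply q.hom _ (Function.rightInverse_surjInv hq) _ _
  · intro s m h1 h2
    ext x
    obtain ⟨y, rfl⟩ := hq x
    have h3 := congr(($h1).hom y)
    simp only [CommRingCat.hom_comp, RingHom.comp_apply, CommRingCat.hom_ofHom] at h3 ⊢
    rw [h3]
    exact (RingHom.liftOfRightInverse_comp_apply q.hom _ (Function.rightInverse_surjInv hq)
      ⟨s.inl.hom, _⟩ _).symm

theorem CategoryTheory.IsPushout.surjective_and_ker_eq (h : IsPushout f p q f')
    (hp : Function.Surjective p.hom) :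
    Function.Surjective q.hom ∧ RingHom.ker q.hom = (RingHom.ker p.hom).map f.hom := by
  set K := (RingHom.ker p.hom).map f.hom with hK
  let q₀ : B ⟶ CommRingCat.of (B ⧸ K) := CommRingCat.ofHom (Ideal.Quotient.mk K)
  have hle : RingHom.ker p.hom ≤ RingHom.ker ((Ideal.Quotient.mk K).comp f.hom) := fun x hx => by
    rw [RingHom.mem_ker, RingHom.comp_apply, Ideal.Quotient.eq_zero_iff_mem]
    exact Ideal.mem_map_of_mem _ hx
  let f₀ : A' ⟶ CommRingCat.of (B ⧸ K) := CommRingCat.ofHom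
    (RingHom.liftOfSurjective p.hom hp ⟨(Ideal.Quotient.mk K).comp f.hom, hle⟩)
  have w₀ : f ≫ q₀ = p ≫ f₀ := by
    ext x
    exact (RingHom.liftOfRightInverse_comp_apply p.hom _ (Function.rightInverse_surjInv hp)
      ⟨(Ideal.Quotient.mk K).comp f.hom, hle⟩ _).symm
  have h₀ : IsPushout f p q₀ f₀ :=
    isPushout_of_surjective w₀ hp (Ideal.Quotient.mk_surjective (I := K)) (Ideal.mk_ker (I := K)).le
  have e1 : q₀ ≫ (h₀.isoIsPushout _ _ h).hom = q := IsPushout.inl_isoIsPushout_hom _ _ h₀ h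
  have hs : Function.Surjective q.hom := by
    rw [← e1]
    exact ((h₀.isoIsPushout _ _ h).commRingCatIsoToRingEquiv.surjective).comp
      (Ideal.Quotient.mk_surjective (I := K))
  refine ⟨hs, ?_⟩
  ext x
  have e2 : q.hom x = (h₀.isoIsPushout _ _ h).commRingCatIsoToRingEquiv (Ideal.Quotient.mk K x) := by
    exact congr($(e1.symm).hom x)
  rw [RingHom.mem_ker, e2, EmbeddingLike.map_eq_zero_iff, Ideal.Quotient.eq_zero_iff_mem]

end Pushout

theorem AlgebraicGeometry.Scheme.Opens.le_preimage_top {S T : Scheme.{u}} (s : S ⟶ T)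
    (U : S.Opens) : U ≤ s ⁻¹ᵁ ⊤ := fun _ _ => trivial

/-- The map from the base ring `A` to the sections over `U` of a scheme over `Spec A`. -/
def structMap {A : Type u} [CommRing A] {S : Scheme.{u}} (s : S ⟶ Spec (CommRingCat.of A))
    (U : S.Opens) : A →+* Γ(S, U) :=
  ((Scheme.ΓSpecIso (CommRingCat.of A)).inv ≫ s.appLE ⊤ U (U.le_preimage_top s)).hom

theorem appLE_structMap {A : Type u} [CommRing A] {S S' : Scheme.{u}}
    {s : S ⟶ Spec (CommRingCat.of A)} {s' : S' ⟶ Spec (CommRingCat.of A)} (t : S' ⟶ S)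
    (h : t ≫ s = s') {U : S.Opens} {U' : S'.Opens} (e : U' ≤ t ⁻¹ᵁ U) (x : A) :
    (t.appLE U U' e).hom (structMap s U x) = structMap s' U' x := by
  subst h
  rw [structMap, structMap, ← Scheme.Hom.appLE_comp_appLE t s ⊤ U U' (U.le_preimage_top s) e]
  rfl

theorem map_structMap {A : Type u} [CommRing A] {S : Scheme.{u}}
    (s : S ⟶ Spec (CommRingCat.of A)) {U U' : S.Opens} (e : U' ⟶ U) (x : A) :
    (S.presheaf.map e.op).hom (structMap s U x) = structMap s U' x := by
  rw [structMap, structMap, ← Scheme.Hom.appLE_map s (U.le_preimage_top s) e.op]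
  rfl

theorem structMap_comp_SpecMap {A A' : Type u} [CommRing A] [CommRing A'] {S : Scheme.{u}}
    (s : S ⟶ Spec (CommRingCat.of A')) (φ : A →+* A') (U : S.Opens) (x : A) :
    structMap (s ≫ Spec.map (CommRingCat.ofHom φ)) U x = structMap s U (φ x) := by
  have h : (Scheme.ΓSpecIso (CommRingCat.of A)).inv ≫ (Spec.map (CommRingCat.ofHom φ)).appTop =
    CommRingCat.ofHom φ ≫ (Scheme.ΓSpecIso (CommRingCat.of A')).inv :=
      (Scheme.ΓSpecIso_inv_naturality _).symm
  rw [structMap, structMap, Scheme.Hom.comp_appLE]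
  exact congr(($h ≫ s.appLE ⊤ U (U.le_preimage_top s)).hom x)

/-- Over an affine open of a scheme over `Spec A`, base change along a surjection `φ : A → A'`
is a surjection on sections with kernel generated by the kernel of `φ`. -/
theorem surjective_app_of_isPullback {A A' : Type u} [CommRing A] [CommRing A'] {φ : A →+* A'}
    (hφ : Function.Surjective φ) {S S' : Scheme.{u}} {t : S' ⟶ S}
    {s : S ⟶ Spec (CommRingCat.of A)} {s' : S' ⟶ Spec (CommRingCat.of A')}
    (h : IsPullback t s' s (Spec.map (CommRingCat.ofHom φ))) {U : S.Opens} (hU : IsAffineOpen U) :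
    Function.Surjective (t.app U).hom ∧
      RingHom.ker (t.app U).hom = (RingHom.ker φ).map (structMap s U) := by
  have : IsAffine U.toScheme := hU
  have h1 : IsPullback (t ∣_ U) ((t ⁻¹ᵁ U).ι ≫ s') (U.ι ≫ s) (Spec.map (CommRingCat.ofHom φ)) :=
    ((isPullback_morphismRestrict t U).flip.paste_horiz h.flip).flip
  have h2 := isPushout_appTop_of_isPullback h1
  have h3 : IsPushout (CommRingCat.ofHom (structMap s U)) (CommRingCat.ofHom φ) (t.app U)
      (CommRingCat.ofHom (structMap s' (t ⁻¹ᵁ U))) := by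
    refine h2.of_iso (Scheme.ΓSpecIso _) (asIso (U.ι.appLE U ⊤ U.ι_preimage_self.ge)).symm
      (Scheme.ΓSpecIso _)
      (asIso ((t ⁻¹ᵁ U).ι.appLE (t ⁻¹ᵁ U) ⊤ (t ⁻¹ᵁ U).ι_preimage_self.ge)).symm ?_ ?_ ?_ ?_
    · rw [Iso.symm_hom, Iso.comp_inv_eq, Category.assoc, ← Iso.inv_comp_eq, structMap, CommRingCat.ofHom_hom,
        asIso_hom, Category.assoc, Scheme.Hom.appLE_comp_appLE, Scheme.Hom.appTop,
        ← Scheme.Hom.appLE_eq_app]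
      rfl
    · exact Scheme.ΓSpecIso_naturality _
    · rw [Iso.symm_hom, Iso.comp_inv_eq, Category.assoc, Iso.symm_hom, Iso.eq_inv_comp,
        asIso_hom, asIso_hom, Scheme.Hom.app_eq_appLE, Scheme.Hom.appLE_comp_appLE,
        Scheme.Hom.appTop, ← Scheme.Hom.appLE_eq_app]
      erw [Scheme.Hom.appLE_comp_appLE]
      congr 1
      exact morphismRestrict_ι t U
    · rw [Iso.symm_hom, Iso.comp_inv_eq, Category.assoc, ← Iso.inv_comp_eq, structMap, CommRingCat.ofHom_hom,
        asIso_hom, Category.assoc, Scheme.Hom.appLE_comp_appLE, Scheme.Hom.appTop,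
        ← Scheme.Hom.appLE_eq_app]
      rfl
  exact h3.surjective_and_ker_eq hφ

/-! ### Affineness of square-zero thickenings -/

namespace AlgebraicGeometry.Scheme

/-- Restriction of sections. -/
def res (X : Scheme.{u}) {U V : X.Opens} (h : V ≤ U) : Γ(X, U) →+* Γ(X, V) :=
  (X.presheaf.map (homOfLE h).op).hom

variable {X Y Z : Scheme.{u}}

@[simp]
theorem res_res {U V W : X.Opens} (h : V ≤ U) (h' : W ≤ V) (x : Γ(X, U)) :
    X.res h' (X.res h x) = X.res (h'.trans h) x := by
  have := X.presheaf.map_comp (homOfLE h).op (homOfLE h').op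
  exact congr(($this).hom x).symm

@[simp]
theorem res_appLE (f : X ⟶ Y) {U : Y.Opens} {V W : X.Opens} (h : W ≤ V) (e : V ≤ f ⁻¹ᵁ U)
    (x : Γ(Y, U)) : X.res h ((f.appLE U V e).hom x) = (f.appLE U W (h.trans e)).hom x :=
  congr(($(f.appLE_map e (homOfLE h).op)).hom x)

@[simp]
theorem appLE_res (f : X ⟶ Y) {U U' : Y.Opens} {V : X.Opens} (h : U ≤ U') (e : V ≤ f ⁻¹ᵁ U)
    (x : Γ(Y, U')) : (f.appLE U V e).hom (Y.res h x) =
      (f.appLE U' V (e.trans (f.preimage_mono h))).hom x :=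
  congr(($(f.map_appLE e (homOfLE h).op)).hom x)

@[simp]
theorem appLE_appLE (f : X ⟶ Y) (g : Y ⟶ Z) {U : Z.Opens} {V : Y.Opens} {W : X.Opens}
    (e : V ≤ g ⁻¹ᵁ U) (e' : W ≤ f ⁻¹ᵁ V) (x : Γ(Z, U)) :
    (f.appLE V W e').hom ((g.appLE U V e).hom x) =
      ((f ≫ g).appLE U W (e'.trans (f.preimage_mono e))).hom x :=
  congr(($(Hom.appLE_comp_appLE f g U V W e e')).hom x)

theorem basicOpen_res' {U V : X.Opens} (h : V ≤ U) (x : Γ(X, U)) :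
    X.basicOpen (X.res h x) = V ⊓ X.basicOpen x :=
  X.basicOpen_res x (homOfLE h).op

theorem eq_of_forall_res_eq {U : X.Opens} {x y : Γ(X, U)}
    (H : ∀ p ∈ U, ∃ (V : X.Opens) (h : V ≤ U), p ∈ V ∧ X.res h x = X.res h y) : x = y := by
  choose! V hV hp he using H
  refine TopCat.Sheaf.eq_of_locally_eq' X.sheaf (fun p : U => V p) U
    (fun p => homOfLE (hV p p.2)) ?_ x y fun p => he p p.2
  intro p hpU
  exact TopologicalSpace.Opens.mem_iSup.mpr ⟨⟨p, hpU⟩, hp p hpU⟩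

/-- Sections over the members of an open cover that agree on overlaps glue. -/
theorem exists_glue {ι : Type u} {V : X.Opens} (U : ι → X.Opens) (hU : ∀ i, U i ≤ V)
    (hV : V ≤ ⨆ i, U i) (s : ∀ i, Γ(X, U i))
    (hs : ∀ i j, X.res (inf_le_left : U i ⊓ U j ≤ U i) (s i) =
      X.res (inf_le_right : U i ⊓ U j ≤ U j) (s j)) :
    ∃ t : Γ(X, V), ∀ i, X.res (hU i) t = s i := by
  obtain ⟨t, ht, -⟩ := TopCat.Sheaf.existsUnique_gluing' X.sheaf U V (fun i => homOfLE (hU i))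
    hV s hs
  exact ⟨t, ht⟩

theorem exists_pow_mul_eq_zero_of_res_eq_zero {U V : X.Opens} (hU : IsAffineOpen U)
    {f x : Γ(X, U)} (h : V ≤ U) (hV : V = X.basicOpen f) (hx : X.res h x = 0) :
    ∃ n : ℕ, f ^ n * x = 0 := by
  subst hV
  exact exists_pow_mul_eq_zero_of_res_basicOpen_eq_zero_of_isAffineOpen X hU x f hx

theorem exists_res_eq_pow_mul {U V : X.Opens} (hU : IsAffineOpen U) (f : Γ(X, U)) (h : V ≤ U)
    (hV : V = X.basicOpen f) (y : Γ(X, V)) :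
    ∃ (n : ℕ) (x : Γ(X, U)), X.res h x = X.res h f ^ n * y := by
  subst hV
  have := hU.isLocalization_basicOpen f
  obtain ⟨⟨x, ⟨_, n, rfl⟩⟩, hx⟩ := IsLocalization.surj (Submonoid.powers f) y
  refine ⟨n, x, ?_⟩
  rw [← map_pow, mul_comm]
  exact hx.symm

end AlgebraicGeometry.Scheme

section Thickening

variable {X X' : Scheme.{u}} (j : X ⟶ X')

theorem exists_lift_of_isAffineOpen [IsClosedImmersion j] {U : X'.Opens} (hU : IsAffineOpen U)
    (x : Γ(X, j ⁻¹ᵁ U)) : ∃ y, (j.appLE U (j ⁻¹ᵁ U) le_rfl).hom y = x := by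
  obtain ⟨y, hy⟩ := j.app_surjective U hU x
  exact ⟨y, by rw [← hy, ← Scheme.Hom.appLE_eq_app]⟩

theorem exists_uniform_nat {ι : Type*} [Finite ι] {P : ι → ℕ → Prop}
    (hP : ∀ i m n, m ≤ n → P i m → P i n) (h : ∀ i, ∃ n, P i n) : ∃ n, ∀ i, P i n := by
  choose n hn using h
  have := Fintype.ofFinite ι
  exact ⟨Finset.univ.sup n, fun i => hP i _ _ (Finset.le_sup (Finset.mem_univ i)) (hn i)⟩

theorem preimage_injective_of_surjective (hj : Function.Surjective j) {U V : X'.Opens}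
    (h : j ⁻¹ᵁ U = j ⁻¹ᵁ V) : U = V := by
  ext x
  obtain ⟨y, rfl⟩ := hj x
  exact congr(y ∈ $h).to_iff

variable [IsClosedImmersion j] (hj : Function.Surjective j)
  (hsq : ∀ U : X'.Opens, IsAffineOpen U → ∀ a b : Γ(X', U),
    (j.appLE U (j ⁻¹ᵁ U) le_rfl).hom a = 0 → (j.appLE U (j ⁻¹ᵁ U) le_rfl).hom b = 0 → a * b = 0)

include hj in
/-- The affine opens of a thickening whose traces on the affine open `j ⁻¹ᵁ U` are principal. -/
theorem exists_isAffineOpen_preimage_eq_basicOpen {U : X'.Opens} (hU : IsAffineOpen (j ⁻¹ᵁ U))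
    {x : X'} (hx : x ∈ U) : ∃ (O : X'.Opens) (g : Γ(X, j ⁻¹ᵁ U)), IsAffineOpen O ∧ x ∈ O ∧
      O ≤ U ∧ j ⁻¹ᵁ O = X.basicOpen g := by
  obtain ⟨y, rfl⟩ := hj x
  obtain ⟨_, ⟨W, hW, rfl⟩, hxW, hWU⟩ := X'.isBasis_affineOpens.exists_subset_of_mem_open hx U.2
  obtain ⟨g, hg, hyg⟩ := hU.exists_basicOpen_le (V := j ⁻¹ᵁ W) ⟨y, hxW⟩ hx
  obtain ⟨G, hG⟩ := exists_lift_of_isAffineOpen j hW (X.res (j.preimage_mono hWU) g)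
  have e : j ⁻¹ᵁ X'.basicOpen G = X.basicOpen g := by
    rw [Scheme.preimage_basicOpen, Scheme.Hom.app_eq_appLE, hG, Scheme.basicOpen_res',
      inf_eq_right.mpr hg]
  exact ⟨X'.basicOpen G, g, hW.basicOpen G, show y ∈ j ⁻¹ᵁ X'.basicOpen G by rwa [e],
    (X'.basicOpen_le G).trans hWU, e⟩

include hj hsq in
/-- Sections lift along a square-zero thickening over an open with affine trace: this is the
vanishing of the first Čech cohomology of the ideal of the thickening. -/
theorem exists_lift_of_isAffineOpen_preimage {U : X'.Opens} (hU : IsAffineOpen (j ⁻¹ᵁ U))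
    (c : Γ(X, j ⁻¹ᵁ U)) : ∃ y, (j.appLE U (j ⁻¹ᵁ U) le_rfl).hom y = c := by
  classical
  have hUc : IsCompact (U : Set X') := by
    have : (U : Set X') = j '' (j ⁻¹ᵁ U) := by
      rw [Scheme.Hom.coe_preimage, Set.image_preimage_eq _ hj]
    rw [this]
    exact hU.isCompact.image j.continuous
  choose! O' g' hO' hxO' hO'U hg' using
    fun x hx => exists_isAffineOpen_preimage_eq_basicOpen j hj hU (x := x) hx
  obtain ⟨t, ht⟩ := hUc.elim_finite_subcover (fun x : U => (O' x : Set X')) (fun x => (O' x).2)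
    fun x hx => Set.mem_iUnion.mpr ⟨⟨x, hx⟩, hxO' x hx⟩
  let ι := {x // x ∈ t}
  let O : ι → X'.Opens := fun i => O' i.1
  let g : ι → Γ(X, j ⁻¹ᵁ U) := fun i => g' i.1
  have hO : ∀ i, IsAffineOpen (O i) := fun i => hO' _ i.1.2
  have hOU : ∀ i, O i ≤ U := fun i => hO'U _ i.1.2
  have hg : ∀ i, j ⁻¹ᵁ O i = X.basicOpen (g i) := fun i => hg' _ i.1.2
  have hcov : ∀ x ∈ U, ∃ i, x ∈ O i := fun x hx => by
    obtain ⟨y, hy, h⟩ := Set.mem_iUnion₂.mp (ht hx)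
    exact ⟨⟨y, hy⟩, h⟩
  have hspan : ∀ N, ∃ b : ι → Γ(X, j ⁻¹ᵁ U), ∑ l, b l * g l ^ N = 1 := by
    intro N
    have h1 : Ideal.span (Set.range g) = ⊤ := by
      rw [← hU.self_le_iSup_basicOpen_iff]
      intro x hx
      obtain ⟨i, hi⟩ := hcov _ hx
      exact TopologicalSpace.Opens.mem_iSup.mpr ⟨⟨g i, i, rfl⟩, (hg i).le hi⟩
    have h2 := Ideal.span_pow_eq_top (Set.range g) h1 N
    rw [← Set.range_comp, Ideal.eq_top_iff_one, Ideal.mem_span_range_iff_exists_fun] at h2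
    exact h2
  let κ : ∀ W : X'.Opens, Γ(X', W) →+* Γ(X, j ⁻¹ᵁ W) := fun W => (j.appLE W (j ⁻¹ᵁ W) le_rfl).hom
  have hκ : ∀ {W W' : X'.Opens} (h : W' ≤ W) (x), κ W' (X'.res h x) =
      X.res (j.preimage_mono h) (κ W x) := fun h x => by simp [κ]
  have hκb : ∀ {W : X'.Opens} (x : Γ(X', W)), j ⁻¹ᵁ X'.basicOpen x = X.basicOpen (κ W x) :=
    fun x => by rw [Scheme.preimage_basicOpen, Scheme.Hom.app_eq_appLE]
  -- two lifts of the same section act in the same way on the ideal of the thickening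
  have hact : ∀ {W : X'.Opens} (_ : IsAffineOpen W) {x y k : Γ(X', W)}, κ W x = κ W y →
      κ W k = 0 → x * k = y * k := fun hW x y k h hk => by
    rw [← sub_eq_zero, ← sub_mul]
    exact hsq _ hW _ _ (by rw [map_sub]; exact sub_eq_zero.mpr h) hk
  -- `L i a` is a lift over `O i` of the section `a`
  choose L hL using fun i a => exists_lift_of_isAffineOpen j (hO i)
    (X.res (j.preimage_mono (hOU i)) a)
  change ∀ i a, κ _ (L i a) = _ at hL
  have hW : ∀ i k, O i ⊓ O k = X'.basicOpen (L i (g k)) := fun i k => by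
    apply preimage_injective_of_surjective j hj
    rw [hκb, hL, Scheme.basicOpen_res', ← hg, Scheme.Hom.preimage_inf]
  have hWa : ∀ i k, IsAffineOpen (O i ⊓ O k) := fun i k => hW i k ▸ (hO i).basicOpen _
  -- after multiplication by `g l ^ N`, the difference of the lifts `L i c` and `L l c` over
  -- `O i ∩ O l` extends to a section `h i l` over `O i` in the ideal of the thickening
  obtain ⟨N, hN⟩ := exists_uniform_nat (ι := ι × ι) (P := fun p n => ∃ h : Γ(X', O p.1),
      κ _ h = 0 ∧ X'.res inf_le_left h = X'.res inf_le_left (L p.1 (g p.2)) ^ n *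
        (X'.res (inf_le_left : O p.1 ⊓ O p.2 ≤ _) (L p.1 c) - X'.res inf_le_right (L p.2 c))) (by
    rintro p m n hmn ⟨h, hh, e⟩
    refine ⟨L p.1 (g p.2) ^ (n - m) * h, by rw [map_mul, hh, mul_zero], ?_⟩
    rw [map_mul, e, map_pow, ← mul_assoc, ← pow_add, Nat.sub_add_cancel hmn]) (by
    rintro ⟨i, k⟩
    obtain ⟨n, h, e⟩ := Scheme.exists_res_eq_pow_mul (hO i) (L i (g k)) inf_le_left (hW i k)
      (X'.res (inf_le_left : O i ⊓ O k ≤ _) (L i c) - X'.res inf_le_right (L k c))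
    obtain ⟨m, hm⟩ := Scheme.exists_pow_mul_eq_zero_of_res_eq_zero ((hO i).preimage j)
      (f := κ _ (L i (g k))) (x := κ _ h) (V := j ⁻¹ᵁ (O i ⊓ O k)) (j.preimage_mono inf_le_left)
      (by rw [← hκb, hW]) (by rw [← hκ (inf_le_left : O i ⊓ O k ≤ O i), e, map_mul, map_sub, hκ, hκ, hL, hL]; simp)
    refine ⟨m + n, L i (g k) ^ m * h, by rw [map_mul, map_pow, hm], ?_⟩
    rw [map_mul, e, map_pow, ← mul_assoc, ← pow_add])
  choose h hh he using fun i k => hN (i, k)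
  dsimp only at h hh he
  -- over `O i ∩ O k`, and up to a power of `g l`, the corrections `h i l` and `h k l` differ by
  -- `g l ^ N` times the difference of the lifts `L i c` and `L k c`
  obtain ⟨m, hm⟩ := exists_uniform_nat (ι := ι × ι × ι) (P := fun p m =>
      X'.res (inf_le_left : O p.1 ⊓ O p.2.1 ≤ _) (L p.1 (g p.2.2)) ^ m *
      (X'.res inf_le_left (h p.1 p.2.2) - X'.res inf_le_right (h p.2.1 p.2.2) -
        X'.res inf_le_left (L p.1 (g p.2.2)) ^ N *
        (X'.res inf_le_left (L p.1 c) - X'.res inf_le_right (L p.2.1 c))) = 0) (by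
    rintro p m n hmn e
    rw [← Nat.sub_add_cancel hmn, pow_add, mul_assoc, e, mul_zero]) (by
    rintro ⟨i, k, l⟩
    have eV : O i ⊓ O k ⊓ O l =
        X'.basicOpen (X'.res (inf_le_left : O i ⊓ O k ≤ _) (L i (g l))) := by
      rw [Scheme.basicOpen_res', ← hW]
      ext x
      simp only [TopologicalSpace.Opens.coe_inf, Set.mem_inter_iff]
      tauto
    refine Scheme.exists_pow_mul_eq_zero_of_res_eq_zero (hWa i k) (V := O i ⊓ O k ⊓ O l)
      inf_le_left eV ?_
    have e1 := congr(X'.res (le_inf (inf_le_left.trans inf_le_left) inf_le_right :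
      O i ⊓ O k ⊓ O l ≤ O i ⊓ O l) $(he i l))
    have e2 := congr(X'.res (le_inf (inf_le_left.trans inf_le_right) inf_le_right :
      O i ⊓ O k ⊓ O l ≤ O k ⊓ O l) $(he k l))
    have hW3 : IsAffineOpen (O i ⊓ O k ⊓ O l) := eV ▸ (hWa i k).basicOpen _
    simp only [map_mul, map_sub, map_pow, Scheme.res_res] at e1 e2 ⊢
    have e3 := hact hW3 (x := X'.res (inf_le_left.trans inf_le_right) (L k (g l)) ^ N)
      (y := X'.res (inf_le_left.trans inf_le_left) (L i (g l)) ^ N)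
      (k := X'.res (inf_le_left.trans inf_le_right) (L k c) - X'.res inf_le_right (L l c))
      (by simp [hκ, hL]) (by simp [hκ, hL])
    rw [e1, e2]
    linear_combination - e3)
  obtain ⟨b, hb⟩ := hspan (m + N)
  -- `h i l` corrects `L i c` after multiplication by a power of `g l`; a partition of unity
  -- combines these into a correction of `L i c` itself
  let k : ∀ i, Γ(X', O i) := fun i => ∑ l, L i (b l) * L i (g l) ^ m * h i l
  have hk : ∀ i, κ _ (k i) = 0 := fun i => by
    simp only [k, map_sum, map_mul, hh, mul_zero, Finset.sum_const_zero]
  have hke : ∀ i l, X'.res (inf_le_left : O i ⊓ O l ≤ _) (k i) - X'.res inf_le_right (k l) =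
      X'.res inf_le_left (L i c) - X'.res inf_le_right (L l c) := by
    intro i p
    simp only [k, map_sum, map_mul, map_pow, ← Finset.sum_sub_distrib]
    have e0 : κ (O i ⊓ O p) (X'.res inf_le_left (L i c) - X'.res inf_le_right (L p c)) = 0 := by
      simp [hκ, hL]
    calc _ = ∑ l, X'.res (inf_le_left : O i ⊓ O p ≤ _) (L i (b l) * L i (g l) ^ (m + N)) *
          (X'.res inf_le_left (L i c) - X'.res inf_le_right (L p c)) := by
          refine Finset.sum_congr rfl fun l _ => ?_
          have e3 := hact (hWa i p) (x := X'.res inf_le_right (L p (b l) * L p (g l) ^ m))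
            (y := X'.res inf_le_left (L i (b l) * L i (g l) ^ m)) (k := X'.res inf_le_right (h p l))
            (by simp [hκ, hL]) (by simp [hκ, hh])
          have e4 := hm (i, p, l)
          simp only [map_mul, map_pow, pow_add] at e3 e4 ⊢
          linear_combination - e3 + X'.res (inf_le_left : O i ⊓ O p ≤ _) (L i (b l)) * e4
      _ = 1 * (X'.res inf_le_left (L i c) - X'.res inf_le_right (L p c)) := by
          rw [← Finset.sum_mul, hact (hWa i p) (y := 1) _ e0]
          rw [map_sum, map_one]
          simp only [hκ, map_mul, map_pow, hL]
          simp only [← map_pow, ← map_mul, ← map_sum, Scheme.res_res, hb, map_one]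
      _ = _ := one_mul _
  obtain ⟨y, hy⟩ := Scheme.exists_glue O hOU (fun x hx => by
    obtain ⟨i, hi⟩ := hcov x hx
    exact TopologicalSpace.Opens.mem_iSup.mpr ⟨i, hi⟩) (fun i => L i c - k i) fun i l => by
      rw [map_sub, map_sub]
      linear_combination - hke i l
  refine ⟨y, Scheme.eq_of_forall_res_eq fun x hx => ?_⟩
  obtain ⟨i, hi⟩ := hcov (j x) hx
  refine ⟨j ⁻¹ᵁ O i, j.preimage_mono (hOU i), hi, ?_⟩
  have := congr(κ _ $(hy i))
  rw [hκ, map_sub, hk, sub_zero, hL] at this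
  exact this

include hj hsq in
/-- An open of a square-zero thickening is affine if its trace is: since sections lift, the
principal opens that are affine are given by sections generating the unit ideal. -/
theorem isAffineOpen_of_isAffineOpen_preimage {U : X'.Opens} (hU : IsAffineOpen (j ⁻¹ᵁ U)) :
    IsAffineOpen U := by
  let κ : ∀ W : X'.Opens, Γ(X', W) →+* Γ(X, j ⁻¹ᵁ W) := fun W => (j.appLE W (j ⁻¹ᵁ W) le_rfl).hom
  have hκb : ∀ {W : X'.Opens} (x : Γ(X', W)), j ⁻¹ᵁ X'.basicOpen x = X.basicOpen (κ W x) :=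
    fun x => by rw [Scheme.preimage_basicOpen, Scheme.Hom.app_eq_appLE]
  have hsurj : Function.Surjective (κ U) := exists_lift_of_isAffineOpen_preimage j hj hsq hU
  have hnil : ∀ a, κ U a = 0 → IsNilpotent a := fun a ha => by
    refine ⟨2, Scheme.eq_of_forall_res_eq fun x hx => ?_⟩
    obtain ⟨O, -, hO, hxO, hOU, -⟩ := exists_isAffineOpen_preimage_eq_basicOpen j hj hU hx
    refine ⟨O, hOU, hxO, ?_⟩
    rw [map_pow, map_zero, sq]
    have : κ O (X'.res hOU a) = 0 := by
      have := congr(X.res (j.preimage_mono hOU) $ha)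
      rw [map_zero] at this
      rw [← this]
      simp [κ]
    exact hsq O hO _ _ this this
  refine isAffineOpen_of_isAffineOpen_basicOpen U {F | IsAffineOpen (X'.basicOpen F)} ?_
    fun F hF => hF
  set s : Set Γ(X', U) := {F | IsAffineOpen (X'.basicOpen F)}
  have h1 : Ideal.span (κ U '' s) = ⊤ := by
    rw [← hU.self_le_iSup_basicOpen_iff]
    intro x hx
    obtain ⟨O, g, hO, hxO, hOU, hg⟩ := exists_isAffineOpen_preimage_eq_basicOpen j hj hU
      (x := j x) hx
    obtain ⟨F, rfl⟩ := hsurj g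
    have e : O = X'.basicOpen F := preimage_injective_of_surjective j hj (by rw [hκb]; exact hg)
    exact TopologicalSpace.Opens.mem_iSup.mpr ⟨⟨_, F, (e ▸ hO :
      IsAffineOpen (X'.basicOpen F)), rfl⟩, (hg.le hxO : _)⟩
  rw [← Ideal.map_span, Ideal.eq_top_iff_one, Ideal.mem_map_iff_of_surjective _ hsurj] at h1
  obtain ⟨a, ha, ha1⟩ := h1
  refine Ideal.eq_top_of_isUnit_mem _ ha ?_
  have := (hnil (a - 1) (by rw [map_sub, ha1, map_one, sub_self])).isUnit_add_one
  rwa [sub_add_cancel] at this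

end Thickening

namespace PadicFormalScheme

variable {V : Type u} [CommRing V] {π : V}

/-! ### Open subsets of a formal scheme -/

theorem truncMap_surjective (n : ℕ) : Function.Surjective (truncMap V π n).hom :=
  Ideal.Quotient.factor_surjective (Ideal.span_singleton_le_span_singleton.mpr
    (pow_dvd_pow π (Nat.le_succ (n + 1))))

theorem mem_ker_truncMap {n : ℕ} {x : TruncRing V π (n + 1)} :
    x ∈ RingHom.ker (truncMap V π n).hom ↔
      ∃ v : V, x = Ideal.Quotient.mk _ (π ^ (n + 1) * v) := by
  obtain ⟨v, rfl⟩ := Ideal.Quotient.mk_surjective x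
  have h : (truncMap V π n).hom (Ideal.Quotient.mk (Ideal.span {π ^ (n + 1 + 1)}) v) =
    Ideal.Quotient.mk (Ideal.span {π ^ (n + 1)}) v := rfl
  rw [RingHom.mem_ker, h, Ideal.Quotient.eq_zero_iff_mem, Ideal.mem_span_singleton]
  constructor
  · rintro ⟨w, rfl⟩
    exact ⟨w, rfl⟩
  · rintro ⟨w, hw⟩
    rw [Ideal.Quotient.mk_eq_mk_iff_sub_mem, Ideal.mem_span_singleton] at hw
    have := (pow_dvd_pow π (Nat.le_succ (n + 1))).trans hw
    exact (dvd_sub_left (dvd_mul_right _ _)).mp this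

theorem mul_eq_zero_of_mem_ker_truncMap {n : ℕ} {x y : TruncRing V π (n + 1)}
    (hx : x ∈ RingHom.ker (truncMap V π n).hom) (hy : y ∈ RingHom.ker (truncMap V π n).hom) :
    x * y = 0 := by
  obtain ⟨v, rfl⟩ := mem_ker_truncMap.mp hx
  obtain ⟨w, rfl⟩ := mem_ker_truncMap.mp hy
  rw [← map_mul, Ideal.Quotient.eq_zero_iff_mem, Ideal.mem_span_singleton]
  exact (pow_dvd_pow π (by omega : n + 1 + 1 ≤ (n + 1) + (n + 1))).trans
    ⟨v * w, by rw [pow_add]; ring⟩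

variable (X : PadicFormalScheme V π)

instance isClosedImmersion_trans (n : ℕ) : IsClosedImmersion (X.trans n) :=
  MorphismProperty.of_isPullback (X.isPullback n).flip
    (IsClosedImmersion.spec_of_surjective _ (truncMap_surjective n))

theorem trans_surjective (n : ℕ) : Function.Surjective (X.trans n) := by
  have : Surjective (Spec.map (truncMap V π n)) := by
    refine ⟨fun x => ?_⟩
    have h : x ∈ Set.range (PrimeSpectrum.comap (truncMap V π n).hom) := by
      rw [range_comap_of_surjective _ _ (truncMap_surjective n)]
      intro y hy
      have := mul_eq_zero_of_mem_ker_truncMap hy hy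
      exact (x.isPrime.mem_or_mem (this ▸ x.asIdeal.zero_mem)).elim id id
    exact h
  have : Surjective (X.trans n) := MorphismProperty.of_isPullback (X.isPullback n).flip this
  exact (X.trans n).surjective

/-- The structure map to the sections over an open of the `n`-th reduction. -/
theorem surjective_trans_app (n : ℕ) {U : (X.obj (n + 1)).Opens} (hU : IsAffineOpen U) :
    Function.Surjective ((X.trans n).app U).hom ∧
      RingHom.ker ((X.trans n).app U).hom =
        (RingHom.ker (truncMap V π n).hom).map (structMap (X.str (n + 1)) U) :=
  surjective_app_of_isPullback (φ := (truncMap V π n).hom) (truncMap_surjective n)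
    (X.isPullback n) hU

theorem mul_eq_zero_of_trans_eq_zero (n : ℕ) (U : (X.obj (n + 1)).Opens) (hU : IsAffineOpen U)
    (a b : Γ(X.obj (n + 1), U)) (ha : ((X.trans n).appLE U (X.trans n ⁻¹ᵁ U) le_rfl).hom a = 0)
    (hb : ((X.trans n).appLE U (X.trans n ⁻¹ᵁ U) le_rfl).hom b = 0) : a * b = 0 := by
  rw [Scheme.Hom.appLE_eq_app] at ha hb
  have ha' : a ∈ RingHom.ker ((X.trans n).app U).hom := ha
  have hb' : b ∈ RingHom.ker ((X.trans n).app U).hom := hb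
  rw [(X.surjective_trans_app n hU).2] at ha' hb'
  have h := Ideal.mul_mem_mul ha' hb'
  rw [← Ideal.map_mul] at h
  have h0 : RingHom.ker (truncMap V π n).hom * RingHom.ker (truncMap V π n).hom = ⊥ := by
    rw [eq_bot_iff, Ideal.mul_le]
    intro x hx y hy
    rw [mul_eq_zero_of_mem_ker_truncMap hx hy]
    exact Submodule.zero_mem _
  rwa [h0, Ideal.map_bot, Ideal.mem_bot] at h

variable {X}

namespace Open

instance : PartialOrder X.Open where
  le U U' := ∀ n, U.carrier n ≤ U'.carrier n
  le_refl U n := le_rfl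
  le_trans _ _ _ h h' n := (h n).trans (h' n)
  le_antisymm U U' h h' := by
    have : U.carrier = U'.carrier := funext fun n => le_antisymm (h n) (h' n)
    cases U; cases U'; congr

theorem mem_carrier_succ (U : X.Open) (n : ℕ) (x : X.obj n) :
    X.trans n x ∈ U.carrier (n + 1) ↔ x ∈ U.carrier n := by
  conv_rhs => rw [← U.compat n]
  rfl

theorem le_of_carrier_le {U U' : X.Open} (n : ℕ) (h : U.carrier n ≤ U'.carrier n) : U ≤ U' := by
  have down : ∀ n, U.carrier (n + 1) ≤ U'.carrier (n + 1) → U.carrier n ≤ U'.carrier n :=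
    fun n h x hx => (U'.mem_carrier_succ n x).mp (h ((U.mem_carrier_succ n x).mpr hx))
  have up : ∀ n, U.carrier n ≤ U'.carrier n → U.carrier (n + 1) ≤ U'.carrier (n + 1) := by
    intro n h x hx
    obtain ⟨y, rfl⟩ := X.trans_surjective n x
    exact (U'.mem_carrier_succ n y).mpr (h ((U.mem_carrier_succ n y).mp hx))
  have h0 : U.carrier 0 ≤ U'.carrier 0 := by
    induction n with
    | zero => exact h
    | succ n ih => exact ih (down n h)
  intro m
  induction m with
  | zero => exact h0
  | succ m ih => exact up m ih

theorem eq_of_carrier_eq {U U' : X.Open} (n : ℕ) (h : U.carrier n = U'.carrier n) : U = U' :=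
  le_antisymm (le_of_carrier_le n h.le) (le_of_carrier_le n h.ge)

theorem exists_point (n : ℕ) (x : X.obj n) :
    ∃ y : X.obj 0, ∀ U : X.Open, x ∈ U.carrier n ↔ y ∈ U.carrier 0 := by
  induction n with
  | zero => exact ⟨x, fun _ => Iff.rfl⟩
  | succ n ih =>
    obtain ⟨z, rfl⟩ := X.trans_surjective n x
    obtain ⟨y, hy⟩ := ih z
    exact ⟨y, fun U => (U.mem_carrier_succ n z).trans (hy U)⟩

/-- The open subset of the formal scheme with given trace on the special fibre. -/
def ofZero (U : (X.obj 0).Opens) : X.Open where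
  carrier n := Nat.rec (motive := fun n => (X.obj n).Opens) U (fun n W =>
    ⟨X.trans n '' W, by
      rw [← compl_compl (X.trans n '' (W : Set (X.obj n))),
        ← Set.image_compl_eq ⟨(X.trans n).isClosedEmbedding.injective, X.trans_surjective n⟩]
      exact ((X.trans n).isClosedEmbedding.isClosedMap _ W.2.isClosed_compl).isOpen_compl⟩) n
  compat n := by
    ext x
    exact (X.trans n).isClosedEmbedding.injective.mem_set_image

theorem exists_carrier_eq (n : ℕ) (W : (X.obj n).Opens) : ∃ U : X.Open, U.carrier n = W := by
  induction n with
  | zero => exact ⟨ofZero W, rfl⟩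
  | succ n ih =>
    obtain ⟨U, hU⟩ := ih (X.trans n ⁻¹ᵁ W)
    exact ⟨U, preimage_injective_of_surjective (X.trans n) (X.trans_surjective n)
      ((U.compat n).trans hU)⟩

/-- An open of a formal scheme is affine as soon as its trace on the special fibre is. -/
theorem isAffine_of_zero {U : X.Open} (h : IsAffineOpen (U.carrier 0)) : U.IsAffine := by
  intro n
  induction n with
  | zero => exact h
  | succ n ih =>
    exact isAffineOpen_of_isAffineOpen_preimage (X.trans n) (X.trans_surjective n)
      (X.mul_eq_zero_of_trans_eq_zero n) (by rwa [U.compat n])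

theorem isAffine_of_carrier {U : X.Open} (n : ℕ) (h : IsAffineOpen (U.carrier n)) :
    U.IsAffine := by
  refine isAffine_of_zero ?_
  induction n with
  | zero => exact h
  | succ n ih => exact ih (U.compat n ▸ h.preimage (X.trans n))

theorem exists_isAffine_le {U : X.Open} {n : ℕ} {x : X.obj n} (hx : x ∈ U.carrier n) :
    ∃ B : X.Open, B.IsAffine ∧ B ≤ U ∧ x ∈ B.carrier n := by
  obtain ⟨_, ⟨W, hW, rfl⟩, hxW, hWU⟩ :=
    (X.obj n).isBasis_affineOpens.exists_subset_of_mem_open hx (U.carrier n).2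
  obtain ⟨B, rfl⟩ := exists_carrier_eq n W
  exact ⟨B, isAffine_of_carrier n hW, le_of_carrier_le n hWU, hxW⟩

instance : Min X.Open where
  min U U' := ⟨fun n => U.carrier n ⊓ U'.carrier n, fun n => by
    rw [Scheme.Hom.preimage_inf, U.compat, U'.compat]⟩

instance : SemilatticeInf X.Open where
  inf := min
  inf_le_left _ _ _ := inf_le_left
  inf_le_right _ _ _ := inf_le_right
  le_inf _ _ _ h h' n := le_inf (h n) (h' n)

instance : OrderTop X.Open where
  top := ⟨fun _ => ⊤, fun _ => rfl⟩
  le_top _ _ := le_top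

variable {Y Z : PadicFormalScheme V π}

theorem preimage_mono (f : X ⟶ Y) {U U' : Y.Open} (h : U ≤ U') : U.preimage f ≤ U'.preimage f :=
  fun n => (f.app n).preimage_mono (h n)

theorem preimage_comp (f : X ⟶ Y) (g : Y ⟶ Z) (U : Z.Open) :
    U.preimage (f ≫ g) = (U.preimage g).preimage f := rfl

@[simp] theorem preimage_top (f : X ⟶ Y) : (⊤ : Y.Open).preimage f = ⊤ := rfl

end Open

@[simp] theorem comp_app {X Y Z : PadicFormalScheme V π} (f : X ⟶ Y) (g : Y ⟶ Z) (n : ℕ) :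
    Hom.app (f ≫ g) n = f.app n ≫ g.app n := rfl

@[ext] theorem hom_ext {X Y : PadicFormalScheme V π} {f g : X ⟶ Y} (h : ∀ n, f.app n = g.app n) :
    f = g := Hom.ext (funext h)

/-! ### Restriction to open subsets -/

variable (X) in
/-- The formal scheme structure on an open subset. -/
def restrict (U : X.Open) : PadicFormalScheme V π where
  obj n := (U.carrier n).toScheme
  str n := (U.carrier n).ι ≫ X.str n
  trans n := (X.trans n).resLE (U.carrier (n + 1)) (U.carrier n) (U.compat n).ge
  isPullback n := by
    have h : IsPullback ((X.trans n).resLE (U.carrier (n + 1)) (U.carrier n) (U.compat n).ge)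
        (U.carrier n).ι (U.carrier (n + 1)).ι (X.trans n) :=
      IsOpenImmersion.isPullback _ _ _ _ (by simp) (by simp [U.compat])
    exact h.paste_vert (X.isPullback n)

/-- The inclusion of an open subset. -/
def ι (U : X.Open) : X.restrict U ⟶ X where
  app n := (U.carrier n).ι
  trans_comp n := ((X.trans n).resLE_comp_ι (U := U.carrier (n + 1)) (V := U.carrier n)
    (U.compat n).ge)
  comp_str _ := rfl

instance (U : X.Open) (n : ℕ) : IsOpenImmersion ((ι U).app n) :=
  inferInstanceAs (IsOpenImmersion (U.carrier n).ι)

theorem opensRange_ι_app (U : X.Open) (n : ℕ) : ((ι U).app n).opensRange = U.carrier n :=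
  (U.carrier n).opensRange_ι

/-- Morphisms that are open immersions modulo every power of `π`. -/
class IsOpenImm {X Y : PadicFormalScheme V π} (f : X ⟶ Y) : Prop where
  app : ∀ n, IsOpenImmersion (f.app n)

attribute [instance] IsOpenImm.app

instance (U : X.Open) : IsOpenImm (ι U) := ⟨inferInstance⟩

instance {X Y : PadicFormalScheme V π} (f : X ⟶ Y) [IsOpenImm f] : Mono f where
  right_cancellation g h e := by
    ext n : 2
    exact (cancel_mono (f.app n)).mp congr(Hom.app $e n)

/-- The image of an open immersion. -/
def opensRange {X Y : PadicFormalScheme V π} (f : X ⟶ Y) [IsOpenImm f] : Y.Open where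
  carrier n := (f.app n).opensRange
  compat n := by
    ext x
    constructor
    · rintro ⟨y, hy⟩
      obtain ⟨z, rfl⟩ := X.trans_surjective n y
      rw [← Scheme.Hom.comp_apply, f.trans_comp, Scheme.Hom.comp_apply] at hy
      exact ⟨z, (Y.trans n).isClosedEmbedding.injective hy⟩
    · rintro ⟨z, rfl⟩
      refine ⟨X.trans n z, ?_⟩
      rw [← Scheme.Hom.comp_apply, f.trans_comp, Scheme.Hom.comp_apply]

@[simp] theorem opensRange_ι (U : X.Open) : opensRange (ι U) = U :=
  Open.eq_of_carrier_eq 0 (opensRange_ι_app U 0)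

theorem range_app_subset {S T : PadicFormalScheme V π} (j : S ⟶ X) [IsOpenImm j] (f : T ⟶ X)
    (h : (opensRange j).preimage f = ⊤) (n : ℕ) :
    Set.range (f.app n) ⊆ Set.range (j.app n) := by
  rintro _ ⟨x, rfl⟩
  have : x ∈ ((opensRange j).preimage f).carrier n := by rw [h]; trivial
  exact this

/-- Morphisms whose image lies in the image of an open immersion factor through it. -/
def lift {S T : PadicFormalScheme V π} (j : S ⟶ X) [IsOpenImm j] (f : T ⟶ X)
    (h : (opensRange j).preimage f = ⊤) : T ⟶ S where
  app n := IsOpenImmersion.lift (j.app n) (f.app n) (range_app_subset j f h n)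
  trans_comp n := by
    rw [← cancel_mono (j.app (n + 1)), Category.assoc, IsOpenImmersion.lift_fac, f.trans_comp,
      Category.assoc, j.trans_comp, IsOpenImmersion.lift_fac_assoc]
  comp_str n := by
    rw [← f.comp_str, ← j.comp_str, IsOpenImmersion.lift_fac_assoc]

@[simp]
theorem lift_comp {S T : PadicFormalScheme V π} (j : S ⟶ X) [IsOpenImm j] (f : T ⟶ X)
    (h : (opensRange j).preimage f = ⊤) : lift j f h ≫ j = f := by
  ext n : 2
  exact IsOpenImmersion.lift_fac _ _ _

theorem preimage_opensRange_self {S : PadicFormalScheme V π} (j : S ⟶ X) [IsOpenImm j] :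
    (opensRange j).preimage j = ⊤ := by
  refine Open.eq_of_carrier_eq 0 ?_
  ext x
  exact ⟨fun _ => trivial, fun _ => ⟨x, rfl⟩⟩

@[simp] theorem preimage_ι_self (U : X.Open) : U.preimage (ι U) = ⊤ := by
  have := preimage_opensRange_self (ι U)
  rwa [opensRange_ι] at this

theorem preimage_ι_eq_top {U U' : X.Open} (h : U ≤ U') : U'.preimage (ι U) = ⊤ :=
  top_le_iff.mp ((preimage_ι_self U).ge.trans (Open.preimage_mono _ h))

theorem preimage_eq_top_of_le {T : PadicFormalScheme V π} {f : T ⟶ X} {U U' : X.Open}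
    (h : U ≤ U') (hU : U.preimage f = ⊤) : U'.preimage f = ⊤ :=
  top_le_iff.mp (hU.ge.trans (Open.preimage_mono _ h))

theorem preimage_comp_eq_top {S T : PadicFormalScheme V π} {f : T ⟶ X} (g : S ⟶ T) {U : X.Open}
    (hU : U.preimage f = ⊤) : U.preimage (g ≫ f) = ⊤ := by
  rw [Open.preimage_comp, hU, Open.preimage_top]

/-- The inclusion of an open subset into a larger one. -/
def incl {U U' : X.Open} (h : U ≤ U') : X.restrict U ⟶ X.restrict U' :=
  lift (ι U') (ι U) (by rw [opensRange_ι]; exact preimage_ι_eq_top h)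

@[simp] theorem incl_ι {U U' : X.Open} (h : U ≤ U') : incl h ≫ ι U' = ι U := lift_comp _ _ _

@[simp] theorem incl_incl {U U' U'' : X.Open} (h : U ≤ U') (h' : U' ≤ U'') :
    incl h ≫ incl h' = incl (h.trans h') := by
  simp [← cancel_mono (ι U'')]

/-- The restriction of a morphism over an open subset of the target. -/
def restrictHom {T : PadicFormalScheme V π} (f : T ⟶ X) (U : X.Open) :
    T.restrict (U.preimage f) ⟶ X.restrict U :=
  lift (ι U) (ι _ ≫ f) (by rw [opensRange_ι, Open.preimage_comp, preimage_ι_self])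

@[simp] theorem restrictHom_ι {T : PadicFormalScheme V π} (f : T ⟶ X) (U : X.Open) :
    restrictHom f U ≫ ι U = ι (U.preimage f) ≫ f := lift_comp _ _ _

end PadicFormalScheme

namespace PadicFormalScheme

variable {V : Type u} [CommRing V] {π : V}

/-! ### Gluing morphisms -/

/-- An open cover of a formal scheme by opens indexed by a preordered set, such that the
intersection of two members is covered by smaller members. -/
structure DirectedCover (T : PadicFormalScheme V π) (K : Type u) [Preorder K] where
  /-- the members of the cover -/
  opens : K → T.Open
  mono : Monotone opens
  covers : ∀ x : T.obj 0, ∃ k, x ∈ (opens k).carrier 0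
  directed : ∀ k k' (x : T.obj 0), x ∈ (opens k).carrier 0 → x ∈ (opens k').carrier 0 →
    ∃ l, l ≤ k ∧ l ≤ k' ∧ x ∈ (opens l).carrier 0

namespace DirectedCover

variable {T : PadicFormalScheme V π} {K : Type u} [Preorder K] (c : DirectedCover T K)

include c in
theorem exists_mem (n : ℕ) (x : T.obj n) : ∃ k, x ∈ (c.opens k).carrier n := by
  obtain ⟨y, hy⟩ := Open.exists_point n x
  obtain ⟨k, hk⟩ := c.covers y
  exact ⟨k, (hy _).mpr hk⟩

/-- The induced open cover of the `n`-th reduction. -/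
def openCover (n : ℕ) : (T.obj n).OpenCover where
  I₀ := K
  X k := (T.restrict (c.opens k)).obj n
  f k := (ι (c.opens k)).app n
  mem₀ := by
    rw [Scheme.presieve₀_mem_precoverage_iff]
    refine ⟨fun x => ?_, inferInstance⟩
    obtain ⟨k, hk⟩ := c.exists_mem n x
    exact ⟨k, ⟨x, hk⟩, rfl⟩

theorem level_hom_ext {n : ℕ} {W : Scheme.{u}} {f g : T.obj n ⟶ W}
    (h : ∀ k, (ι (c.opens k)).app n ≫ f = (ι (c.opens k)).app n ≫ g) : f = g :=
  (c.openCover n).hom_ext _ _ h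

instance (n : ℕ) : Preorder (c.openCover n).I₀ := inferInstanceAs (Preorder K)

theorem incl_app_ι_app {U U' : T.Open} (h : U ≤ U') (n : ℕ) :
    (incl h).app n ≫ (ι U').app n = (ι U).app n :=
  congr(Hom.app $(incl_ι h) n)

instance {U U' : T.Open} (h : U ≤ U') (n : ℕ) : IsOpenImmersion ((incl h).app n) := by
  have : IsOpenImmersion ((incl h).app n ≫ (ι U').app n) := by
    rw [incl_app_ι_app]; infer_instance
  exact IsOpenImmersion.of_comp _ ((ι U').app n)

theorem opensRange_incl_app {U U' : T.Open} (h : U ≤ U') (n : ℕ) :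
    ((incl h).app n).opensRange = (ι U').app n ⁻¹ᵁ U.carrier n := by
  ext x
  have hy : ∀ y, (ι U').app n ((incl h).app n y) = (ι U).app n y := fun y => by
    rw [← Scheme.Hom.comp_apply, incl_app_ι_app]
  constructor
  · rintro ⟨y, rfl⟩
    change (ι U').app n ((incl h).app n y) ∈ U.carrier n
    rw [hy]
    exact y.2
  · intro hx
    exact ⟨⟨(ι U').app n x, hx⟩, ((ι U').app n).isOpenEmbedding.injective (hy _)⟩

theorem exists_lift_eq {n : ℕ} {i j : K} (x : (pullback ((ι (c.opens i)).app n)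
    ((ι (c.opens j)).app n) : Scheme.{u})) :
    ∃ (k : K) (hi : k ≤ i) (hj : k ≤ j) (y : (T.restrict (c.opens k)).obj n),
      pullback.lift ((incl (c.mono hi)).app n) ((incl (c.mono hj)).app n)
        (by rw [incl_app_ι_app, incl_app_ι_app]) y = x := by
  obtain ⟨y, hy⟩ := Open.exists_point n ((ι (c.opens i)).app n (pullback.fst ((ι (c.opens i)).app n) ((ι (c.opens j)).app n) x))
  have h1 : (ι (c.opens i)).app n (pullback.fst ((ι (c.opens i)).app n) ((ι (c.opens j)).app n) x) ∈ (c.opens i).carrier n :=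
    (pullback.fst ((ι (c.opens i)).app n) ((ι (c.opens j)).app n) x).2
  have h2 : (ι (c.opens i)).app n (pullback.fst ((ι (c.opens i)).app n) ((ι (c.opens j)).app n) x) ∈ (c.opens j).carrier n := by
    rw [← Scheme.Hom.comp_apply, pullback.condition, Scheme.Hom.comp_apply]
    exact (pullback.snd ((ι (c.opens i)).app n) ((ι (c.opens j)).app n) x).2
  obtain ⟨l, hi, hj, hl⟩ := c.directed i j y ((hy _).mp h1) ((hy _).mp h2)
  refine ⟨l, hi, hj, ⟨_, (hy _).mpr hl⟩, ?_⟩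
  apply (pullback.fst ((ι (c.opens i)).app n) _ ≫
    (ι (c.opens i)).app n).isOpenEmbedding.injective
  refine (Scheme.Hom.comp_apply _ _ _).symm.trans ?_
  rw [pullback.lift_fst_assoc, incl_app_ι_app]
  rfl

instance locallyDirected (n : ℕ) : Scheme.Cover.LocallyDirected (c.openCover n) where
  trans {i j} h := (incl (c.mono (leOfHom h))).app n
  trans_id i := by
    refine (cancel_mono ((ι (c.opens i)).app n)).mp ?_
    exact (incl_app_ι_app _ _).trans (Category.id_comp _).symm
  trans_comp {i j k} h h' :=
    (congr(Hom.app $(incl_incl (c.mono (leOfHom h)) (c.mono (leOfHom h'))) n)).symm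
  w h := incl_app_ι_app _ _
  directed x := by
    obtain ⟨k, hi, hj, y, hy⟩ := c.exists_lift_eq x
    exact ⟨k, homOfLE hi, homOfLE hj, y, hy⟩
  property_trans h := inferInstanceAs (IsOpenImmersion ((incl (c.mono (leOfHom h))).app n))

theorem existsUnique_glue {W : PadicFormalScheme V π} (g : ∀ k, T.restrict (c.opens k) ⟶ W)
    (hg : ∀ k k' (h : k ≤ k'), incl (c.mono h) ≫ g k' = g k) :
    ∃! f : T ⟶ W, ∀ k, ι (c.opens k) ≫ f = g k := by
  let F : ∀ n, T.obj n ⟶ W.obj n := fun n =>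
    (c.openCover n).glueMorphismsOfLocallyDirected (fun k => (g k).app n) fun {i j} h =>
      congr(Hom.app $(hg i j (leOfHom h)) n)
  have hF : ∀ k n, (ι (c.opens k)).app n ≫ F n = (g k).app n := fun k n =>
    (c.openCover n).map_glueMorphismsOfLocallyDirected _ _ k
  refine ⟨⟨F, fun n => ?_, fun n => ?_⟩, fun k => ?_, fun f hf => ?_⟩
  · refine c.level_hom_ext fun k => ?_
    rw [← Category.assoc, ← Category.assoc, hF, ← (g k).trans_comp, ← (ι (c.opens k)).trans_comp,
      Category.assoc, hF]
  · refine c.level_hom_ext fun k => ?_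
    rw [← Category.assoc, hF, (g k).comp_str, (ι (c.opens k)).comp_str]
  · ext n : 2
    exact hF k n
  · ext n : 2
    refine c.level_hom_ext fun k => ?_
    rw [← comp_app, hf, hF]

end DirectedCover

/-- Every basis of opens gives a directed cover. -/
def DirectedCover.ofBasis {T : PadicFormalScheme V π} (P : T.Open → Prop)
    (hP : ∀ (U : T.Open) (x : T.obj 0), x ∈ U.carrier 0 → ∃ B ≤ U, x ∈ B.carrier 0 ∧ P B) :
    DirectedCover T {B : T.Open // P B} where
  opens B := B.1
  mono _ _ h := h
  covers x := by
    obtain ⟨B, -, hx, hB⟩ := hP ⊤ x trivial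
    exact ⟨⟨B, hB⟩, hx⟩
  directed B B' x hx hx' := by
    obtain ⟨C, hC, hxC, h⟩ := hP (B.1 ⊓ B'.1) x ⟨hx, hx'⟩
    exact ⟨⟨C, h⟩, hC.trans inf_le_left, hC.trans inf_le_right, hxC⟩

/-- The cover of a formal scheme by its affine opens. -/
def affineCover (X : PadicFormalScheme V π) : DirectedCover X {U : X.Open // U.IsAffine} :=
  .ofBasis _ fun _ _ hx =>
    let ⟨B, hB, hBU, hxB⟩ := Open.exists_isAffine_le hx
    ⟨B, hBU, hxB, hB⟩

/-- The inverse image of a directed cover. -/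
def DirectedCover.preimage {T X : PadicFormalScheme V π} {K : Type u} [Preorder K]
    (c : DirectedCover X K) (f : T ⟶ X) : DirectedCover T K where
  opens k := (c.opens k).preimage f
  mono _ _ h := Open.preimage_mono f (c.mono h)
  covers x := c.covers (f.app 0 x)
  directed k k' x := c.directed k k' (f.app 0 x)

/-! ### Gluing formal schemes over a base -/

section Glue

variable {X : PadicFormalScheme V π} {K : Type u} [Preorder K] (c : DirectedCover X K)
  (G : K ⥤ PadicFormalScheme V π) (p : ∀ k, G.obj k ⟶ X.restrict (c.opens k))
  (hG : ∀ {k k'} (h : k ⟶ k') n, IsPullback ((G.map h).app n) ((p k).app n) ((p k').app n)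
    ((incl (c.mono (leOfHom h))).app n))

/-- The data for gluing the `n`-th reductions: the pieces `G k` are compatibly fibred over the
members of the cover, and cartesian over the inclusions of these. -/
def glueData (n : ℕ) : Scheme.Cover.RelativeGluingData (c.openCover n) where
  functor :=
    { obj := fun k => (G.obj k).obj n
      map := fun h => (G.map h).app n
      map_id := fun k => by
        have := G.map_id k
        exact congr(Hom.app $this n)
      map_comp := fun h h' => by
        have := G.map_comp h h'
        exact congr(Hom.app $this n) }
  natTrans :=
    { app := fun k => (p k).app n
      naturality := fun k k' h => by
        exact (hG h n).w }
  equifibered k k' h := hG h n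

variable {c G p}

/-- The `n`-th reduction of the glued formal scheme. -/
abbrev gluedObj (n : ℕ) : Scheme.{u} := (glueData c G p hG n).glued

/-- The inclusions of the pieces. -/
def gluedι (n : ℕ) (k : K) : (G.obj k).obj n ⟶ gluedObj hG n :=
  colimit.ι (glueData c G p hG n).functor k

instance (n : ℕ) (k : K) : IsOpenImmersion (gluedι hG n k) :=
  (glueData c G p hG n).cover.map_prop k

theorem glued_hom_ext {n : ℕ} {W : Scheme.{u}} {f g : gluedObj hG n ⟶ W}
    (h : ∀ k, gluedι hG n k ≫ f = gluedι hG n k ≫ g) : f = g :=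
  colimit.hom_ext h

theorem map_gluedι {k k' : K} (h : k ⟶ k') (n : ℕ) :
    (G.map h).app n ≫ gluedι hG n k' = gluedι hG n k :=
  colimit.w (glueData c G p hG n).functor h

/-- Morphisms out of the glued scheme. -/
def gluedDesc {n : ℕ} {W : Scheme.{u}} (f : ∀ k, (G.obj k).obj n ⟶ W)
    (hf : ∀ {k k'} (h : k ⟶ k'), (G.map h).app n ≫ f k' = f k) : gluedObj hG n ⟶ W :=
  colimit.desc (glueData c G p hG n).functor
    ⟨W, ⟨f, fun _ _ h => (hf h).trans (Category.comp_id _).symm⟩⟩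

theorem gluedι_desc {n : ℕ} {W : Scheme.{u}} (f : ∀ k, (G.obj k).obj n ⟶ W)
    (hf : ∀ {k k'} (h : k ⟶ k'), (G.map h).app n ≫ f k' = f k) (k : K) :
    gluedι hG n k ≫ gluedDesc hG f hf = f k :=
  colimit.ι_desc _ _

theorem isPullback_gluedι (n : ℕ) (k : K) : IsPullback ((p k).app n) (gluedι hG n k)
    ((ι (c.opens k)).app n) (glueData c G p hG n).toBase :=
  (glueData c G p hG n).isPullback_natTrans_ι_toBase k

theorem preimage_toBase (n : ℕ) (k : K) :
    (glueData c G p hG n).toBase ⁻¹ᵁ (c.opens k).carrier n = (gluedι hG n k).opensRange := by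
  rw [← opensRange_ι_app]
  exact (glueData c G p hG n).toBase_preimage_eq_opensRange_ι k

theorem map_trans_gluedι {k k' : K} (h : k ⟶ k') (n : ℕ) :
    (G.map h).app n ≫ (G.obj k').trans n ≫ gluedι hG (n + 1) k' =
      (G.obj k).trans n ≫ gluedι hG (n + 1) k := by
  rw [← Category.assoc, ← (G.map h).trans_comp, Category.assoc, map_gluedι]

/-- The transition morphisms of the glued formal scheme. -/
def gluedTrans (n : ℕ) : gluedObj hG n ⟶ gluedObj hG (n + 1) :=
  gluedDesc hG (fun k => (G.obj k).trans n ≫ gluedι hG (n + 1) k) fun h => map_trans_gluedι hG h n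

theorem gluedι_trans (n : ℕ) (k : K) : gluedι hG n k ≫ gluedTrans hG n =
    (G.obj k).trans n ≫ gluedι hG (n + 1) k :=
  gluedι_desc hG _ (fun h => map_trans_gluedι hG h n) k

theorem gluedTrans_toBase (n : ℕ) : gluedTrans hG n ≫ (glueData c G p hG (n + 1)).toBase =
    (glueData c G p hG n).toBase ≫ X.trans n := by
  refine glued_hom_ext hG fun k => ?_
  rw [← Category.assoc, gluedι_trans, Category.assoc, ← (isPullback_gluedι hG (n + 1) k).w,
    ← reassoc_of% (isPullback_gluedι hG n k).w, ← (ι (c.opens k)).trans_comp,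
    reassoc_of% (p k).trans_comp]

theorem isPullback_gluedTrans (n : ℕ) (k : K) : IsPullback (gluedι hG n k) ((G.obj k).trans n)
    (gluedTrans hG n) (gluedι hG (n + 1) k) := by
  refine (IsOpenImmersion.isPullback _ _ _ _ (gluedι_trans hG n k) ?_).flip
  rw [← preimage_toBase, ← preimage_toBase, ← Scheme.Hom.comp_preimage, gluedTrans_toBase,
    Scheme.Hom.comp_preimage, (c.opens k).compat]

/-- The structure morphisms of the glued formal scheme. -/
def gluedStr (n : ℕ) : gluedObj hG n ⟶ Spec (TruncRing V π n) :=
  gluedDesc hG (fun k => (G.obj k).str n) fun h => (G.map h).comp_str n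

theorem gluedι_str (n : ℕ) (k : K) : gluedι hG n k ≫ gluedStr hG n = (G.obj k).str n :=
  gluedι_desc hG _ (fun h => (G.map h).comp_str n) k

theorem toBase_str (n : ℕ) : (glueData c G p hG n).toBase ≫ X.str n = gluedStr hG n := by
  refine glued_hom_ext hG fun k => ?_
  rw [← reassoc_of% (isPullback_gluedι hG n k).w, (ι (c.opens k)).comp_str, (p k).comp_str,
    gluedι_str]

/-- The formal scheme glued from the pieces `G k` over the opens of a directed cover. -/
def glued : PadicFormalScheme V π where
  obj := gluedObj hG
  str := gluedStr hG
  trans := gluedTrans hG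
  isPullback n := by
    refine Scheme.isPullback_of_openCover _ _ _ _ (glueData c G p hG (n + 1)).cover fun k => ?_
    let e := (isPullback_gluedTrans hG n k).isoPullback
    refine ((G.obj k).isPullback n).of_iso e (Iso.refl _) (Iso.refl _) (Iso.refl _) ?_ ?_ ?_ ?_
    · exact (Category.comp_id _).trans (isPullback_gluedTrans hG n k).isoPullback_hom_snd.symm
    · refine (Category.comp_id _).trans ?_
      exact (((isPullback_gluedTrans hG n k).isoPullback_hom_fst_assoc _).trans
        (gluedι_str hG n k)).symm
    · exact (Category.comp_id _).trans
        ((Category.id_comp _).trans (gluedι_str hG (n + 1) k)).symm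
    · exact (Category.comp_id _).trans (Category.id_comp _).symm

/-- The inclusions of the pieces into the glued formal scheme. -/
def gluedIncl (k : K) : G.obj k ⟶ glued hG where
  app n := gluedι hG n k
  trans_comp n := (gluedι_trans hG n k).symm
  comp_str n := gluedι_str hG n k

instance (k : K) : IsOpenImm (gluedIncl hG k) :=
  ⟨fun n => inferInstanceAs (IsOpenImmersion (gluedι hG n k))⟩

theorem map_gluedIncl {k k' : K} (h : k ⟶ k') : G.map h ≫ gluedIncl hG k' = gluedIncl hG k := by
  ext n : 2
  exact map_gluedι hG h n

/-- The projection of the glued formal scheme to the base. -/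
def gluedToBase : glued hG ⟶ X where
  app n := (glueData c G p hG n).toBase
  trans_comp n := gluedTrans_toBase hG n
  comp_str n := toBase_str hG n

theorem gluedIncl_toBase (k : K) : gluedIncl hG k ≫ gluedToBase hG = p k ≫ ι (c.opens k) := by
  ext n : 2
  exact (isPullback_gluedι hG n k).w.symm

theorem preimage_gluedToBase (k : K) :
    (c.opens k).preimage (gluedToBase hG) = opensRange (gluedIncl hG k) :=
  Open.eq_of_carrier_eq 0 (preimage_toBase hG 0 k)

end Glue

end PadicFormalScheme

namespace PadicFormalScheme

variable {V : Type u} [CommRing V] {π : V}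

/-! ### Moduli problems over a formal scheme -/

/-- A moduli problem over `X`: a contravariant set-valued functor on formal schemes together with
a natural map to the functor represented by `X`, and a class of formal schemes, stable under open
immersions and of local nature, on which the functor is to be represented. -/
structure Moduli (X : PadicFormalScheme V π) where
  /-- the families over a formal scheme -/
  obj : PadicFormalScheme V π → Type u
  /-- the inverse image of a family -/
  map : ∀ {S T : PadicFormalScheme V π}, (S ⟶ T) → obj T → obj S
  map_id : ∀ {T : PadicFormalScheme V π} (σ : obj T), map (𝟙 T) σ = σ
  map_comp : ∀ {R S T : PadicFormalScheme V π} (f : R ⟶ S) (g : S ⟶ T) (σ : obj T),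
    map (f ≫ g) σ = map f (map g σ)
  /-- the morphism to `X` underlying a family -/
  anchor : ∀ {T : PadicFormalScheme V π}, obj T → (T ⟶ X)
  anchor_map : ∀ {S T : PadicFormalScheme V π} (f : S ⟶ T) (σ : obj T),
    anchor (map f σ) = f ≫ anchor σ
  /-- the class of test objects -/
  IsTest : PadicFormalScheme V π → Prop
  isTest_of_isOpenImm : ∀ {S T : PadicFormalScheme V π} (j : S ⟶ T) [IsOpenImm j],
    IsTest T → IsTest S
  isTest_of_cover : ∀ {T : PadicFormalScheme V π}, (∀ x : T.obj 0,
    ∃ (S : PadicFormalScheme V π) (j : S ⟶ T) (_ : IsOpenImm j),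
      x ∈ (opensRange j).carrier 0 ∧ IsTest S) → IsTest T

namespace Moduli

variable {X : PadicFormalScheme V π} (Φ : Moduli X)

/-- Families can be glued along directed covers. -/
def IsSheaf : Prop :=
  ∀ (T : PadicFormalScheme V π) (K : Type u) [Preorder K] (c : DirectedCover T K)
    (σ : ∀ k, Φ.obj (T.restrict (c.opens k))),
    (∀ k k' (h : k ≤ k'), Φ.map (incl (c.mono h)) (σ k') = σ k) →
    ∃! s : Φ.obj T, ∀ k, Φ.map (ι (c.opens k)) s = σ k

variable {Φ}

theorem IsSheaf.eq_of_forall (hΦ : Φ.IsSheaf) {T : PadicFormalScheme V π} {K : Type u}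
    [Preorder K] (c : DirectedCover T K) {s s' : Φ.obj T}
    (h : ∀ k, Φ.map (ι (c.opens k)) s = Φ.map (ι (c.opens k)) s') : s = s' := by
  obtain ⟨t, -, ht⟩ := hΦ T K c (fun k => Φ.map (ι (c.opens k)) s') fun k k' hk => by
    rw [← Φ.map_comp, incl_ι]
  rw [ht s h, ht s' fun k => rfl]

/-- A family `ξ` over a test object `W` is universal if every family over a test object is
obtained from it by a unique base change. -/
structure IsUniversal {W : PadicFormalScheme V π} (ξ : Φ.obj W) : Prop where
  isTest : Φ.IsTest W
  existsUnique : ∀ (T : PadicFormalScheme V π) (σ : Φ.obj T), Φ.IsTest T →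
    ∃! h : T ⟶ W, Φ.map h ξ = σ

/-- Universality among the families whose underlying morphism factors through the open `U`. -/
structure IsUniversalOver (U : X.Open) {W : PadicFormalScheme V π} (ξ : Φ.obj W) : Prop where
  isTest : Φ.IsTest W
  preimage_anchor : U.preimage (Φ.anchor ξ) = ⊤
  existsUnique : ∀ (T : PadicFormalScheme V π) (σ : Φ.obj T), Φ.IsTest T →
    U.preimage (Φ.anchor σ) = ⊤ → ∃! h : T ⟶ W, Φ.map h ξ = σ

/-- Universality can be checked locally on the test objects. -/
theorem IsSheaf.existsUnique_of_locally (hΦ : Φ.IsSheaf) {W : PadicFormalScheme V π} (ξ : Φ.obj W)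
    {T : PadicFormalScheme V π} (σ : Φ.obj T)
    (H : ∀ (U : T.Open) (x : T.obj 0), x ∈ U.carrier 0 → ∃ B ≤ U, x ∈ B.carrier 0 ∧
      ∃! h : T.restrict B ⟶ W, Φ.map h ξ = Φ.map (ι B) σ) :
    ∃! h : T ⟶ W, Φ.map h ξ = σ := by
  let c := DirectedCover.ofBasis _ H
  have H' : ∀ k, ∃! h : T.restrict (c.opens k) ⟶ W, Φ.map h ξ = Φ.map (ι (c.opens k)) σ :=
    fun k => k.2
  choose g hg hgu using H'
  dsimp only at hg hgu
  obtain ⟨h, hh, hu⟩ := c.existsUnique_glue g fun k k' hk => by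
    refine hgu k _ ?_
    rw [Φ.map_comp, hg, ← Φ.map_comp, incl_ι]
  refine ⟨h, hΦ.eq_of_forall c fun k => ?_, fun h' hh' => hu h' fun k => ?_⟩
  · rw [← Φ.map_comp, hh, hg]
  · refine hgu k _ ?_
    dsimp only at hh'
    rw [Φ.map_comp, hh']

theorem IsUniversalOver.existsUnique_iso {U : X.Open} {W W' : PadicFormalScheme V π}
    {ξ : Φ.obj W} {ξ' : Φ.obj W'} (h : Φ.IsUniversalOver U ξ) (h' : Φ.IsUniversalOver U ξ') :
    ∃ e : W ≅ W', Φ.map e.hom ξ' = ξ := by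
  obtain ⟨f, hf, -⟩ := h'.existsUnique W ξ h.isTest h.preimage_anchor
  obtain ⟨g, hg, -⟩ := h.existsUnique W' ξ' h'.isTest h'.preimage_anchor
  refine ⟨⟨f, g, ?_, ?_⟩, hf⟩
  · exact (h.existsUnique W ξ h.isTest h.preimage_anchor).unique (by rw [Φ.map_comp, hg, hf]) (Φ.map_id _)
  · exact (h'.existsUnique W' ξ' h'.isTest h'.preimage_anchor).unique (by rw [Φ.map_comp, hf, hg]) (Φ.map_id _)

theorem IsUniversalOver.restrict {U U' : X.Open} (hU : U' ≤ U) {W : PadicFormalScheme V π}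
    {ξ : Φ.obj W} (h : Φ.IsUniversalOver U ξ) :
    Φ.IsUniversalOver U' (Φ.map (ι (U'.preimage (Φ.anchor ξ))) ξ) := by
  refine ⟨Φ.isTest_of_isOpenImm (ι _) h.isTest,
    by rw [Φ.anchor_map, Open.preimage_comp, preimage_ι_self], fun T σ hT hσ => ?_⟩
  obtain ⟨g, hg, hu⟩ := h.existsUnique T σ hT (preimage_eq_top_of_le hU hσ)
  have h1 : (U'.preimage (Φ.anchor ξ)).preimage g = ⊤ := by
    rw [← Open.preimage_comp, ← Φ.anchor_map, hg, hσ]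
  refine ⟨lift (ι _) g (by rwa [opensRange_ι]), ?_, fun g' hg' => ?_⟩
  · dsimp only
    rw [← Φ.map_comp, lift_comp, hg]
  · rw [← cancel_mono (ι (U'.preimage (Φ.anchor ξ))), lift_comp]
    refine hu _ ?_
    dsimp only at hg' ⊢
    rw [Φ.map_comp, hg']

theorem IsUniversal.isUniversalOver {W : PadicFormalScheme V π}
    {ξ : Φ.obj W} (h : Φ.IsUniversal ξ) : Φ.IsUniversalOver ⊤ ξ :=
  ⟨h.isTest, rfl, fun T σ hT _ => h.existsUnique T σ hT⟩

theorem isOpenImm_of_isIso {S T : PadicFormalScheme V π} (e : S ≅ T) : IsOpenImm e.hom :=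
  ⟨fun n => by
    have : IsIso (e.hom.app n) := ⟨e.inv.app n, by rw [← comp_app, e.hom_inv_id]; rfl,
      by rw [← comp_app, e.inv_hom_id]; rfl⟩
    infer_instance⟩

/-- The comparison map between universal families over two nested opens is the inclusion of an
open subset. -/
theorem IsUniversalOver.exists_comparison {U U' : X.Open} (hU : U' ≤ U)
    {W W' : PadicFormalScheme V π} {ξ : Φ.obj W} {ξ' : Φ.obj W'} (h : Φ.IsUniversalOver U ξ)
    (h' : Φ.IsUniversalOver U' ξ') (r : W' ⟶ W) (hr : Φ.map r ξ = ξ') :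
    ∃ _ : IsOpenImm r, opensRange r = U'.preimage (Φ.anchor ξ) := by
  obtain ⟨e, he⟩ := h'.existsUnique_iso (h.restrict hU)
  have hr' : r = e.hom ≫ ι _ := (h.existsUnique W' ξ' h'.isTest
    (preimage_eq_top_of_le hU h'.preimage_anchor)).unique hr
    (by rw [Φ.map_comp, he])
  have := isOpenImm_of_isIso e
  have hi : ∀ n, IsIso (e.hom.app n) := fun n => ⟨e.inv.app n, by
    rw [← comp_app, e.hom_inv_id]; rfl, by rw [← comp_app, e.inv_hom_id]; rfl⟩
  subst hr'
  refine ⟨⟨fun n => by rw [comp_app]; infer_instance⟩, Open.eq_of_carrier_eq 0 ?_⟩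
  exact (Scheme.Hom.opensRange_comp_of_isIso (e.hom.app 0) ((ι _).app 0)).trans
    (opensRange_ι_app _ 0)

theorem IsUniversal.exists_comparison {U : X.Open} {W W' : PadicFormalScheme V π} {ξ : Φ.obj W}
    {ξ' : Φ.obj W'} (h : Φ.IsUniversal ξ) (h' : Φ.IsUniversalOver U ξ') :
    ∃ r : W' ⟶ W, Φ.map r ξ = ξ' ∧
      ∃ _ : IsOpenImm r, opensRange r = U.preimage (Φ.anchor ξ) := by
  obtain ⟨r, hr⟩ := (h.existsUnique W' ξ' h'.isTest).exists
  exact ⟨r, hr, h.isUniversalOver.exists_comparison le_top h' r hr⟩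

/-- A sheaf that is representable over every affine open of the base is representable: the local
representing objects, and the universal families over them, are glued along the comparison maps. -/
theorem IsSheaf.exists_isUniversal (hΦ : Φ.IsSheaf)
    (H : ∀ U : X.Open, U.IsAffine →
      ∃ (W : PadicFormalScheme V π) (ξ : Φ.obj W), Φ.IsUniversalOver U ξ) :
    ∃ (W : PadicFormalScheme V π) (ξ : Φ.obj W), Φ.IsUniversal ξ := by
  let K := {U : X.Open // U.IsAffine}
  let c : DirectedCover X K := X.affineCover
  choose W₀ ξ₀ hξ₀ using H
  let W : K → PadicFormalScheme V π := fun k => W₀ k.1 k.2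
  let ξ : ∀ k, Φ.obj (W k) := fun k => ξ₀ k.1 k.2
  have hξ : ∀ k : K, Φ.IsUniversalOver k.1 (ξ k) := fun k => hξ₀ k.1 k.2
  choose r hr using fun (k k' : K) (h : k ≤ k') =>
    ((hξ k').existsUnique (W k) (ξ k) (hξ k).isTest
      (preimage_eq_top_of_le h (hξ k).preimage_anchor)).exists
  have hru : ∀ {T : PadicFormalScheme V π} {k : K} {f g : T ⟶ W k}, Φ.IsTest T →
      Φ.map f (ξ k) = Φ.map g (ξ k) → f = g := fun {T k f g} hT h =>
    ((hξ k).existsUnique T (Φ.map g (ξ k)) hT (by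
      rw [Φ.anchor_map, Open.preimage_comp, (hξ k).preimage_anchor,
        Open.preimage_top])).unique h rfl
  let G : K ⥤ PadicFormalScheme V π :=
    { obj := W
      map := fun {k k'} h => r k k' (leOfHom h)
      map_id := fun k => hru (hξ k).isTest (by rw [hr, Φ.map_id])
      map_comp := fun {k k' k''} h h' => hru (hξ k).isTest (by
        rw [hr, Φ.map_comp, hr, hr]) }
  let p : ∀ k, G.obj k ⟶ X.restrict (c.opens k) := fun k =>
    lift (ι _) (Φ.anchor (ξ k)) (by rw [opensRange_ι]; exact (hξ k).preimage_anchor)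
  have hp : ∀ k, p k ≫ ι _ = Φ.anchor (ξ k) := fun k => lift_comp _ _ _
  have hpn : ∀ k n, (p k).app n ≫ (ι (c.opens k)).app n = (Φ.anchor (ξ k)).app n := fun k n =>
    congr(Hom.app $(hp k) n)
  have hcmp := fun {k k' : K} (h : k ⟶ k') =>
    (hξ k').exists_comparison (leOfHom h) (hξ k) (G.map h) (hr k k' (leOfHom h))
  have hpr : ∀ {k k'} (h : k ⟶ k'), G.map h ≫ p k' = p k ≫ incl (c.mono (leOfHom h)) := by
    intro k k' h
    rw [← cancel_mono (ι (c.opens k')), Category.assoc, Category.assoc, hp, incl_ι, hp]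
    refine (Φ.anchor_map _ _).symm.trans ?_
    exact congrArg _ (hr k k' (leOfHom h))
  have hG : ∀ {k k'} (h : k ⟶ k') n, IsPullback ((G.map h).app n) ((p k).app n) ((p k').app n)
      ((incl (c.mono (leOfHom h))).app n) := by
    intro k k' h n
    obtain ⟨hi, hr⟩ := hcmp h
    refine (IsOpenImmersion.isPullback _ _ _ _ congr(Hom.app $(hpr h) n) ?_).flip
    rw [show ((G.map h).app n).opensRange = _ from congr(Open.carrier $hr n)]
    rw [DirectedCover.opensRange_incl_app, ← Scheme.Hom.comp_preimage, hpn]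
    rfl
  let P := glued hG
  let q : P ⟶ X := gluedToBase hG
  let j : ∀ k, W k ⟶ P := gluedIncl hG
  have hj : ∀ k, IsOpenImm (j k) := fun k => inferInstanceAs (IsOpenImm (gluedIncl hG k))
  have hjr : ∀ k, opensRange (j k) = k.1.preimage q := fun k => (preimage_gluedToBase hG k).symm
  have hjq : ∀ k, j k ≫ q = Φ.anchor (ξ k) := fun k => (gluedIncl_toBase hG k).trans (hp k)
  have hjG : ∀ k k' (h : k ≤ k'), r k k' h ≫ j k' = j k := fun k k' h =>
    map_gluedIncl hG (homOfLE h)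
  -- the universal family over the part of `P` above an affine open of `X`
  let m : ∀ k, P.restrict ((c.preimage q).opens k) ⟶ W k := fun k =>
    lift (j k) (ι _) (by rw [hjr]; exact preimage_ι_self _)
  have hm : ∀ k, m k ≫ j k = ι _ := fun k => lift_comp _ _ _
  obtain ⟨ζ, hζ, -⟩ := hΦ P K (c.preimage q) (fun k => Φ.map (m k) (ξ k)) fun k k' h => by
    rw [← Φ.map_comp, ← hr k k' h, ← Φ.map_comp]
    congr 1
    rw [← cancel_mono (j k'), Category.assoc, Category.assoc, hm, hjG, hm, incl_ι]
  have hjζ : ∀ k, Φ.map (j k) ζ = ξ k := fun k => by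
    let l : W k ⟶ P.restrict ((c.preimage q).opens k) := lift (ι _) (j k) (by
      rw [opensRange_ι]
      have := preimage_opensRange_self (j k)
      rwa [hjr] at this)
    have hl : l ≫ ι _ = j k := lift_comp _ _ _
    have hlm : l ≫ m k = 𝟙 _ := by
      rw [← cancel_mono (j k), Category.assoc, hm, hl, Category.id_comp]
    rw [← hl, Φ.map_comp, hζ, ← Φ.map_comp, hlm, Φ.map_id]
  have hζq : Φ.anchor ζ = q := by
    obtain ⟨_, _, hu⟩ := (c.preimage q).existsUnique_glue (fun k => ι _ ≫ q) fun k k' h => by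
      rw [← Category.assoc, incl_ι]
    rw [hu q fun k => rfl, hu (Φ.anchor ζ) fun k => ?_]
    rw [← Φ.anchor_map, hζ, Φ.anchor_map, ← hjq, ← Category.assoc, hm]
  have hPt : Φ.IsTest P := Φ.isTest_of_cover fun x => by
    obtain ⟨k, hk⟩ := (c.preimage q).exists_mem 0 x
    exact ⟨W k, j k, hj k, by rw [hjr]; exact hk, (hξ k).isTest⟩
  refine ⟨P, ζ, hPt, fun T σ hT => ?_⟩
  -- the classifying maps of the restrictions of `σ` to the inverse images of the affine opens glue
  let d := c.preimage (Φ.anchor σ)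
  have hd : ∀ k : K, k.1.preimage (Φ.anchor (Φ.map (ι (d.opens k)) σ)) = ⊤ := fun k => by
    rw [Φ.anchor_map, Open.preimage_comp]
    exact preimage_ι_self _
  have hTd : ∀ k, Φ.IsTest (T.restrict (d.opens k)) := fun k =>
    Φ.isTest_of_isOpenImm (ι _) hT
  choose h hh hhu using fun k => (hξ k).existsUnique _ _ (hTd k) (hd k)
  dsimp only at hh hhu
  obtain ⟨f, hf, hfu⟩ := d.existsUnique_glue (fun k => h k ≫ j k) fun k k' hk => by
    rw [← hjG k k' hk, ← Category.assoc, ← Category.assoc]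
    congr 1
    refine hru (hTd k) ?_
    rw [Φ.map_comp, hh, Φ.map_comp, hr, hh, ← Φ.map_comp, incl_ι]
  refine ⟨f, hΦ.eq_of_forall d fun k => ?_, fun f' hf' => hfu f' fun k => ?_⟩
  · rw [← Φ.map_comp, hf, Φ.map_comp, hjζ, hh]
  · have hq : f' ≫ q = Φ.anchor σ := by rw [← hζq, ← Φ.anchor_map, hf']
    let l : T.restrict (d.opens k) ⟶ W k := lift (j k) (ι _ ≫ f') (by
      rw [hjr, ← Open.preimage_comp, Category.assoc, hq, Open.preimage_comp]
      exact preimage_ι_self _)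
    have hl : l ≫ j k = ι _ ≫ f' := lift_comp _ _ _
    rw [← hl]
    congr 1
    refine hhu k l ?_
    rw [← hjζ, ← Φ.map_comp, hl, Φ.map_comp, hf']

end Moduli

end PadicFormalScheme

/-! ### Morphisms into affine opens -/

namespace AlgebraicGeometry

theorem IsAffineOpen.exists_appLE_eq {S X : Scheme.{u}} {U : X.Opens} (hU : IsAffineOpen U)
    (φ : Γ(X, U) ⟶ Γ(S, ⊤)) :
    ∃ (f : S ⟶ X) (e : ⊤ ≤ f ⁻¹ᵁ U), f.appLE U ⊤ e = φ := by
  have e1 : ⊤ ≤ (Spec.map φ ≫ hU.fromSpec) ⁻¹ᵁ U := by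
    rw [Scheme.Hom.comp_preimage, hU.fromSpec_preimage_self]
    exact le_rfl
  have e : ⊤ ≤ (S.toSpecΓ ≫ Spec.map φ ≫ hU.fromSpec) ⁻¹ᵁ U := by
    rw [Scheme.Hom.comp_preimage]
    exact (S.toSpecΓ).preimage_mono e1
  refine ⟨S.toSpecΓ ≫ Spec.map φ ≫ hU.fromSpec, e, ?_⟩
  have h1 : hU.fromSpec.appLE U ⊤ hU.fromSpec_preimage_self.ge = (Scheme.ΓSpecIso _).inv := by
    rw [Scheme.Hom.appLE, hU.fromSpec_app_self, Category.assoc, ← Functor.map_comp]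
    exact (congrArg _ (CategoryTheory.Functor.map_id _ _)).trans (Category.comp_id _)
  have h2 : (Spec.map φ ≫ hU.fromSpec).appLE U ⊤ e1 = φ ≫ (Scheme.ΓSpecIso _).inv := by
    rw [← Scheme.Hom.appLE_comp_appLE _ _ U ⊤ ⊤ hU.fromSpec_preimage_self.ge le_rfl, h1,
      Scheme.ΓSpecIso_inv_naturality, Scheme.Hom.appTop, ← Scheme.Hom.appLE_eq_app]
    rfl
  have h3 := S.toSpecΓ_appTop
  rw [Scheme.Hom.appTop, ← Scheme.Hom.appLE_eq_app] at h3
  refine (Scheme.Hom.appLE_comp_appLE (S.toSpecΓ) (Spec.map φ ≫ hU.fromSpec) U ⊤ ⊤ e1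
    le_rfl).symm.trans ?_
  rw [h2, Category.assoc]
  refine (congrArg _ (congrArg _ h3)).trans ?_
  rw [Iso.inv_hom_id, Category.comp_id]

theorem IsAffineOpen.hom_ext {S X : Scheme.{u}} {U : X.Opens} (hU : IsAffineOpen U)
    {f g : S ⟶ X} (hf : ⊤ ≤ f ⁻¹ᵁ U) (hg : ⊤ ≤ g ⁻¹ᵁ U)
    (h : f.appLE U ⊤ hf = g.appLE U ⊤ hg) : f = g := by
  have key : ∀ (f : S ⟶ X) (hf : ⊤ ≤ f ⁻¹ᵁ U), (⊤ : S.Opens).ι ≫ f =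
      (⊤ : S.Opens).toSpecΓ ≫ Spec.map (f.appLE U ⊤ hf) ≫ hU.fromSpec := by
    intro f hf
    rw [Scheme.Opens.toSpecΓ_SpecMap_appLE_assoc, hU.toSpecΓ_fromSpec, Scheme.Hom.resLE_comp_ι]
  have h1 : (⊤ : S.Opens).ι ≫ f = (⊤ : S.Opens).ι ≫ g := by rw [key f hf, key g hg, h]
  exact (cancel_epi S.topIso.hom).mp h1

end AlgebraicGeometry

theorem hom_ext_of_structMap {A : Type u} [CommRing A] {S : Scheme.{u}}
    {s s' : S ⟶ Spec (CommRingCat.of A)} (h : ∀ a, structMap s ⊤ a = structMap s' ⊤ a) :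
    s = s' := by
  refine (isAffineOpen_top (Spec (CommRingCat.of A))).hom_ext (Scheme.Opens.le_preimage_top s ⊤)
    (Scheme.Opens.le_preimage_top s' ⊤) ?_
  rw [← Iso.cancel_iso_inv_left (Scheme.ΓSpecIso (CommRingCat.of A))]
  ext a
  exact h a

theorem AlgebraicGeometry.Scheme.isUnit_res_self_basicOpen (X : Scheme.{u}) {U : X.Opens}
    (f : Γ(X, U)) : IsUnit (X.res (X.basicOpen_le f) f) :=
  RingedSpace.isUnit_res_basicOpen X.toLocallyRingedSpace.toRingedSpace f

/-! ### Level conditions on schemes over `V` -/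

section Level

variable {V : Type u} [CommRing V]

/-- Along the morphism `t : S ⟶ S'` of schemes over `V`, the sections killed by `π` become zero.
If `S` and `S'` are the reductions of an affine formal scheme modulo `π ^ (n + 1)` and
`π ^ (n + 2)`, this expresses the absence of `π`-torsion. -/
def KillsTorsion {S S' : Scheme.{u}} (t : S ⟶ S') (s' : S' ⟶ Spec (CommRingCat.of V)) (π : V) :
    Prop :=
  ∀ (W : S'.Opens) (y : Γ(S', W)), structMap s' W π * y = 0 →
    (t.appLE W (t ⁻¹ᵁ W) le_rfl).hom y = 0

/-- Every section `y` satisfying a homogeneous equation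
`y ^ d + c₁ π y ^ (d - 1) + ⋯ + c_d π ^ d = 0`, i.e. such that `y / π` looks integral, is
annihilated by `π ^ d`. On the reduction modulo `π ^ (d + 1)` of a torsion-free affine formal
scheme, a section is annihilated by `π ^ d` if and only if it is divisible by `π`; in contrast to
divisibility, annihilation can be checked locally. -/
def IsNormalAt {S : Scheme.{u}} (s : S ⟶ Spec (CommRingCat.of V)) (π : V) (d : ℕ) : Prop :=
  ∀ (W : S.Opens) (y : Γ(S, W)) (c : ℕ → Γ(S, W)), c 0 = 1 →
    ∑ i ∈ Finset.range (d + 1), c i * structMap s W π ^ i * y ^ (d - i) = 0 →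
    structMap s W π ^ d * y = 0

theorem res_structMap {S : Scheme.{u}} (s : S ⟶ Spec (CommRingCat.of V)) {U W : S.Opens}
    (h : W ≤ U) (v : V) : S.res h (structMap s U v) = structMap s W v :=
  map_structMap s (homOfLE h) v

/-- The condition `KillsTorsion` can be checked on affine opens covering the target. -/
theorem KillsTorsion.of_affine {S S' : Scheme.{u}} {t : S ⟶ S'}
    {s' : S' ⟶ Spec (CommRingCat.of V)} {π : V}
    (H : ∀ x : S', ∃ U : S'.Opens, x ∈ U ∧ IsAffineOpen U ∧ ∀ y : Γ(S', U),
      structMap s' U π * y = 0 → (t.appLE U (t ⁻¹ᵁ U) le_rfl).hom y = 0) :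
    KillsTorsion t s' π := by
  intro W y hy
  refine Scheme.eq_of_forall_res_eq fun x hx => ?_
  obtain ⟨U, hxU, hU, hUt⟩ := H (t x)
  obtain ⟨f, hf, hxf⟩ := hU.exists_basicOpen_le (V := W) ⟨t x, hx⟩ hxU
  obtain ⟨n, z, hz⟩ := Scheme.exists_res_eq_pow_mul hU f (S'.basicOpen_le f) rfl (S'.res hf y)
  obtain ⟨m, hm⟩ := Scheme.exists_pow_mul_eq_zero_of_res_eq_zero hU
    (x := structMap s' U π * z) (f := f) (S'.basicOpen_le f) rfl (by
      rw [map_mul, hz, res_structMap, mul_left_comm, ← res_structMap s' hf, ← map_mul, hy,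
        map_zero, mul_zero])
  have h0 := hUt (f ^ m * z) (by rw [mul_left_comm]; exact hm)
  refine ⟨t ⁻¹ᵁ S'.basicOpen f, t.preimage_mono hf, hxf, ?_⟩
  have h1 := congr((t.appLE (S'.basicOpen f) (t ⁻¹ᵁ S'.basicOpen f) le_rfl).hom $hz)
  have h2 := congr(S.res (t.preimage_mono (S'.basicOpen_le f)) $h0)
  rw [map_zero] at h2 ⊢
  have hu : IsUnit ((t.appLE (S'.basicOpen f) (t ⁻¹ᵁ S'.basicOpen f) le_rfl).hom
      (S'.res (S'.basicOpen_le f) f)) := (S'.isUnit_res_self_basicOpen f).map _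
  simp only [map_mul, map_pow, Scheme.res_appLE, Scheme.appLE_res] at h1 h2 hu ⊢
  rw [h1, ← mul_assoc, ← pow_add] at h2
  exact (hu.pow _).mul_right_eq_zero.mp h2

theorem IsNormalAt.of_affine {S : Scheme.{u}} {s : S ⟶ Spec (CommRingCat.of V)} {π : V} {d : ℕ}
    (H : ∀ x : S, ∃ U : S.Opens, x ∈ U ∧ IsAffineOpen U ∧ ∀ (y : Γ(S, U)) (c : ℕ → Γ(S, U)),
      c 0 = 1 →
      ∑ i ∈ Finset.range (d + 1), c i * structMap s U π ^ i * y ^ (d - i) = 0 →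
      structMap s U π ^ d * y = 0) :
    IsNormalAt s π d := by
  intro W y c hc hy
  rcases Nat.eq_zero_or_pos d with rfl | hd
  · have h1 : (1 : Γ(S, W)) = 0 := by simpa [hc] using hy
    rw [← mul_one (structMap s W π ^ 0 * y), h1, mul_zero]
  refine Scheme.eq_of_forall_res_eq fun x hx => ?_
  obtain ⟨U, hxU, hU, hUt⟩ := H x
  obtain ⟨f, hf, hxf⟩ := hU.exists_basicOpen_le (V := W) ⟨x, hx⟩ hxU
  refine ⟨_, hf, hxf, ?_⟩
  have hfU := S.basicOpen_le f
  -- a common denominator of `y` and of the coefficients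
  obtain ⟨n, hn⟩ := exists_uniform_nat (ι := Option (Fin (d + 1)))
    (P := fun o n => ∃ z, S.res hfU z = S.res hfU f ^ n * S.res hf (o.elim y fun i => c i)) (by
      rintro o m n hmn ⟨z, hz⟩
      refine ⟨f ^ (n - m) * z, ?_⟩
      rw [map_mul, hz, map_pow, ← mul_assoc, ← pow_add, Nat.sub_add_cancel hmn])
    fun o => Scheme.exists_res_eq_pow_mul hU f hfU rfl _
  obtain ⟨z, hz⟩ := hn none
  choose e he using fun i : Fin (d + 1) => hn (some i)
  dsimp only [Option.elim] at hz he
  let b : ℕ → Γ(S, U) := fun i => if h : i < d + 1 then if i = 0 then 1 else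
    f ^ (n * (i - 1)) * e ⟨i, h⟩ else 0
  have hb : ∀ i ∈ Finset.range (d + 1),
      S.res hfU (b i) = S.res hfU f ^ (n * i) * S.res hf (c i) := by
    intro i hi
    rw [Finset.mem_range] at hi
    simp only [b, dif_pos hi]
    split_ifs with h0
    · rw [h0, hc]; simp
    · obtain ⟨k, rfl⟩ := Nat.exists_eq_succ_of_ne_zero h0
      rw [map_mul, he, map_pow, ← mul_assoc, ← pow_add]
      congr 2
  have hsum : S.res hfU (∑ i ∈ Finset.range (d + 1), b i * structMap s U π ^ i * z ^ (d - i)) =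
      0 := by
    have h1 := congr(S.res hfU f ^ (n * d) * S.res hf $hy)
    rw [map_zero, mul_zero, map_sum, Finset.mul_sum] at h1
    rw [← h1, map_sum]
    refine Finset.sum_congr rfl fun i hi => ?_
    have hi' : n * d = n * i + n * (d - i) := by
      rw [← mul_add, Nat.add_sub_cancel' (Nat.lt_succ_iff.mp (Finset.mem_range.mp hi))]
    simp only [map_mul, map_pow, hb i hi, hz, res_structMap, mul_pow, hi', ← pow_mul, pow_add]
    ring
  obtain ⟨m, hm⟩ := Scheme.exists_pow_mul_eq_zero_of_res_eq_zero hU (f := f) hfU rfl hsum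
  have key := hUt (f ^ m * z) (fun i => f ^ (m * i) * b i) (by simp [b]) (by
    · have h1 := congr(f ^ (m * d - m) * $hm)
      rw [mul_zero, ← mul_assoc, ← pow_add, Nat.sub_add_cancel (Nat.le_mul_of_pos_right m hd),
        Finset.mul_sum] at h1
      rw [← h1]
      refine Finset.sum_congr rfl fun i hi => ?_
      have hi' : m * d = m * i + m * (d - i) := by
        rw [← mul_add, Nat.add_sub_cancel' (Nat.lt_succ_iff.mp (Finset.mem_range.mp hi))]
      rw [hi', pow_add, mul_pow, ← pow_mul]
      ring)
  have h2 := congr(S.res hfU $key)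
  have hu : IsUnit (S.res hfU f) := S.isUnit_res_self_basicOpen f
  simp only [map_mul, map_pow, hz, res_structMap, map_zero] at h2 ⊢
  refine ((hu.pow (m + n)).mul_right_eq_zero).mp ?_
  rw [← h2, pow_add]
  ring

end Level

theorem bijective_appLE_image {S T : Scheme.{u}} (j : S ⟶ T) [IsOpenImmersion j] (W : S.Opens) :
    Function.Bijective (j.appLE (j ''ᵁ W) W (j.preimage_image_eq W).ge).hom := by
  rw [← Scheme.Hom.appIso_hom']
  exact (j.appIso W).commRingCatIsoToRingEquiv.bijective

section Level

variable {V : Type u} [CommRing V] {π : V}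

theorem KillsTorsion.of_isOpenImmersion {S S' S₀ S₀' : Scheme.{u}} {t : S ⟶ S'}
    {s' : S' ⟶ Spec (CommRingCat.of V)} {t₀ : S₀ ⟶ S₀'} {s₀' : S₀' ⟶ Spec (CommRingCat.of V)}
    (j : S₀ ⟶ S) (j' : S₀' ⟶ S') [IsOpenImmersion j'] (w : t₀ ≫ j' = j ≫ t) (hs : j' ≫ s' = s₀')
    (h : KillsTorsion t s' π) : KillsTorsion t₀ s₀' π := by
  intro W y hy
  obtain ⟨z, rfl⟩ := (bijective_appLE_image j' W).2 y
  have hz : structMap s' _ π * z = 0 := (bijective_appLE_image j' W).1 (by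
    rw [map_mul, map_zero, appLE_structMap j' hs, hy])
  have h1 := h _ z hz
  have e : t₀ ⁻¹ᵁ W ≤ j ⁻¹ᵁ (t ⁻¹ᵁ (j' ''ᵁ W)) := by
    rw [← Scheme.Hom.comp_preimage, ← w, Scheme.Hom.comp_preimage, j'.preimage_image_eq]
  have h2 := congr((j.appLE (t ⁻¹ᵁ (j' ''ᵁ W)) (t₀ ⁻¹ᵁ W) e).hom $h1)
  rw [map_zero, Scheme.appLE_appLE] at h2
  rw [Scheme.appLE_appLE]
  simp only [w]
  exact h2

theorem KillsTorsion.of_cover {S S' : Scheme.{u}} {t : S ⟶ S'}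
    {s' : S' ⟶ Spec (CommRingCat.of V)}
    (H : ∀ x : S, ∃ (S₀ S₀' : Scheme.{u}) (t₀ : S₀ ⟶ S₀') (j : S₀ ⟶ S) (j' : S₀' ⟶ S'),
      x ∈ Set.range j ∧ IsOpenImmersion j ∧ t₀ ≫ j' = j ≫ t ∧ KillsTorsion t₀ (j' ≫ s') π) :
    KillsTorsion t s' π := by
  intro W y hy
  refine Scheme.eq_of_forall_res_eq fun x hx => ?_
  obtain ⟨S₀, S₀', t₀, j, j', ⟨x, rfl⟩, hj, w, h⟩ := H x
  have h0 := h (j' ⁻¹ᵁ W) ((j'.appLE W (j' ⁻¹ᵁ W) le_rfl).hom y) (by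
    rw [← appLE_structMap j' rfl (U := W) le_rfl, ← map_mul, hy, map_zero])
  have hle : j ''ᵁ (j ⁻¹ᵁ (t ⁻¹ᵁ W)) ≤ t ⁻¹ᵁ W := by
    rintro _ ⟨z, hz, rfl⟩
    exact hz
  refine ⟨_, hle, ⟨x, hx, rfl⟩, (bijective_appLE_image j _).1 ?_⟩
  rw [Scheme.appLE_appLE] at h0
  simp only [w] at h0
  simp only [Scheme.res_appLE, Scheme.appLE_appLE, map_zero]
  refine Eq.trans ?_ ((congrArg (S₀.res (le_of_eq ?_)) h0).trans (map_zero _))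
  · rw [Scheme.res_appLE]
  · rw [← Scheme.Hom.comp_preimage, ← w, ← Scheme.Hom.comp_preimage]

theorem IsNormalAt.of_isOpenImmersion {S S₀ : Scheme.{u}} {s : S ⟶ Spec (CommRingCat.of V)}
    {s₀ : S₀ ⟶ Spec (CommRingCat.of V)} {d : ℕ} (j : S₀ ⟶ S) [IsOpenImmersion j] (hs : j ≫ s = s₀)
    (h : IsNormalAt s π d) : IsNormalAt s₀ π d := by
  intro W y c hc hy
  obtain ⟨z, rfl⟩ := (bijective_appLE_image j W).2 y
  choose e he using fun i => (bijective_appLE_image j W).2 (c i)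
  have h1 := h _ z e ((bijective_appLE_image j W).1 (by rw [he, hc, map_one]))
    ((bijective_appLE_image j W).1 (by
      rw [map_zero, ← hy, map_sum]
      simp only [map_mul, map_pow, he, appLE_structMap j hs]))
  have h2 := congr((j.appLE (j ''ᵁ W) W (j.preimage_image_eq W).ge).hom $h1)
  simpa only [map_mul, map_pow, appLE_structMap j hs, map_zero] using h2

theorem IsNormalAt.of_cover {S : Scheme.{u}} {s : S ⟶ Spec (CommRingCat.of V)} {d : ℕ}
    (H : ∀ x : S, ∃ (S₀ : Scheme.{u}) (j : S₀ ⟶ S), x ∈ Set.range j ∧ IsOpenImmersion j ∧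
      IsNormalAt (j ≫ s) π d) : IsNormalAt s π d := by
  intro W y c hc hy
  refine Scheme.eq_of_forall_res_eq fun x hx => ?_
  obtain ⟨S₀, j, ⟨x, rfl⟩, hj, h⟩ := H x
  have hle : j ''ᵁ (j ⁻¹ᵁ W) ≤ W := by
    rintro _ ⟨z, hz, rfl⟩
    exact hz
  refine ⟨_, hle, ⟨x, hx, rfl⟩, (bijective_appLE_image j _).1 ?_⟩
  have h1 := h (j ⁻¹ᵁ W) ((j.appLE W (j ⁻¹ᵁ W) le_rfl).hom y)
    (fun i => (j.appLE W (j ⁻¹ᵁ W) le_rfl).hom (c i)) (by simp only [hc, map_one]) (by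
      have := congr((j.appLE W (j ⁻¹ᵁ W) le_rfl).hom $hy)
      simpa only [map_sum, map_mul, map_pow, appLE_structMap j rfl, map_zero] using this)
  simpa only [Scheme.appLE_res, map_mul, map_pow, appLE_structMap j rfl, map_zero] using h1

end Level

/-! ### Rings that are normal with respect to an element -/

/-- The quotient `b / p` is integral over `A` only if it belongs to `A`. The equation of
integrality is multiplied by a power of `p`, so that no localisation enters. -/
def IsNormalWrt {A : Type*} [CommRing A] (p : A) : Prop :=
  ∀ (d : ℕ) (b : A) (c : ℕ → A), c 0 = 1 →
    ∑ i ∈ Finset.range (d + 1), c i * p ^ i * b ^ (d - i) = 0 → p ∣ b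

theorem exists_homogeneous_of_isIntegral {R A : Type*} [CommRing R] [CommRing A] [Algebra R A]
    {x : A} (hx : IsIntegral R x) : ∃ (d : ℕ) (c : ℕ → R), c 0 = 1 ∧
      ∑ i ∈ Finset.range (d + 1), algebraMap R A (c i) * x ^ (d - i) = 0 := by
  obtain ⟨p, hp, hx⟩ := hx
  refine ⟨p.natDegree, fun i => p.coeff (p.natDegree - i), by simpa using hp.leadingCoeff, ?_⟩
  rw [Polynomial.eval₂_eq_sum_range, ← Finset.sum_range_reflect] at hx
  rw [← hx]
  refine Finset.sum_congr rfl fun i hi => ?_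
  simp

theorem isIntegral_of_homogeneous {R A : Type*} [CommRing R] [CommRing A] [Algebra R A]
    {x : A} {d : ℕ} {c : ℕ → R} (hc : c 0 = 1)
    (h : ∑ i ∈ Finset.range (d + 1), algebraMap R A (c i) * x ^ (d - i) = 0) :
    IsIntegral R x := by
  refine ⟨Polynomial.X ^ d + ∑ i ∈ Finset.range d, Polynomial.C (c (d - i)) * Polynomial.X ^ i,
    Polynomial.monic_X_pow_add ?_, ?_⟩
  · refine (Polynomial.degree_sum_le _ _).trans_lt ?_
    rw [Finset.sup_lt_iff (by exact WithBot.bot_lt_coe d)]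
    intro i hi
    exact (Polynomial.degree_C_mul_X_pow_le _ _).trans_lt
      (by exact_mod_cast Finset.mem_range.mp hi)
  · rw [← h, Finset.sum_range_succ', hc, add_comm, ← Finset.sum_range_reflect]
    simp only [Polynomial.eval₂_add, Polynomial.eval₂_pow, Polynomial.eval₂_X,
      Polynomial.eval₂_finsetSum, Polynomial.eval₂_mul, Polynomial.eval₂_C, map_one, one_mul,
      Nat.sub_zero]
    congr 1
    refine Finset.sum_congr rfl fun i hi => ?_
    have := Finset.mem_range.mp hi
    rw [show d - (d - 1 - i) = i + 1 by omega, show d - (i + 1) = d - 1 - i by omega]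

/-- A ring that is normal with respect to the nonzerodivisor `p` is integrally closed in
`A[1/p]`. -/
theorem IsNormalWrt.exists_algebraMap_eq {A : Type*} [CommRing A] {p : A} (hA : IsNormalWrt p)
    (hp : p ∈ nonZeroDivisors A) {L : Type*} [CommRing L] [Algebra A L]
    [IsLocalization.Away p L] {x : L} (hx : IsIntegral A x) : ∃ a, algebraMap A L a = x := by
  have hinj : Function.Injective (algebraMap A L) :=
    IsLocalization.injective L (Submonoid.powers_le.mpr hp)
  have hu : IsUnit (algebraMap A L p) := IsLocalization.Away.algebraMap_isUnit p
  obtain ⟨⟨b, ⟨_, k, rfl⟩⟩, hb⟩ := IsLocalization.surj (Submonoid.powers p) x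
  dsimp only at hb
  rw [map_pow] at hb
  induction k generalizing b with
  | zero => exact ⟨b, by simpa using hb.symm⟩
  | succ k ih =>
    obtain ⟨d, c, hc, h⟩ := exists_homogeneous_of_isIntegral hx
    obtain ⟨b', rfl⟩ := hA d b (fun i => c i * p ^ (k * i)) (by simpa using hc) (by
      apply hinj
      rw [map_zero, map_sum, ← mul_zero (algebraMap A L p ^ ((k + 1) * d)), ← h, Finset.mul_sum]
      refine Finset.sum_congr rfl fun i hi => ?_
      have hi' : (k + 1) * d = k * i + i + (k + 1) * (d - i) := by
        have : d = i + (d - i) :=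
          (Nat.add_sub_cancel' (Nat.lt_succ_iff.mp (Finset.mem_range.mp hi))).symm
        conv_lhs => rw [this]
        ring
      simp only [map_mul, map_pow, ← hb, mul_pow, hi', pow_add, ← pow_mul]
      ring)
    refine ih b' (hu.mul_left_cancel ?_)
    rw [← map_mul, ← hb, pow_succ]
    ring

/-- The integral closure of `R` in `R[1/p]` is normal with respect to `p`. -/
theorem isNormalWrt_integralClosure {R L : Type*} [CommRing R] [CommRing L] [Algebra R L] (p : R)
    [IsLocalization.Away p L] : IsNormalWrt (algebraMap R (integralClosure R L) p) := by
  intro d b c hc h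
  have hu : IsUnit (algebraMap R L p) := IsLocalization.Away.algebraMap_isUnit p
  obtain ⟨u, hu⟩ := hu
  have hx : IsIntegral (integralClosure R L) ((u⁻¹ : Lˣ) * (b : L)) := by
    refine isIntegral_of_homogeneous hc (d := d) ?_
    have h1 := congr((u⁻¹ : Lˣ) ^ d * algebraMap (integralClosure R L) L $h)
    rw [map_zero, mul_zero, map_sum, Finset.mul_sum] at h1
    rw [← h1]
    refine Finset.sum_congr rfl fun i hi => ?_
    have e : (algebraMap (integralClosure R L) L) (algebraMap R (integralClosure R L) p) = u := by
      rw [hu]; rfl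
    have hi' : d = i + (d - i) :=
      (Nat.add_sub_cancel' (Nat.lt_succ_iff.mp (Finset.mem_range.mp hi))).symm
    have h2 : ((u⁻¹ : Lˣ) : L) ^ i * (u : L) ^ i = 1 := by
      rw [← mul_pow, Units.inv_mul, one_pow]
    have h3 : ((u⁻¹ : Lˣ) : L) ^ d = ((u⁻¹ : Lˣ) : L) ^ i * ((u⁻¹ : Lˣ) : L) ^ (d - i) := by
      rw [← pow_add, ← hi']
    simp only [map_mul, map_pow, e, mul_pow, h3]
    change algebraMap (integralClosure R L) L (c i) * (_ * (b : L) ^ (d - i)) =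
      _ * (_ * _ * (b : L) ^ (d - i))
    linear_combination (- algebraMap (integralClosure R L) L (c i) *
      ((u⁻¹ : Lˣ) : L) ^ (d - i) * (b : L) ^ (d - i)) * h2
  have hx' : IsIntegral R ((u⁻¹ : Lˣ) * (b : L)) := isIntegral_trans _ hx
  refine ⟨⟨_, hx'⟩, Subtype.ext ?_⟩
  change (b : L) = algebraMap R L p * ((u⁻¹ : Lˣ) * (b : L))
  rw [← hu, ← mul_assoc, Units.mul_inv, one_mul]

namespace PadicFormalScheme

variable {V : Type u} [CommRing V] {π : V}

/-! ### Sections over affine opens -/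

variable (X : PadicFormalScheme V π)

theorem app_comp_toBase {X Y : PadicFormalScheme V π} (f : X ⟶ Y) (n : ℕ) :
    f.app n ≫ Y.toBase n = X.toBase n := by
  rw [toBase, ← Category.assoc, f.comp_str, toBase]

@[simp]
theorem reduction_algebraMap (U : X.Open) (n : ℕ) (v : V) :
    X.reduction U n (algebraMap V (X.sections U) v) = structMap (X.toBase n) (U.carrier n) v :=
  rfl

theorem transApp_reduction (U : X.Open) (n : ℕ) (x : X.sections U) :
    (X.transApp U n).hom (X.reduction U (n + 1) x) = X.reduction U n x := x.2 n

variable {X} in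
theorem sections_ext {U : X.Open} {x y : X.sections U}
    (h : ∀ n, X.reduction U n x = X.reduction U n y) : x = y :=
  Subtype.ext (funext h)

theorem structMap_pow_eq_zero (n : ℕ) (W : (X.obj n).Opens) :
    structMap (X.toBase n) W (π ^ (n + 1)) = 0 := by
  rw [toBase, structMap_comp_SpecMap]
  have : Ideal.Quotient.mk (Ideal.span {π ^ (n + 1)}) (π ^ (n + 1)) = 0 :=
    Ideal.Quotient.eq_zero_iff_mem.mpr (Ideal.mem_span_singleton_self _)
  rw [this, map_zero]

theorem exists_eq_mul_of_appLE_eq_zero {n : ℕ} {W' : (X.obj (n + 1)).Opens}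
    {W : (X.obj n).Opens} (h : W = X.trans n ⁻¹ᵁ W') (hW : IsAffineOpen W') :
    Function.Surjective ((X.trans n).appLE W' W h.le).hom ∧
    ∀ x, ((X.trans n).appLE W' W h.le).hom x = 0 →
      ∃ y, x = structMap (X.toBase (n + 1)) W' (π ^ (n + 1)) * y := by
  subst h
  rw [Scheme.Hom.appLE_eq_app]
  obtain ⟨h1, h2⟩ := X.surjective_trans_app n hW
  refine ⟨h1, fun x hx => ?_⟩
  have hx' : x ∈ RingHom.ker ((X.trans n).app W').hom := hx
  have hk : RingHom.ker (truncMap V π n).hom ≤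
      Ideal.span {Ideal.Quotient.mk _ (π ^ (n + 1))} := by
    intro z hz
    obtain ⟨v, rfl⟩ := mem_ker_truncMap.mp hz
    rw [map_mul]
    exact Ideal.mul_mem_right _ _ (Ideal.mem_span_singleton_self _)
  rw [h2] at hx'
  have h3 := Ideal.map_mono (f := structMap (X.str (n + 1)) W') hk hx'
  rw [Ideal.map_span, Set.image_singleton, Ideal.mem_span_singleton] at h3
  obtain ⟨y, hy⟩ := h3
  exact ⟨y, by rw [hy, toBase, structMap_comp_SpecMap]⟩

variable {X} {U : X.Open} (hU : U.IsAffine)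

include hU in
theorem transApp_surjective (n : ℕ) : Function.Surjective (X.transApp U n).hom :=
  (X.exists_eq_mul_of_appLE_eq_zero (U.compat n).symm (hU (n + 1))).1

include hU in
theorem exists_eq_mul_of_transApp_eq_zero {n : ℕ} {x : Γ(X.obj (n + 1), U.carrier (n + 1))}
    (hx : (X.transApp U n).hom x = 0) :
    ∃ y, x = structMap (X.toBase (n + 1)) (U.carrier (n + 1)) (π ^ (n + 1)) * y :=
  (X.exists_eq_mul_of_appLE_eq_zero (U.compat n).symm (hU (n + 1))).2 x hx

include hU in
/-- Over an affine open, the sections of the reductions lift to the formal scheme. -/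
theorem reduction_surjective (n : ℕ) : Function.Surjective (X.reduction U n) := by
  have key : ∀ (n : ℕ) (a : Γ(X.obj n, U.carrier n)), ∃ p : ∀ m, Γ(X.obj m, U.carrier m),
      p n = a ∧ ∀ m < n, (X.transApp U m).hom (p (m + 1)) = p m := by
    intro n
    induction n with
    | zero =>
      intro a
      exact ⟨Function.update 0 0 a, by simp, by simp⟩
    | succ n ih =>
      intro a
      obtain ⟨p, hp, hpm⟩ := ih ((X.transApp U n).hom a)
      refine ⟨Function.update p (n + 1) a, by simp, fun m hm => ?_⟩
      rw [Function.update_of_ne (a := m) (by omega)]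
      rcases Nat.lt_succ_iff_lt_or_eq.mp hm with hm | rfl
      · rw [Function.update_of_ne (by omega)]
        exact hpm m hm
      · rw [Function.update_self, hp]
  intro a
  obtain ⟨p, hp, hpm⟩ := key n a
  choose l hl using transApp_surjective hU
  let x : ∀ m, Γ(X.obj m, U.carrier m) := fun m =>
    Nat.rec (motive := fun m => Γ(X.obj m, U.carrier m)) (p 0)
      (fun m y => if m + 1 ≤ n then p (m + 1) else l m y) m
  have hx : ∀ m ≤ n, x m = p m := by
    intro m hm
    cases m with
    | zero => rfl
    | succ m => exact if_pos hm
  refine ⟨⟨x, fun m => ?_⟩, (hx n le_rfl).trans hp⟩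
  by_cases hm : m + 1 ≤ n
  · rw [hx _ hm, hx m (by omega), hpm m hm]
  · have : x (m + 1) = l m (x m) := if_neg hm
    rw [this, hl]

theorem exists_sections {x : ∀ n, Γ(X.obj n, U.carrier n)}
    (hx : ∀ n, (X.transApp U n).hom (x (n + 1)) = x n) :
    ∃ a : X.sections U, ∀ n, X.reduction U n a = x n :=
  ⟨⟨x, hx⟩, fun _ => rfl⟩

theorem reduction_eq_zero_of_le {x : X.sections U} {n m : ℕ} (h : m ≤ n)
    (hx : X.reduction U n x = 0) : X.reduction U m x = 0 := by
  induction n, h using Nat.le_induction with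
  | base => exact hx
  | succ n _ ih => exact ih (by rw [← transApp_reduction, hx, map_zero])

theorem reduction_pow_mul (n k : ℕ) (h : n < k) (x : X.sections U) :
    X.reduction U n (algebraMap V _ (π ^ k) * x) = 0 := by
  obtain ⟨m, rfl⟩ := Nat.exists_eq_add_of_lt h
  rw [map_mul, reduction_algebraMap, show n + m + 1 = (n + 1) + m by omega, pow_add, map_mul,
    structMap_pow_eq_zero, zero_mul, zero_mul]

include hU in
/-- The kernel of the reduction modulo `π ^ (n + 1)` over an affine open. -/
theorem exists_eq_pow_mul_of_reduction_eq_zero {n : ℕ} {x : X.sections U}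
    (hx : X.reduction U n x = 0) : ∃ y, x = algebraMap V _ (π ^ (n + 1)) * y := by
  have step : ∀ (m : ℕ) (x : X.sections U), X.reduction U m x = 0 →
      ∃ y, X.reduction U (m + 1) (x - algebraMap V _ (π ^ (m + 1)) * y) = 0 := by
    intro m x hx
    obtain ⟨y, hy⟩ := exists_eq_mul_of_transApp_eq_zero hU
      ((X.transApp_reduction U m x).trans hx)
    obtain ⟨z, rfl⟩ := reduction_surjective hU (m + 1) y
    exact ⟨z, by rw [map_sub, map_mul, reduction_algebraMap, hy, sub_self]⟩
  -- successive approximations of the quotient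
  have app : ∃ z : ℕ → X.sections U,
      (∀ k, X.reduction U (n + k) (x - algebraMap V _ (π ^ (n + 1)) * z k) = 0) ∧
      ∀ k, ∃ y, z (k + 1) = z k + algebraMap V _ (π ^ k) * y := by
    choose! w hw using step
    let z : ℕ → X.sections U := fun k => Nat.rec 0 (fun k z => z + algebraMap V _ (π ^ k) *
      w (n + k) (x - algebraMap V _ (π ^ (n + 1)) * z)) k
    refine ⟨z, fun k => ?_, fun k => ⟨_, rfl⟩⟩
    induction k with
    | zero => simpa [z] using hx
    | succ k ih =>
      have h1 := hw _ _ ih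
      have e : algebraMap V (X.sections U) (π ^ (n + k + 1)) =
          algebraMap V _ (π ^ (n + 1)) * algebraMap V _ (π ^ k) := by
        rw [← map_mul, ← pow_add, show n + k + 1 = n + 1 + k by omega]
      rw [e, mul_assoc, sub_sub, ← mul_add] at h1
      exact h1
  obtain ⟨z, hz, hzs⟩ := app
  have hst : ∀ m k, m < k → X.reduction U m (z k) = X.reduction U m (z (m + 1)) := by
    intro m k hk
    induction k, hk using Nat.le_induction with
    | base => rfl
    | succ k hk ih =>
      obtain ⟨y, hy⟩ := hzs k
      rw [hy, map_add, reduction_pow_mul m k hk, add_zero, ih]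
  obtain ⟨y, hy⟩ := exists_sections (U := U) (x := fun m => X.reduction U m (z (m + 1)))
    fun m => by rw [transApp_reduction, hst m (m + 1 + 1) (by omega)]
  refine ⟨y, sections_ext fun m => ?_⟩
  have h1 := reduction_eq_zero_of_le (show m ≤ n + (m + 1) by omega) (hz (m + 1))
  rw [map_sub, sub_eq_zero] at h1
  rw [h1, map_mul, map_mul, hy]

theorem isUnit_one_add_mul (x : X.sections U) : IsUnit (1 + algebraMap V _ π * x) := by
  have h1 : ∀ n, IsUnit (X.reduction U n (1 + algebraMap V _ π * x)) := by
    intro n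
    rw [map_add, map_one, map_mul, reduction_algebraMap]
    refine IsNilpotent.isUnit_one_add ⟨n + 1, ?_⟩
    rw [mul_pow, ← map_pow, structMap_pow_eq_zero, zero_mul]
  choose u hu using h1
  obtain ⟨y, hy⟩ := exists_sections (U := U) (x := fun n => ((u n)⁻¹ : (Γ(X.obj n, U.carrier n))ˣ))
    fun n => by
      have h2 : Units.map (X.transApp U n).hom.toMonoidHom (u (n + 1)) = u n := Units.ext (by
        rw [hu, ← transApp_reduction, ← hu]; rfl)
      rw [← h2, ← map_inv]
      rfl
  refine IsUnit.of_mul_eq_one y (sections_ext fun n => ?_)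
  rw [map_mul, hy, ← hu, Units.mul_inv, map_one]

include hU in
theorem isUnit_of_reduction_zero {x : X.sections U} (hx : IsUnit (X.reduction U 0 x)) :
    IsUnit x := by
  obtain ⟨b, hb⟩ := hx.exists_right_inv
  obtain ⟨y, rfl⟩ := reduction_surjective hU 0 b
  obtain ⟨z, hz⟩ := exists_eq_pow_mul_of_reduction_eq_zero hU (n := 0) (x := x * y - 1)
    (by rw [map_sub, map_mul, hb, map_one, sub_self])
  rw [zero_add, pow_one] at hz
  have := isUnit_one_add_mul z
  rw [← hz, add_sub_cancel] at this
  exact isUnit_of_mul_isUnit_left this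

/-! ### Absence of torsion and normality -/

variable (X) in
/-- The level-wise form of the absence of `π`-torsion. -/
def LevelTorsionFree : Prop := ∀ n, KillsTorsion (X.trans n) (X.toBase (n + 1)) π

variable (X) in
/-- The level-wise form of normality with respect to `π`; equations of degree `d` are considered
modulo `π ^ (d + 1)`. -/
def LevelNormal : Prop := ∀ d, IsNormalAt (X.toBase d) π d

theorem LevelTorsionFree.transApp_eq_zero (h : X.LevelTorsionFree) {n : ℕ}
    {x : Γ(X.obj (n + 1), U.carrier (n + 1))}
    (hx : structMap (X.toBase (n + 1)) (U.carrier (n + 1)) π * x = 0) :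
    (X.transApp U n).hom x = 0 := by
  have h1 := congr((X.obj n).res (U.compat n).ge $(h n _ x hx))
  rwa [map_zero, Scheme.res_appLE] at h1

theorem LevelTorsionFree.torsionFree (h : X.LevelTorsionFree) : X.TorsionFree := by
  intro U x hx
  refine sections_ext fun n => ?_
  rw [← transApp_reduction, map_zero]
  refine h.transApp_eq_zero ?_
  have := congr(X.reduction U (n + 1) $hx)
  rwa [Algebra.smul_def, map_mul, reduction_algebraMap, map_zero] at this

theorem TorsionFree.mem_nonZeroDivisors (h : X.TorsionFree) (U : X.Open) :
    algebraMap V (X.sections U) π ∈ nonZeroDivisors (X.sections U) := by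
  refine mem_nonZeroDivisors_iff_right.mpr fun x hx => h U x ?_
  rwa [Algebra.smul_def, mul_comm]

/-- A presentation of an affine open as the formal spectrum of the `π`-adic completion of a
`V`-algebra `B`: a ring homomorphism to the sections inducing isomorphisms of `B / π ^ (n + 1)`
with the sections modulo `π ^ (n + 1)`. -/
structure IsChart (U : X.Open) {B : Type u} [CommRing B] (β : V →+* B) (θ : B →+* X.sections U) :
    Prop where
  isAffine : U.IsAffine
  comp_eq : θ.comp β = algebraMap V (X.sections U)
  surjective : ∀ n, Function.Surjective ((X.reduction U n).comp θ)
  exists_eq_mul : ∀ n b, X.reduction U n (θ b) = 0 → ∃ b', b = β (π ^ (n + 1)) * b'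

include hU in
theorem isChart_id : IsChart U (algebraMap V (X.sections U)) (RingHom.id _) where
  isAffine := hU
  comp_eq := rfl
  surjective := reduction_surjective hU
  exists_eq_mul _ _ hb := exists_eq_pow_mul_of_reduction_eq_zero hU hb

section Chart

variable {B : Type u} [CommRing B] {β : V →+* B} {θ : B →+* X.sections U} (hθ : IsChart U β θ)

include hθ in
theorem IsChart.reduction_base (n : ℕ) (v : V) :
    X.reduction U n (θ (β v)) = structMap (X.toBase n) (U.carrier n) v := by
  rw [← reduction_algebraMap, ← hθ.comp_eq, RingHom.comp_apply]

include hθ in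
theorem IsChart.reduction_base_pow_mul (n k : ℕ) (h : n < k) (b : B) :
    X.reduction U n (θ (β (π ^ k) * b)) = 0 := by
  rw [map_mul, show θ (β (π ^ k)) = algebraMap V _ (π ^ k) from congr($(hθ.comp_eq) (π ^ k)),
    reduction_pow_mul n k h]

include hθ in
theorem IsChart.ker_eq (n : ℕ) :
    RingHom.ker ((X.reduction U n).comp θ) = Ideal.span {β (π ^ (n + 1))} := by
  ext b
  rw [Ideal.mem_span_singleton]
  refine ⟨fun hb => hθ.exists_eq_mul n b hb, ?_⟩
  rintro ⟨b', rfl⟩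
  exact hθ.reduction_base_pow_mul n (n + 1) (by omega) b'

end Chart

/-- A covering by formal spectra of completions of torsion-free rings implies the level-wise
condition. -/
theorem levelTorsionFree_of_charts (H : ∀ x : X.obj 0, ∃ (U : X.Open) (B : Type u)
    (_ : CommRing B) (β : V →+* B) (θ : B →+* X.sections U), x ∈ U.carrier 0 ∧
    IsChart U β θ ∧ β π ∈ nonZeroDivisors B) : X.LevelTorsionFree := by
  intro n
  refine .of_affine fun x => ?_
  obtain ⟨x₀, hx₀⟩ := Open.exists_point (n + 1) x
  obtain ⟨U, B, _, β, θ, hxU, hθ, hπ⟩ := H x₀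
  refine ⟨U.carrier (n + 1), (hx₀ U).mpr hxU, hθ.isAffine (n + 1), fun y hy => ?_⟩
  obtain ⟨z, rfl⟩ := hθ.surjective (n + 1) y
  obtain ⟨w, hw⟩ := hθ.exists_eq_mul (n + 1) (β π * z) (by
    rw [map_mul, map_mul, hθ.reduction_base]; exact hy)
  have hz : z = β (π ^ (n + 1)) * w := by
    refine (mem_nonZeroDivisors_iff_right.mp hπ _ ?_ |> sub_eq_zero.mp :)
    rw [mul_comm, mul_sub, hw, pow_succ', map_mul, mul_assoc, sub_self]
  have h1 : X.reduction U n (θ z) = 0 := by rw [hz, hθ.reduction_base_pow_mul n (n + 1) (by omega)]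
  rw [← transApp_reduction] at h1
  have h2 := congr((X.obj n).res (U.compat n).le $h1)
  rwa [map_zero, transApp, Scheme.res_appLE] at h2

include hU in
theorem LevelNormal.isNormalWrt (h : X.LevelNormal) (hX : X.TorsionFree) :
    IsNormalWrt (algebraMap V (X.sections U) π) := by
  intro d b c hc hb
  have h1 := h d (U.carrier d) (X.reduction U d b) (fun i => X.reduction U d (c i))
    (by simp only [hc, map_one]) (by
      have := congr(X.reduction U d $hb)
      simpa only [map_sum, map_mul, map_pow, reduction_algebraMap, map_zero] using this)
  obtain ⟨w, hw⟩ := exists_eq_pow_mul_of_reduction_eq_zero hU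
    (x := algebraMap V _ (π ^ d) * b) (by rw [map_mul, reduction_algebraMap, map_pow, h1])
  refine ⟨w, sub_eq_zero.mp (mem_nonZeroDivisors_iff_right.mp
    (pow_mem (hX.mem_nonZeroDivisors U) d) _ ?_)⟩
  rw [mul_comm, mul_sub, ← map_pow, hw, pow_succ, map_mul, mul_assoc, sub_self]

/-- A covering by formal spectra of completions of rings that are normal with respect to `π`
implies the level-wise condition. -/
theorem levelNormal_of_charts (H : ∀ x : X.obj 0, ∃ (U : X.Open) (B : Type u)
    (_ : CommRing B) (β : V →+* B) (θ : B →+* X.sections U), x ∈ U.carrier 0 ∧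
    IsChart U β θ ∧ IsNormalWrt (β π)) : X.LevelNormal := by
  intro d
  refine .of_affine fun x => ?_
  obtain ⟨x₀, hx₀⟩ := Open.exists_point d x
  obtain ⟨U, B, _, β, θ, hxU, hθ, hπ⟩ := H x₀
  refine ⟨U.carrier d, (hx₀ U).mpr hxU, hθ.isAffine d, fun y c hc hy => ?_⟩
  obtain ⟨z, rfl⟩ := hθ.surjective d y
  choose e he using fun i => hθ.surjective d (c i)
  simp only [RingHom.comp_apply] at he hy ⊢
  rcases Nat.eq_zero_or_pos d with rfl | hd
  · have h1 : (1 : Γ(X.obj 0, U.carrier 0)) = 0 := by simpa [hc] using hy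
    rw [← mul_one (structMap _ _ π ^ 0 * _), h1, mul_zero]
  -- the equation holds up to a multiple of `π ^ (d + 1)`, which the last coefficient absorbs
  obtain ⟨w, hw⟩ := hθ.exists_eq_mul d
    (∑ i ∈ Finset.range (d + 1), (if i = 0 then 1 else e i) * β π ^ i * z ^ (d - i)) (by
    rw [← hy, map_sum, map_sum]
    refine Finset.sum_congr rfl fun i _ => ?_
    split_ifs with hi
    · subst hi; simp [hc]
    · simp only [map_mul, map_pow, he, hθ.reduction_base])
  obtain ⟨b, rfl⟩ := hπ d z (fun i => if i = 0 then 1 else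
    if i = d then e i - β π * w else e i) (by simp) (by
    rw [Finset.sum_range_succ] at hw ⊢
    have e1 : ∑ i ∈ Finset.range d, (if i = 0 then 1 else
        if i = d then e i - β π * w else e i) * β π ^ i * z ^ (d - i) =
        ∑ i ∈ Finset.range d, (if i = 0 then 1 else e i) * β π ^ i *
          z ^ (d - i) := Finset.sum_congr rfl fun i hi => by
      rw [if_neg (Finset.mem_range.mp hi).ne]
    rw [e1, if_neg hd.ne', if_pos rfl]
    rw [if_neg hd.ne', map_pow] at hw
    simp only [Nat.sub_self, pow_zero, mul_one] at hw ⊢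
    linear_combination hw)
  rw [map_mul, map_mul, hθ.reduction_base, ← mul_assoc, ← pow_succ, ← map_pow,
    structMap_pow_eq_zero, zero_mul]

theorem LevelTorsionFree.of_isOpenImm {S T : PadicFormalScheme V π} (j : S ⟶ T) [IsOpenImm j]
    (h : T.LevelTorsionFree) : S.LevelTorsionFree := fun n =>
  (h n).of_isOpenImmersion (j.app n) (j.app (n + 1)) (j.trans_comp n) (app_comp_toBase j _)

theorem LevelNormal.of_isOpenImm {S T : PadicFormalScheme V π} (j : S ⟶ T) [IsOpenImm j]
    (h : T.LevelNormal) : S.LevelNormal := fun n =>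
  (h n).of_isOpenImmersion (j.app n) (app_comp_toBase j _)

theorem LevelTorsionFree.of_cover {T : PadicFormalScheme V π} (H : ∀ x : T.obj 0,
    ∃ (S : PadicFormalScheme V π) (j : S ⟶ T) (_ : IsOpenImm j), x ∈ (opensRange j).carrier 0 ∧
      S.LevelTorsionFree) : T.LevelTorsionFree := fun n => by
  refine .of_cover fun x => ?_
  obtain ⟨y, hy⟩ := Open.exists_point n x
  obtain ⟨S, j, hj, hx, hS⟩ := H y
  refine ⟨_, _, S.trans n, j.app n, j.app (n + 1), (hy (opensRange j)).mpr hx, inferInstance,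
    j.trans_comp n, ?_⟩
  rw [app_comp_toBase]
  exact hS n

theorem LevelNormal.of_cover {T : PadicFormalScheme V π} (H : ∀ x : T.obj 0,
    ∃ (S : PadicFormalScheme V π) (j : S ⟶ T) (_ : IsOpenImm j), x ∈ (opensRange j).carrier 0 ∧
      S.LevelNormal) : T.LevelNormal := fun n => by
  refine .of_cover fun x => ?_
  obtain ⟨y, hy⟩ := Open.exists_point n x
  obtain ⟨S, j, hj, hx, hS⟩ := H y
  refine ⟨_, j.app n, (hy (opensRange j)).mpr hx, inferInstance, ?_⟩
  rw [app_comp_toBase]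
  exact hS n

end PadicFormalScheme

namespace PadicFormalScheme

variable {V : Type u} [CommRing V] {π : V}

/-! ### Morphisms to affine formal schemes -/

section MapLE

variable {X Y Z : PadicFormalScheme V π}

theorem Open.carrier_le_preimage {f : X ⟶ Y} {U' : Y.Open} {U : X.Open} (e : U ≤ U'.preimage f)
    (n : ℕ) : U.carrier n ≤ f.app n ⁻¹ᵁ U'.carrier n := e n

/-- The map on sections over `U'` and `U` induced by a morphism that sends `U` to `U'`. -/
def mapLE (f : X ⟶ Y) (U' : Y.Open) (U : X.Open) (e : U ≤ U'.preimage f) :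
    Y.sections U' →+* X.sections U :=
  RingHom.codRestrict
    (RingHom.pi fun n => ((f.app n).appLE (U'.carrier n) (U.carrier n)
      (Open.carrier_le_preimage e n)).hom.comp
      (Y.reduction U' n))
    (X.sections U) (fun x n => by
      have h := Y.transApp_reduction U' n x
      have h' := f.trans_comp n
      simp only [RingHom.pi_apply, RingHom.comp_apply]
      rw [← h, transApp, transApp, Scheme.appLE_appLE, Scheme.appLE_appLE]
      simp only [h'])

theorem reduction_mapLE (f : X ⟶ Y) {U' : Y.Open} {U : X.Open} (e : U ≤ U'.preimage f) (n : ℕ)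
    (x : Y.sections U') : X.reduction U n (mapLE f U' U e x) =
      ((f.app n).appLE (U'.carrier n) (U.carrier n)
      (Open.carrier_le_preimage e n)).hom (Y.reduction U' n x) := rfl

theorem sectionsMap_eq_mapLE (f : X ⟶ Y) (U' : Y.Open) :
    sectionsMap f U' = mapLE f U' (U'.preimage f) le_rfl := by
  refine RingHom.ext fun x => sections_ext fun n => ?_
  exact congr($((f.app n).appLE_eq_app (U := U'.carrier n)).hom (Y.reduction U' n x)).symm

theorem mapLE_mapLE (f : X ⟶ Y) (g : Y ⟶ Z) {U : Z.Open} {U' : Y.Open} {U'' : X.Open}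
    (e : U' ≤ U.preimage g) (e' : U'' ≤ U'.preimage f) (x : Z.sections U) :
    mapLE f U' U'' e' (mapLE g U U' e x) =
      mapLE (f ≫ g) U U'' (e'.trans (Open.preimage_mono f e)) x := by
  refine sections_ext fun n => ?_
  simp only [reduction_mapLE, Scheme.appLE_appLE]
  rfl

theorem mapLE_algebraMap (f : X ⟶ Y) {U' : Y.Open} {U : X.Open} (e : U ≤ U'.preimage f) (v : V) :
    mapLE f U' U e (algebraMap V _ v) = algebraMap V _ v := by
  refine sections_ext fun n => ?_
  rw [reduction_mapLE, reduction_algebraMap, reduction_algebraMap,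
    appLE_structMap _ (app_comp_toBase f n)]

theorem mapLE_congr {f g : X ⟶ Y} (h : f = g) {U' : Y.Open} {U : X.Open} (e : U ≤ U'.preimage f)
    (x : Y.sections U') : mapLE f U' U e x = mapLE g U' U (h ▸ e) x := by
  subst h; rfl

end MapLE

section Chart

variable {N : PadicFormalScheme V π} {U : N.Open} {B : Type u} [CommRing B] {β : V →+* B}
  {θ : B →+* N.sections U}

/-- Morphisms to the formal spectrum of the completion of `B` are homomorphisms from `B`. -/
theorem IsChart.existsUnique_hom (hθ : IsChart U β θ) {S : PadicFormalScheme V π}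
    (g : B →+* S.sections ⊤) (hg : g.comp β = algebraMap V _) :
    ∃! h : S ⟶ N, ∃ e : ⊤ ≤ U.preimage h, (mapLE h U ⊤ e).comp θ = g := by
  have hker : ∀ n b, N.reduction U n (θ b) = 0 → S.reduction ⊤ n (g b) = 0 := by
    intro n b hb
    obtain ⟨b', rfl⟩ := hθ.exists_eq_mul n b hb
    rw [map_mul, show g (β (π ^ (n + 1))) = algebraMap V _ (π ^ (n + 1)) from
      congr($hg (π ^ (n + 1))), reduction_pow_mul n (n + 1) (by omega)]
  let φ : ∀ n, Γ(N.obj n, U.carrier n) →+* Γ(S.obj n, ⊤) := fun n =>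
    RingHom.liftOfSurjective ((N.reduction U n).comp θ) (hθ.surjective n)
      ⟨(S.reduction ⊤ n).comp g, fun b hb => hker n b hb⟩
  have hφ : ∀ n b, φ n (N.reduction U n (θ b)) = S.reduction ⊤ n (g b) := fun n b =>
    RingHom.liftOfSurjective_comp_apply ((N.reduction U n).comp θ) (hθ.surjective n)
      ⟨(S.reduction ⊤ n).comp g, fun b hb => hker n b hb⟩ b
  choose f e hf using fun n => (hθ.isAffine n).exists_appLE_eq (CommRingCat.ofHom (φ n))
  have hfr : ∀ n b, ((f n).appLE (U.carrier n) ⊤ (e n)).hom (N.reduction U n (θ b)) =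
      S.reduction ⊤ n (g b) := fun n b => by rw [hf]; exact hφ n b
  have et : ∀ n, (⊤ : (S.obj n).Opens) ≤ (S.trans n ≫ f (n + 1)) ⁻¹ᵁ U.carrier (n + 1) :=
    fun n => by
      rw [Scheme.Hom.comp_preimage]
      exact ((S.trans n).preimage_mono (e (n + 1)))
  have et' : ∀ n, (⊤ : (S.obj n).Opens) ≤ (f n ≫ N.trans n) ⁻¹ᵁ U.carrier (n + 1) :=
    fun n => by
      rw [Scheme.Hom.comp_preimage, U.compat]
      exact e n
  let F : S ⟶ N :=
    { app := f
      trans_comp := fun n => by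
        refine (hθ.isAffine (n + 1)).hom_ext (et n) (et' n) ?_
        ext y
        obtain ⟨b, rfl⟩ := hθ.surjective (n + 1) y
        have h1 := congr((S.transApp ⊤ n).hom $(hfr (n + 1) b))
        rw [transApp_reduction, ← hfr, transApp] at h1
        rw [RingHom.comp_apply]
        have h2 := N.transApp_reduction U n (θ b)
        rw [transApp] at h2
        rw [← h2] at h1
        refine (Scheme.appLE_appLE _ _ (e (n + 1)) le_rfl _).symm.trans (h1.trans ?_)
        exact Scheme.appLE_appLE _ _ (U.compat n).ge (e n) _
      comp_str := fun n => by
        refine hom_ext_of_structMap fun a => ?_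
        obtain ⟨v, rfl⟩ := Ideal.Quotient.mk_surjective a
        rw [← structMap_comp_SpecMap, ← structMap_comp_SpecMap,
          ← appLE_structMap (s := N.toBase n) (f n) (Category.assoc _ _ _).symm (e n),
          ← hθ.reduction_base, hfr, show g (β v) = _ from congr($hg v)]
        rfl }
  refine ⟨F, ⟨fun n => e n, ?_⟩, ?_⟩
  · exact RingHom.ext fun b => sections_ext fun n => hfr n b
  · rintro F' ⟨e', hF'⟩
    ext n : 2
    refine (hθ.isAffine n).hom_ext (e' n) (e n) ?_
    ext y
    obtain ⟨b, rfl⟩ := hθ.surjective n y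
    rw [RingHom.comp_apply]
    exact (congr(S.reduction ⊤ n ($hF' b))).trans (hfr n b).symm

theorem IsChart.hom_ext (hθ : IsChart U β θ) {S : PadicFormalScheme V π} {f g : S ⟶ N}
    (hf : ⊤ ≤ U.preimage f) (hg : ⊤ ≤ U.preimage g)
    (h : ∀ b, mapLE f U ⊤ hf (θ b) = mapLE g U ⊤ hg (θ b)) : f = g := by
  refine (hθ.existsUnique_hom ((mapLE g U ⊤ hg).comp θ) ?_).unique ⟨hf, RingHom.ext h⟩ ⟨hg, rfl⟩
  ext v
  rw [RingHom.comp_assoc, hθ.comp_eq, RingHom.comp_apply, mapLE_algebraMap]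

theorem bijective_appLE_opensRange {S : PadicFormalScheme V π} (j : S ⟶ N) [IsOpenImm j]
    {W : S.Open} {U : N.Open} (h : W = U.preimage j) (hU : U ≤ opensRange j) (n : ℕ) :
    Function.Bijective ((j.app n).appLE (U.carrier n) (W.carrier n)
      (Open.carrier_le_preimage h.le n)).hom := by
  have : U.carrier n = (j.app n) ''ᵁ W.carrier n := by
    subst h
    exact ((j.app n).image_preimage_eq_opensRange_inf (U.carrier n) |>.trans
      (inf_eq_right.mpr (hU n))).symm
  have key := bijective_appLE_image (j.app n) (W.carrier n)
  generalize_proofs at key ⊢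
  revert key
  generalize (j.app n) ''ᵁ W.carrier n = U' at *
  subst this
  exact id

theorem bijective_mapLE_opensRange {S : PadicFormalScheme V π} (j : S ⟶ N) [IsOpenImm j]
    {W : S.Open} {U : N.Open} (h : W = U.preimage j) (hU : U ≤ opensRange j) :
    Function.Bijective (mapLE j U W h.le) := by
  have hb := bijective_appLE_opensRange j h hU
  refine ⟨fun x y hxy => sections_ext fun n => (hb n).1 congr(S.reduction W n $hxy), fun y => ?_⟩
  choose x hx using fun n => (hb n).2 (S.reduction W n y)
  obtain ⟨a, ha⟩ := exists_sections (U := U) (x := x) fun n => (hb n).1 (by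
    rw [hx, ← transApp_reduction, ← hx (n + 1), transApp, transApp, Scheme.appLE_appLE,
      Scheme.appLE_appLE]
    simp only [j.trans_comp n])
  exact ⟨a, sections_ext fun n => by rw [reduction_mapLE, ha, hx]⟩

/-- Charts are transported along open immersions. -/
theorem IsChart.exists_of_isOpenImm {S : PadicFormalScheme V π} (j : S ⟶ N) [IsOpenImm j]
    {θ : B →+* S.sections ⊤} (hθ : IsChart ⊤ β θ) (hU : opensRange j = U) :
    ∃ (e : ⊤ ≤ U.preimage j) (θ' : B →+* N.sections U), IsChart U β θ' ∧
      (mapLE j U ⊤ e).comp θ' = θ := by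
  subst hU
  have h := (preimage_opensRange_self j).symm
  have hb := bijective_mapLE_opensRange j h le_rfl
  let E := RingEquiv.ofBijective _ hb
  have hE : ∀ x, mapLE j _ ⊤ h.le (E.symm x) = x := fun x => E.apply_symm_apply x
  have hred : ∀ n x, S.reduction ⊤ n x =
      ((j.app n).appLE _ ⊤ (Open.carrier_le_preimage h.le n)).hom (N.reduction _ n (E.symm x)) := fun n x => by
    conv_lhs => rw [← hE x]
    rfl
  have hlev := bijective_appLE_opensRange j h le_rfl
  refine ⟨h.le, E.symm.toRingHom.comp θ, ⟨fun n => ?_, ?_, fun n y => ?_, fun n b hb => ?_⟩, ?_⟩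
  · have e : (j.app n) ''ᵁ ⊤ = (opensRange j).carrier n := (j.app n).image_top_eq_opensRange
    rw [← e]
    exact (hθ.isAffine n).image_of_isOpenImmersion _
  · rw [RingHom.comp_assoc, hθ.comp_eq]
    refine RingHom.ext fun v => hb.1 ((hE _).trans ?_)
    rw [mapLE_algebraMap]
  · obtain ⟨b, hb⟩ := hθ.surjective n (((j.app n).appLE ((opensRange j).carrier n) ⊤ (Open.carrier_le_preimage h.le n)).hom y)
    refine ⟨b, (hlev n).1 ?_⟩
    exact (hred n _).symm.trans hb
  · refine hθ.exists_eq_mul n b ?_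
    rw [hred]
    exact (congrArg _ hb).trans (map_zero _)
  · exact RingHom.ext fun b => hE _

end Chart

end PadicFormalScheme

namespace PadicFormalScheme

variable {V : Type u} [CommRing V] {π : V}

/-! ### Completions of schemes -/

/-- The closed immersion of the spectrum of `V / π ^ (n + 1)` into that of `V`. -/
abbrev baseIncl (V : Type u) [CommRing V] (π : V) (n : ℕ) :
    Spec (TruncRing V π n) ⟶ Spec (CommRingCat.of V) :=
  Spec.map (CommRingCat.ofHom (Ideal.Quotient.mk _))

theorem truncMap_baseIncl (n : ℕ) :
    Spec.map (truncMap V π n) ≫ baseIncl V π (n + 1) = baseIncl V π n := by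
  have h : CommRingCat.ofHom (Ideal.Quotient.mk _) ≫ truncMap V π n =
      CommRingCat.ofHom (Ideal.Quotient.mk (Ideal.span {π ^ (n + 1)})) := by
    ext x; rfl
  rw [← Spec.map_comp, h]

/-- `C` is the `π`-adic completion of the `V`-scheme `Y`. -/
structure IsCompletion {Y : Scheme.{u}} (y : Y ⟶ Spec (CommRingCat.of V))
    (C : PadicFormalScheme V π) (e : ∀ n, C.obj n ⟶ Y) : Prop where
  trans_comp : ∀ n, C.trans n ≫ e (n + 1) = e n
  isPullback : ∀ n, IsPullback (e n) (C.str n) y (baseIncl V π n)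

section

variable {Y : Scheme.{u}} (y : Y ⟶ Spec (CommRingCat.of V))

/-- The transition morphisms of the completion of a scheme. -/
def completionTrans (n : ℕ) :
    pullback y (baseIncl V π n) ⟶ pullback y (baseIncl V π (n + 1)) :=
  pullback.lift (pullback.fst _ _) (pullback.snd _ _ ≫ Spec.map (truncMap V π n)) (by
    rw [pullback.condition, Category.assoc, truncMap_baseIncl])

variable (π) in
/-- The `π`-adic completion of a `V`-scheme. -/
def completion : PadicFormalScheme V π where
  obj n := pullback y (baseIncl V π n)
  str n := pullback.snd _ _
  trans n := completionTrans y n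
  isPullback n := by
    refine IsPullback.of_right (h₁₂ := pullback.fst y (baseIncl V π (n + 1)))
      (h₂₂ := baseIncl V π (n + 1)) (v₁₃ := y) ?_ (pullback.lift_snd _ _ _)
      (IsPullback.of_hasPullback _ _)
    rw [truncMap_baseIncl, completionTrans, pullback.lift_fst]
    exact IsPullback.of_hasPullback _ _

theorem isCompletion_completion : IsCompletion y (completion π y) fun _ => pullback.fst _ _ where
  trans_comp _ := pullback.lift_fst _ _ _
  isPullback _ := IsPullback.of_hasPullback _ _

end

namespace IsCompletion

variable {Y : Scheme.{u}} {y : Y ⟶ Spec (CommRingCat.of V)} {C : PadicFormalScheme V π}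
  {e : ∀ n, C.obj n ⟶ Y} (h : IsCompletion y C e)

include h in
theorem isAffineHom (n : ℕ) : IsAffineHom (e n) :=
  MorphismProperty.of_isPullback (h.isPullback n).flip inferInstance

include h in
theorem comp_eq_toBase (n : ℕ) : e n ≫ y = C.toBase n := (h.isPullback n).w

/-- The completion of an open subset. -/
def preimage (U : Y.Opens) : C.Open where
  carrier n := e n ⁻¹ᵁ U
  compat n := by rw [← Scheme.Hom.comp_preimage, h.trans_comp]

theorem carrier_le_preimage (U : Y.Opens) (n : ℕ) :
    (h.preimage U).carrier n ≤ e n ⁻¹ᵁ U := le_rfl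

/-- The map from the sections of a scheme to those of its completion. -/
def sectionsMap (U : Y.Opens) : Γ(Y, U) →+* C.sections (h.preimage U) :=
  RingHom.codRestrict (RingHom.pi fun n =>
    ((e n).appLE U ((h.preimage U).carrier n) (h.carrier_le_preimage U n)).hom) _ (fun x n => by
      have h' := h.trans_comp n
      simp only [RingHom.pi_apply]
      rw [transApp, Scheme.appLE_appLE]
      simp only [h'])

theorem reduction_sectionsMap (U : Y.Opens) (n : ℕ) (x : Γ(Y, U)) :
    C.reduction _ n (h.sectionsMap U x) =
      ((e n).appLE U ((h.preimage U).carrier n) (h.carrier_le_preimage U n)).hom x := rfl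

theorem isChart {U : Y.Opens} (hU : IsAffineOpen U) :
    IsChart (h.preimage U) (structMap y U) (h.sectionsMap U) := by
  have := h.isAffineHom
  have key := fun n => surjective_app_of_isPullback Ideal.Quotient.mk_surjective (h.isPullback n) hU
  refine ⟨fun n => hU.preimage (e n), ?_, fun n => ?_, fun n b hb => ?_⟩
  · refine RingHom.ext fun v => sections_ext fun n => ?_
    rw [RingHom.comp_apply, reduction_sectionsMap, reduction_algebraMap,
      appLE_structMap _ (h.comp_eq_toBase n)]
  · intro x
    obtain ⟨b, hb⟩ := (key n).1 x
    refine ⟨b, ?_⟩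
    rw [RingHom.comp_apply, reduction_sectionsMap, ← hb]
    exact congr($((e n).appLE_eq_app (U := U)).hom b)
  · rw [reduction_sectionsMap] at hb
    have hb' : b ∈ RingHom.ker ((e n).app U).hom := by
      exact congr($((e n).appLE_eq_app (U := U)).hom b).symm.trans hb
    rw [(key n).2, Ideal.mk_ker, Ideal.map_span, Set.image_singleton,
      Ideal.mem_span_singleton] at hb'
    exact hb'

end IsCompletion

theorem IsChart.comp_equiv {X : PadicFormalScheme V π} {U : X.Open} {B B' : Type u} [CommRing B]
    [CommRing B'] {β : V →+* B} {θ : B →+* X.sections U} (hθ : IsChart U β θ) (E : B' ≃+* B) :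
    IsChart U (E.symm.toRingHom.comp β) (θ.comp E.toRingHom) where
  isAffine := hθ.isAffine
  comp_eq := RingHom.ext fun v => by
    have := congr($(hθ.comp_eq) v)
    simpa using this
  surjective n x := by
    obtain ⟨b, rfl⟩ := hθ.surjective n x
    exact ⟨E.symm b, by simp⟩
  exists_eq_mul n b hb := by
    obtain ⟨b', hb'⟩ := hθ.exists_eq_mul n (E b) hb
    exact ⟨E.symm b', E.injective (by simpa using hb')⟩

/-- The formal spectrum of the completion of a `V`-algebra. -/
theorem exists_isChart_top {B : Type u} [CommRing B] (β : V →+* B) :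
    ∃ (N : PadicFormalScheme V π) (θ : B →+* N.sections ⊤), IsChart ⊤ β θ := by
  let y : Spec (CommRingCat.of B) ⟶ Spec (CommRingCat.of V) := Spec.map (CommRingCat.ofHom β)
  have h := isCompletion_completion (π := π) y
  let E : B ≃+* Γ(Spec (CommRingCat.of B), ⊤) :=
    (Scheme.ΓSpecIso (CommRingCat.of B)).symm.commRingCatIsoToRingEquiv
  have hc := (h.isChart (isAffineOpen_top (Spec (CommRingCat.of B)))).comp_equiv E
  have hβ : E.symm.toRingHom.comp (structMap y ⊤) = β := by
    refine RingHom.ext fun v => E.injective ?_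
    refine (E.apply_symm_apply _).trans ?_
    have := structMap_comp_SpecMap (𝟙 (Spec (CommRingCat.of B))) β ⊤ v
    rw [Category.id_comp] at this
    refine this.trans ?_
    have h1 : (𝟙 (Spec (CommRingCat.of B)) : _ ⟶ _).appLE ⊤ ⊤
        (Scheme.Opens.le_preimage_top _ _) = 𝟙 _ := (Scheme.Hom.appLE_eq_app _).trans (by simp)
    rw [structMap, CommRingCat.hom_comp, RingHom.comp_apply]
    exact congr($(h1).hom _)
  rw [hβ] at hc
  exact ⟨_, _, hc⟩

end PadicFormalScheme

/-! ### Normalisation in the generic fibre -/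

/-- The integral closure of `R` in `R[1/p]` is initial among the `R`-algebras that are `p`-normal
and without `p`-torsion. -/
theorem existsUnique_lift_integralClosure {R C L : Type*} [CommRing R] [CommRing C] [CommRing L]
    [Algebra R L] (p : R) [IsLocalization.Away p L] (φ : R →+* C) (hC : IsNormalWrt (φ p))
    (hp : φ p ∈ nonZeroDivisors C) :
    ∃! g : integralClosure R L →+* C, g.comp (algebraMap R (integralClosure R L)) = φ := by
  let L' := Localization.Away (φ p)
  have hinj : Function.Injective (algebraMap C L') :=
    IsLocalization.injective L' (Submonoid.powers_le.mpr hp)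
  have hu : IsUnit (((algebraMap C L').comp φ) p) :=
    IsLocalization.Away.algebraMap_isUnit (S := L') (φ p)
  let ψ : L →+* L' := IsLocalization.Away.lift p hu
  have hψ : ψ.comp (algebraMap R L) = (algebraMap C L').comp φ := IsLocalization.Away.lift_comp p hu
  let E : C ≃+* (algebraMap C L').range := RingEquiv.ofBijective (algebraMap C L').rangeRestrict
    ⟨fun x y h => hinj congr(($h).1), (algebraMap C L').rangeRestrict_surjective⟩
  have hE : ∀ z, algebraMap C L' (E.symm z) = z := fun z => congr(($(E.apply_symm_apply z)).1)
  let g : integralClosure R L →+* C := E.symm.toRingHom.comp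
    (RingHom.codRestrict (ψ.comp (integralClosure R L).val.toRingHom) (algebraMap C L').range
      fun x => hC.exists_algebraMap_eq hp (x.2.map_of_comp_eq φ ψ hψ.symm))
  have hg : ∀ x, algebraMap C L' (g x) = ψ x := fun x => hE _
  refine ⟨g, RingHom.ext fun r => hinj ((hg _).trans congr($hψ r)), fun g' hg' => ?_⟩
  ext x
  obtain ⟨⟨r, ⟨_, k, rfl⟩⟩, hr⟩ := IsLocalization.surj (Submonoid.powers p) (x : L)
  have hx : x * algebraMap R (integralClosure R L) p ^ k = algebraMap R _ r := by
    refine Subtype.ext ?_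
    rw [← map_pow]
    exact hr
  have h1 := congr(g' $hx)
  rw [map_mul, map_pow, ← RingHom.comp_apply, ← RingHom.comp_apply, hg'] at h1
  refine hinj ((IsUnit.mul_left_inj (hu.pow k)).mp ?_)
  rw [hg, RingHom.comp_apply, ← map_pow, ← map_mul, h1, map_pow]
  have h2 : ψ (x * algebraMap R L (p ^ k)) = ψ (algebraMap R L r) := congrArg ψ hr
  rw [map_mul, map_pow, map_pow, ← RingHom.comp_apply, ← RingHom.comp_apply, hψ] at h2
  exact h2.symm

theorem algebraMap_integralClosure_mem_nonZeroDivisors {R L : Type*} [CommRing R] [CommRing L]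
    [Algebra R L] (p : R) [IsLocalization.Away p L] :
    algebraMap R (integralClosure R L) p ∈ nonZeroDivisors (integralClosure R L) := by
  have hu : IsUnit (algebraMap R L p) := IsLocalization.Away.algebraMap_isUnit _
  refine mem_nonZeroDivisors_iff_right.mpr fun x hx => Subtype.ext ?_
  exact hu.mul_left_eq_zero.mp congr(($hx).1)

namespace PadicFormalScheme

variable {V : Type u} [CommRing V] {π : V} {X N : PadicFormalScheme V π}

theorem isAffine_top_restrict {B : X.Open} (hB : B.IsAffine) :
    (⊤ : (X.restrict B).Open).IsAffine := fun n => by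
  have : IsAffine ((X.restrict B).obj n) := hB n
  exact isAffineOpen_top _

variable (X) in
/-- The functor represented by the normalisation: all morphisms to `X`, on test objects that are
torsion-free and normal. -/
def normModuli : Moduli X where
  obj T := T ⟶ X
  map f t := f ≫ t
  map_id := Category.id_comp
  map_comp f g σ := Category.assoc f g σ
  anchor t := t
  anchor_map _ _ := rfl
  IsTest T := T.LevelTorsionFree ∧ T.LevelNormal
  isTest_of_isOpenImm j _ h := ⟨h.1.of_isOpenImm j, h.2.of_isOpenImm j⟩
  isTest_of_cover H := ⟨.of_cover fun x => let ⟨S, j, hj, hx, h⟩ := H x; ⟨S, j, hj, hx, h.1⟩,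
    .of_cover fun x => let ⟨S, j, hj, hx, h⟩ := H x; ⟨S, j, hj, hx, h.2⟩⟩

theorem isSheaf_normModuli : (normModuli X).IsSheaf := fun _ _ _ c σ h => c.existsUnique_glue σ h

/-- The structure map of the integral closure. -/
abbrev normBase (X : PadicFormalScheme V π) (U : X.Open) : V →+* X.genericIntegralClosure U :=
  (algebraMap (X.sections U) (X.genericIntegralClosure U)).comp (algebraMap V (X.sections U))

/-- Charts over an open subset of the base are transported along open immersions. -/
theorem IsChart.exists_of_comparison {N' : PadicFormalScheme V π} {B : Type u} [CommRing B]
    {β : V →+* B} {θ : B →+* N'.sections ⊤} (hθ : IsChart ⊤ β θ) (r : N' ⟶ N) [IsOpenImm r]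
    {f : N ⟶ X} {f' : N' ⟶ X} (hr : r ≫ f = f') {U : X.Open}
    (hri : opensRange r = U.preimage f) (e : ⊤ = U.preimage f') {α : X.sections U →+* B}
    (hα : θ.comp α = mapLE f' U ⊤ e.le) :
    ∃ θ' : B →+* N.sections (U.preimage f), IsChart (U.preimage f) β θ' ∧
      θ'.comp α = mapLE f U (U.preimage f) le_rfl := by
  obtain ⟨e', θ', hθ', hθr⟩ := hθ.exists_of_isOpenImm r hri
  refine ⟨θ', hθ', RingHom.ext fun x => ?_⟩
  refine (bijective_mapLE_opensRange r (W := ⊤) (U := U.preimage f)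
    (le_antisymm e' le_top) hri.ge).1 ?_
  refine congr($hθr (α x)).trans (congr($hα x).trans ?_)
  exact (mapLE_congr hr.symm _ x).trans (mapLE_mapLE _ _ _ _ _).symm

section

variable {U : X.Open} (hU : U.IsAffine) {f : N ⟶ X} {U' : N.Open}
  {θ : X.genericIntegralClosure U →+* N.sections U'} (hθ : IsChart U' (normBase X U) θ)
  (e : U' = U.preimage f)
  (hθf : θ.comp (algebraMap (X.sections U) (X.genericIntegralClosure U)) = mapLE f U U' e.le)

include hU hθ hθf in
/-- Morphisms from an affine torsion-free normal formal scheme to an affine open factor uniquely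
through the formal spectrum of the completion of the integral closure. -/
theorem IsChart.existsUnique_of_normal {T : PadicFormalScheme V π} (hT : T.LevelTorsionFree)
    (hn : T.LevelNormal) (hTa : (⊤ : T.Open).IsAffine) (t : T ⟶ X) (ht : U.preimage t = ⊤) :
    ∃! h : T ⟶ N, h ≫ f = t := by
  have htf := hT.torsionFree
  have hφ : mapLE t U ⊤ ht.ge (algebraMap V (X.sections U) π) = algebraMap V _ π :=
    mapLE_algebraMap t ht.ge π
  obtain ⟨g, hg, hgu⟩ := existsUnique_lift_integralClosure
    (L := Localization.Away (algebraMap V (X.sections U) π)) (algebraMap V (X.sections U) π)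
    (mapLE t U ⊤ ht.ge) (by rw [hφ]; exact hn.isNormalWrt hTa htf)
    (by rw [hφ]; exact htf.mem_nonZeroDivisors ⊤)
  obtain ⟨h, ⟨e', he'⟩, hu⟩ := hθ.existsUnique_hom g (by
    refine RingHom.ext fun v => ?_
    exact congr($hg (algebraMap V _ v)).trans (mapLE_algebraMap t ht.ge v))
  have key : ∀ (h : T ⟶ N) (e' : ⊤ ≤ U'.preimage h) (r : X.sections U),
      mapLE (h ≫ f) U ⊤ (e'.trans (Open.preimage_mono h e.le)) r =
        mapLE h U' ⊤ e' (θ (algebraMap _ _ r)) := fun h e' r => by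
    rw [show θ (algebraMap _ _ r) = mapLE f U U' e.le r from congr($hθf r), mapLE_mapLE]
  refine ⟨h, ?_, fun h' hh' => ?_⟩
  · refine (isChart_id hU).hom_ext (e'.trans (Open.preimage_mono h e.le)) ht.ge fun r => ?_
    rw [RingHom.id_apply, key h e']
    exact congr($he' (algebraMap _ _ r)).trans congr($hg r)
  · have e'' : ⊤ ≤ U'.preimage h' := by
      rw [e, ← Open.preimage_comp, hh', ht]
    refine hu h' ⟨e'', hgu _ (RingHom.ext fun r => ?_)⟩
    refine (key h' e'' r).symm.trans ?_
    exact mapLE_congr hh' (e''.trans (Open.preimage_mono h' e.le)) r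

include hU hθ hθf in
theorem existsUnique_normModuli {T : PadicFormalScheme V π} (hT : (normModuli X).IsTest T)
    (t : T ⟶ X) (ht : U.preimage t = ⊤) :
    ∃! h : T ⟶ N, h ≫ f = t := by
  refine isSheaf_normModuli.existsUnique_of_locally (Φ := normModuli X) f t fun A x hx => ?_
  obtain ⟨B, hB, hBA, hxB⟩ := Open.exists_isAffine_le hx
  have hTB := (normModuli X).isTest_of_isOpenImm (ι B) hT
  exact ⟨B, hBA, hxB, hθ.existsUnique_of_normal hU e hθf hTB.1 hTB.2 (isAffine_top_restrict hB)
    (ι B ≫ t) (preimage_comp_eq_top _ ht)⟩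

end

theorem IsGenericNormalization.exists_isChart {f : N ⟶ X} (hf : IsGenericNormalization f)
    {U : X.Open} (hU : U.IsAffine) :
    ∃ θ : X.genericIntegralClosure U →+* N.sections (U.preimage f),
      IsChart (U.preimage f) (normBase X U) θ ∧
      θ.comp (algebraMap (X.sections U) (X.genericIntegralClosure U)) =
        mapLE f U (U.preimage f) le_rfl := by
  obtain ⟨θ, h1, h2⟩ := hf.chart U hU
  rw [sectionsMap_eq_mapLE] at h1
  refine ⟨θ, ⟨fun n => ?_, ?_, fun n => (h2 n).1, fun n b hb => ?_⟩, h1⟩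
  · have := hf.isAffine n
    exact (hU n).preimage (f.app n)
  · exact RingHom.ext fun v =>
      congr($h1 (algebraMap V _ v)).trans (mapLE_algebraMap f le_rfl v)
  · exact Ideal.mem_span_singleton.mp ((h2 n).2.le hb)

theorem isTest_normModuli_of_isChart (H : ∀ x : N.obj 0, ∃ (U : N.Open) (B : Type u)
    (_ : CommRing B) (β : V →+* B) (θ : B →+* N.sections U), x ∈ U.carrier 0 ∧
    IsChart U β θ ∧ β π ∈ nonZeroDivisors B ∧ IsNormalWrt (β π)) : (normModuli X).IsTest N :=
  ⟨levelTorsionFree_of_charts fun x => let ⟨U, B, i, β, θ, hx, hθ, h⟩ := H x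
    ⟨U, B, i, β, θ, hx, hθ, h.1⟩,
  levelNormal_of_charts fun x => let ⟨U, B, i, β, θ, hx, hθ, h⟩ := H x
    ⟨U, B, i, β, θ, hx, hθ, h.2⟩⟩

theorem isTest_normModuli_of_charts (H : ∀ x : N.obj 0, ∃ (U : X.Open) (U' : N.Open)
    (θ : X.genericIntegralClosure U →+* N.sections U'), x ∈ U'.carrier 0 ∧
    IsChart U' (normBase X U) θ) : (normModuli X).IsTest N := by
  refine isTest_normModuli_of_isChart fun x => ?_
  obtain ⟨U, U', θ, hx, hθ⟩ := H x
  exact ⟨U', X.genericIntegralClosure U, Subalgebra.toCommRing _, normBase X U, θ, hx, hθ,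
    algebraMap_integralClosure_mem_nonZeroDivisors _, isNormalWrt_integralClosure _⟩

/-- The normalisation is universal among the torsion-free normal formal schemes. -/
theorem IsGenericNormalization.isUniversal {f : N ⟶ X} (hf : IsGenericNormalization f) :
    (normModuli X).IsUniversal (W := N) f := by
  refine ⟨isTest_normModuli_of_charts fun x => ?_, fun T t hT => ?_⟩
  · obtain ⟨U, hU, _, hx⟩ := Open.exists_isAffine_le (U := (⊤ : X.Open)) (x := f.app 0 x) trivial
    obtain ⟨θ, hθ, -⟩ := hf.exists_isChart hU
    exact ⟨U, _, θ, hx, hθ⟩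
  · refine isSheaf_normModuli.existsUnique_of_locally (Φ := normModuli X) f t fun A x hx => ?_
    obtain ⟨U, hU, _, hxU⟩ :=
      Open.exists_isAffine_le (U := (⊤ : X.Open)) (x := Hom.app t 0 x) trivial
    obtain ⟨θ, hθ, hθf⟩ := hf.exists_isChart hU
    obtain ⟨B, hBA, hBU, hxB⟩ : ∃ B ≤ A, B ≤ U.preimage (Y := X) t ∧ x ∈ B.carrier 0 :=
      ⟨A ⊓ U.preimage (Y := X) t, inf_le_left, inf_le_right, ⟨hx, hxU⟩⟩
    exact ⟨B, hBA, hxB, existsUnique_normModuli hU hθ rfl hθf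
      ((normModuli X).isTest_of_isOpenImm (ι B) hT) (ι B ≫ t)
      ((Open.preimage_comp (ι B) t U).trans (preimage_ι_eq_top hBU))⟩

theorem exists_isUniversalOver_normModuli {U : X.Open} (hU : U.IsAffine) :
    ∃ (N : PadicFormalScheme V π) (f : N ⟶ X)
      (θ : X.genericIntegralClosure U →+* N.sections ⊤) (e : ⊤ = U.preimage f),
      IsChart ⊤ (normBase X U) θ ∧
      θ.comp (algebraMap (X.sections U) (X.genericIntegralClosure U)) = mapLE f U ⊤ e.le ∧
      (normModuli X).IsUniversalOver (W := N) U f := by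
  obtain ⟨N, θ, hθ⟩ := exists_isChart_top (π := π) (normBase X U)
  obtain ⟨f, ⟨e, hf⟩, -⟩ := (isChart_id hU).existsUnique_hom
    (θ.comp (algebraMap (X.sections U) (X.genericIntegralClosure U))) hθ.comp_eq
  have e' : ⊤ = U.preimage f := le_antisymm e le_top
  refine ⟨N, f, θ, e', hθ, hf.symm, ⟨isTest_normModuli_of_charts fun x => ⟨U, ⊤, θ, trivial, hθ⟩,
    e'.symm, fun T t hT ht => existsUnique_normModuli hU hθ e' hf.symm hT t ht⟩⟩

theorem isAffineMor_of_charts {f : N ⟶ X} (H : ∀ U : X.Open, U.IsAffine →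
    (U.preimage f).IsAffine) : IsAffineMor f := fun n => ⟨fun W hW => by
  obtain ⟨U, rfl⟩ := Open.exists_carrier_eq n W
  exact H U (Open.isAffine_of_carrier n hW) n⟩

theorem isGenericNormalization_of_charts {f : N ⟶ X}
    (H : ∀ U : X.Open, U.IsAffine → ∃ θ : X.genericIntegralClosure U →+* N.sections (U.preimage f),
      IsChart (U.preimage f) (normBase X U) θ ∧
      θ.comp (algebraMap (X.sections U) (X.genericIntegralClosure U)) =
        mapLE f U (U.preimage f) le_rfl) : IsGenericNormalization f where
  isAffine := isAffineMor_of_charts fun U hU => (H U hU).elim fun _ h => h.1.isAffine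
  chart U hU := (H U hU).elim fun θ h =>
    ⟨θ, h.2.trans (sectionsMap_eq_mapLE f U).symm, fun n => ⟨h.1.surjective n, h.1.ker_eq n⟩⟩

/-- The normalisation exists. -/
theorem exists_isGenericNormalization (X : PadicFormalScheme V π) :
    ∃ (N : PadicFormalScheme V π) (f : N ⟶ X), IsGenericNormalization f := by
  obtain ⟨N, (f : N ⟶ X), hf⟩ := isSheaf_normModuli.exists_isUniversal (Φ := normModuli X) fun U hU => by
    obtain ⟨N, f, -, -, -, -, h⟩ := exists_isUniversalOver_normModuli hU
    exact ⟨N, f, h⟩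
  have key : ∀ U : X.Open, U.IsAffine → ∃ θ : X.genericIntegralClosure U →+*
      N.sections (U.preimage f), IsChart (U.preimage f) (normBase X U) θ ∧
      θ.comp (algebraMap (X.sections U) (X.genericIntegralClosure U)) =
        mapLE f U (U.preimage f) le_rfl := by
    intro U hU
    obtain ⟨N', f', θ, e, hθ, hθf, h⟩ := exists_isUniversalOver_normModuli hU
    obtain ⟨r, hr, hi, hri⟩ := Moduli.IsUniversal.exists_comparison (Φ := normModuli X) hf h
    exact hθ.exists_of_comparison r hr hri e hθf
  exact ⟨N, f, isGenericNormalization_of_charts key⟩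

end PadicFormalScheme

/-! ### Inverse images of ideals -/

namespace AlgebraicGeometry.Scheme.IdealSheafData

variable {X Y : Scheme.{u}}

theorem ideal_comap_top [IsAffine X] [IsAffine Y] (J : Y.IdealSheafData) (f : X ⟶ Y) :
    (J.comap f).ideal ⟨⊤, isAffineOpen_top X⟩ =
      (J.ideal ⟨⊤, isAffineOpen_top Y⟩).map (f.appLE ⊤ ⊤ (Opens.le_preimage_top f ⊤)).hom := by
  have e : f.appLE ⊤ ⊤ (Opens.le_preimage_top f ⊤) = f.appTop := Scheme.Hom.appLE_eq_app _
  rw [e]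
  refine le_antisymm ?_ ?_
  · have h : J.comap f ≤ ofIdealTop ((J.ideal ⟨⊤, isAffineOpen_top Y⟩).map f.appTop.hom) := by
      rw [← le_map_iff_comap_le]
      refine le_of_isAffine ?_
      rw [ideal_map_of_isAffineHom]
      refine (Ideal.le_comap_map).trans (Ideal.comap_mono ?_)
      exact (equivOfIsAffine.right_inv _).ge
    refine (h ⟨⊤, isAffineOpen_top X⟩).trans ?_
    exact (equivOfIsAffine.right_inv _).le
  · rw [Ideal.map_le_iff_le_comap]
    have h := le_map_comap J f ⟨⊤, isAffineOpen_top Y⟩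
    rw [ideal_map_of_isAffineHom] at h
    exact h

theorem ideal_comap_isOpenImmersion [IsAffine X] (J : Y.IdealSheafData) (i : X ⟶ Y)
    [IsOpenImmersion i] {B : Y.Opens} (hB : IsAffineOpen B) (h : i ''ᵁ ⊤ = B)
    (e : ⊤ ≤ i ⁻¹ᵁ B) : (J.comap i).ideal ⟨⊤, isAffineOpen_top X⟩ =
      (J.ideal ⟨B, hB⟩).map (i.appLE B ⊤ e).hom := by
  subst h
  rw [ideal_comap_of_isOpenImmersion, ← Scheme.Hom.appIso_hom']
  exact (Ideal.map_comap_of_equiv (i.appIso ⊤).commRingCatIsoToRingEquiv).symm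

/-- The inverse image of an ideal sheaf over affine opens. -/
theorem ideal_comap_eq_map (J : Y.IdealSheafData) (f : X ⟶ Y) {U : Y.Opens} (hU : IsAffineOpen U)
    {B : X.Opens} (hB : IsAffineOpen B) (e : B ≤ f ⁻¹ᵁ U) :
    (J.comap f).ideal ⟨B, hB⟩ = (J.ideal ⟨U, hU⟩).map (f.appLE U B e).hom := by
  have : IsAffine B.toScheme := hB
  have : IsAffine U.toScheme := hU
  let g := f.resLE U B e
  have hg : g ≫ U.ι = B.ι ≫ f := f.resLE_comp_ι e
  have eB : ⊤ ≤ B.ι ⁻¹ᵁ B := B.ι_preimage_self.ge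
  have eU : ⊤ ≤ U.ι ⁻¹ᵁ U := U.ι_preimage_self.ge
  have hb := bijective_appLE_image B.ι ⊤
  have hBi : B.ι ''ᵁ ⊤ = B := B.ι_image_top
  have hb' : Function.Bijective (B.ι.appLE B ⊤ eB).hom := by
    generalize_proofs at hb
    revert hb
    generalize B.ι ''ᵁ ⊤ = B' at *
    subst hBi
    exact id
  have hinj : ∀ K K' : Ideal Γ(X, B), K.map (B.ι.appLE B ⊤ eB).hom = K'.map (B.ι.appLE B ⊤ eB).hom →
      K = K' := fun K K' h => by
    rw [← Ideal.comap_map_of_bijective _ hb' (I := K), h, Ideal.comap_map_of_bijective _ hb']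
  refine hinj _ _ ?_
  rw [← ideal_comap_isOpenImmersion (J.comap f) B.ι hB hBi eB, ← comap_comp, ← hg, comap_comp,
    ideal_comap_top, ideal_comap_isOpenImmersion J U.ι hU U.ι_image_top eU, Ideal.map_map,
    Ideal.map_map]
  congr 1
  ext x
  simp only [RingHom.comp_apply, appLE_appLE, hg]

end AlgebraicGeometry.Scheme.IdealSheafData

namespace PadicFormalScheme

variable {V : Type u} [CommRing V] {π : V} {X Y : PadicFormalScheme V π}

namespace IdealSystem

theorem ext {I J : X.IdealSystem} (h : I.ideal = J.ideal) : I = J := by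
  cases I; cases J; congr

theorem pullback_comp {Z : PadicFormalScheme V π} (I : Z.IdealSystem) (f : X ⟶ Y) (g : Y ⟶ Z) :
    I.pullback (f ≫ g) = (I.pullback g).pullback f :=
  ext (funext fun n => Scheme.IdealSheafData.comap_comp (I.ideal n) (f.app n) (g.app n))

theorem pullback_id (I : X.IdealSystem) : I.pullback (𝟙 X) = I :=
  ext (funext fun n => Scheme.IdealSheafData.comap_id (I.ideal n))

/-- The ideal of sections modulo `π ^ (n + 1)` over an affine open. -/
def level (I : X.IdealSystem) {U : X.Open} (hU : U.IsAffine) (n : ℕ) :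
    Ideal Γ(X.obj n, U.carrier n) := (I.ideal n).ideal ⟨U.carrier n, hU n⟩

theorem level_pullback (I : Y.IdealSystem) (f : X ⟶ Y) {U : Y.Open} (hU : U.IsAffine)
    {B : X.Open} (hB : B.IsAffine) (e : B ≤ U.preimage f) (n : ℕ) :
    (I.pullback f).level hB n = (I.level hU n).map ((f.app n).appLE (U.carrier n) (B.carrier n)
      (Open.carrier_le_preimage e n)).hom :=
  (I.ideal n).ideal_comap_eq_map (f.app n) (hU n) (hB n) _

theorem level_succ (I : X.IdealSystem) {U : X.Open} (hU : U.IsAffine) (n : ℕ) :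
    I.level hU n = (I.level hU (n + 1)).map (X.transApp U n).hom := by
  have := (I.ideal (n + 1)).ideal_comap_eq_map (X.trans n) (hU (n + 1)) (hU n) (U.compat n).ge
  rw [I.compat n] at this
  exact this

theorem mem_sectionIdeal (I : X.IdealSystem) {U : X.Open} (hU : U.IsAffine) (x : X.sections U) :
    x ∈ I.sectionIdeal U hU ↔ ∀ n, X.reduction U n x ∈ I.level hU n := by
  rw [sectionIdeal, Ideal.mem_iInf]
  rfl

/-- Sections of the reductions of an ideal lift to sections of the ideal. -/
theorem exists_mem_sectionIdeal (I : X.IdealSystem) {U : X.Open} (hU : U.IsAffine) (n : ℕ)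
    {y : Γ(X.obj n, U.carrier n)} (hy : y ∈ I.level hU n) :
    ∃ x ∈ I.sectionIdeal U hU, X.reduction U n x = y := by
  obtain ⟨x, rfl⟩ := reduction_surjective hU n y
  have step : ∀ m (a : I.level hU m), ∃ b : I.level hU (m + 1),
      (X.transApp U m).hom b = a := by
    rintro m ⟨a, ha⟩
    rw [I.level_succ hU m, Ideal.mem_map_iff_of_surjective _ (transApp_surjective hU m)] at ha
    obtain ⟨b, hb, rfl⟩ := ha
    exact ⟨⟨b, hb⟩, rfl⟩
  choose l hl using step
  have down : ∀ m ≤ n, X.reduction U m x ∈ I.level hU m := by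
    have key : ∀ k m, m + k = n → X.reduction U m x ∈ I.level hU m := by
      intro k
      induction k with
      | zero => rintro m rfl; exact hy
      | succ k ih =>
        intro m hm
        rw [I.level_succ hU m, ← transApp_reduction]
        exact Ideal.mem_map_of_mem _ (ih (m + 1) (by omega))
    exact fun m hm => key (n - m) m (by omega)
  let z : ∀ m, I.level hU m := fun m =>
    Nat.rec (motive := fun m => I.level hU m) ⟨_, down 0 (Nat.zero_le n)⟩
      (fun m y => if h : m + 1 ≤ n then ⟨_, down (m + 1) h⟩ else l m y) m
  have hz : ∀ m (h : m ≤ n), z m = ⟨_, down m h⟩ := by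
    intro m hm
    cases m with
    | zero => rfl
    | succ m => exact dif_pos hm
  obtain ⟨w, hw⟩ := exists_sections (U := U) (x := fun m => (z m : Γ(X.obj m, U.carrier m)))
    fun m => by
      by_cases hm : m + 1 ≤ n
      · rw [hz _ hm, hz m (by omega)]
        exact transApp_reduction _ _ _ _
      · have : z (m + 1) = l m (z m) := dif_neg hm
        rw [this, hl]
  refine ⟨w, (I.mem_sectionIdeal hU w).mpr fun m => ?_, ?_⟩
  · rw [hw]
    exact (z m).2
  · rw [hw, hz n le_rfl]

/-- The ideal is locally generated by one section, compatibly in all reductions. -/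
def IsLocallyPrincipal (I : X.IdealSystem) : Prop :=
  ∀ x : X.obj 0, ∃ (U : X.Open) (hU : U.IsAffine) (a : X.sections U), x ∈ U.carrier 0 ∧
    ∀ n, I.level hU n = Ideal.span {X.reduction U n a}

/-- The ideal locally contains a power of `π`. -/
def IsOpen (I : X.IdealSystem) : Prop :=
  ∀ x : X.obj 0, ∃ (U : X.Open) (hU : U.IsAffine) (N : ℕ), x ∈ U.carrier 0 ∧
    ∀ n, structMap (X.toBase n) (U.carrier n) (π ^ N) ∈ I.level hU n

theorem Admissible.isOpen {I : X.IdealSystem} (hI : I.Admissible) : I.IsOpen := fun x => by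
  obtain ⟨U, hU, _, hx⟩ := Open.exists_isAffine_le (U := (⊤ : X.Open)) (x := x) trivial
  obtain ⟨N, hN⟩ := (hI U hU).1
  exact ⟨U, hU, N, hx, fun n => (I.mem_sectionIdeal hU _).mp hN n⟩

theorem level_pullback_eq_span {I : Y.IdealSystem} (f : X ⟶ Y) {U : Y.Open} {hU : U.IsAffine}
    {B : X.Open} (hB : B.IsAffine) (e : B ≤ U.preimage f) {a : Y.sections U}
    (ha : ∀ n, I.level hU n = Ideal.span {Y.reduction U n a}) (n : ℕ) :
    (I.pullback f).level hB n = Ideal.span {X.reduction B n (mapLE f U B e a)} := by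
  rw [I.level_pullback f hU hB e, ha, Ideal.map_span, Set.image_singleton]
  rfl

theorem IsLocallyPrincipal.pullback {I : Y.IdealSystem} (hI : I.IsLocallyPrincipal) (f : X ⟶ Y) :
    (I.pullback f).IsLocallyPrincipal := fun x => by
  obtain ⟨U, hU, a, hx, ha⟩ := hI (f.app 0 x)
  obtain ⟨B, hB, hBU, hxB⟩ := Open.exists_isAffine_le (U := U.preimage f) (n := 0) (x := x) hx
  exact ⟨B, hB, mapLE f U B hBU a, hxB, level_pullback_eq_span f hB hBU ha⟩

theorem structMap_mem_level_pullback {I : Y.IdealSystem} (f : X ⟶ Y) {U : Y.Open}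
    {hU : U.IsAffine} {B : X.Open} (hB : B.IsAffine) (e : B ≤ U.preimage f) {v : V} {n : ℕ}
    (hv : structMap (Y.toBase n) (U.carrier n) v ∈ I.level hU n) :
    structMap (X.toBase n) (B.carrier n) v ∈ (I.pullback f).level hB n := by
  rw [I.level_pullback f hU hB e,
    ← appLE_structMap (f.app n) (app_comp_toBase f n) (Open.carrier_le_preimage e n)]
  exact Ideal.mem_map_of_mem _ hv

theorem IsOpen.pullback {I : Y.IdealSystem} (hI : I.IsOpen) (f : X ⟶ Y) :
    (I.pullback f).IsOpen := fun x => by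
  obtain ⟨U, hU, N, hx, hN⟩ := hI (f.app 0 x)
  obtain ⟨B, hB, hBU, hxB⟩ := Open.exists_isAffine_le (U := U.preimage f) (n := 0) (x := x) hx
  exact ⟨B, hB, N, hxB, fun n => structMap_mem_level_pullback f hB hBU (hN n)⟩

theorem IsLocallyPrincipal.of_cover {I : X.IdealSystem} (H : ∀ x : X.obj 0,
    ∃ (S : PadicFormalScheme V π) (j : S ⟶ X) (_ : IsOpenImm j), x ∈ (opensRange j).carrier 0 ∧
      (I.pullback j).IsLocallyPrincipal) : I.IsLocallyPrincipal := fun x => by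
  obtain ⟨S, j, hj, ⟨y, rfl⟩, h⟩ := H x
  obtain ⟨U, hU, a, hy, ha⟩ := h y
  obtain ⟨W, hW⟩ := Open.exists_carrier_eq (X := X) 0 ((j.app 0) ''ᵁ U.carrier 0)
  have hWU : U = W.preimage j := Open.eq_of_carrier_eq 0 (by
    refine ((j.app 0).preimage_image_eq (U.carrier 0)).symm.trans ?_
    rw [← hW]
    rfl)
  have hWj : W ≤ opensRange j := Open.le_of_carrier_le 0 (by
    rw [hW]
    rintro _ ⟨z, -, rfl⟩
    exact ⟨z, rfl⟩)
  have hWa : W.IsAffine := Open.isAffine_of_zero (by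
    rw [hW]
    exact (hU 0).image_of_isOpenImmersion _)
  obtain ⟨b, rfl⟩ := (bijective_mapLE_opensRange j hWU hWj).2 a
  refine ⟨W, hWa, b, by rw [hW]; exact ⟨y, hy, rfl⟩, fun n => ?_⟩
  have hb := bijective_appLE_opensRange j hWU hWj n
  rw [← Ideal.comap_map_of_bijective _ hb (I := I.level hWa n),
    ← I.level_pullback j hWa hU hWU.le, ha, reduction_mapLE, ← Set.image_singleton,
    ← Ideal.map_span, Ideal.comap_map_of_bijective _ hb]

end IdealSystem

variable (X) in
/-- The functor represented by the blow-up: morphisms pulling back the ideal to a locally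
principal one, on torsion-free test objects. -/
def blowModuli (I : X.IdealSystem) : Moduli X where
  obj T := {t : T ⟶ X // (I.pullback t).IsLocallyPrincipal}
  map f t := ⟨f ≫ t.1, by rw [I.pullback_comp]; exact t.2.pullback f⟩
  map_id _ := Subtype.ext (Category.id_comp _)
  map_comp f g σ := Subtype.ext (Category.assoc f g σ.1)
  anchor t := t.1
  anchor_map _ _ := rfl
  IsTest T := T.LevelTorsionFree
  isTest_of_isOpenImm j _ h := h.of_isOpenImm j
  isTest_of_cover H := .of_cover H

theorem isSheaf_blowModuli (I : X.IdealSystem) : (blowModuli X I).IsSheaf := by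
  intro T K _ c σ h
  obtain ⟨t, ht, hu⟩ := c.existsUnique_glue (fun k => (σ k).1) fun k k' hk =>
    congr(($(h k k' hk)).1)
  refine ⟨⟨t, .of_cover fun x => ?_⟩, fun k => Subtype.ext (ht k), fun s hs =>
    Subtype.ext (hu s.1 fun k => congr(($(hs k)).1))⟩
  obtain ⟨k, hk⟩ := c.exists_mem 0 x
  refine ⟨_, ι (c.opens k), inferInstance, by rw [opensRange_ι]; exact hk, ?_⟩
  rw [← I.pullback_comp, ht]
  exact (σ k).2

end PadicFormalScheme

/-! ### The affine charts of a blow-up -/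

/-- `B` is the chart `R[K / a]` of the blow-up of `R` along `K`, the subring of `R[1/a]`
generated by `R` and the fractions `r / a` with `r ∈ K`. -/
structure IsBlowupAlgebra {R B : Type*} [CommRing R] [CommRing B] (α : R →+* B) (K : Ideal R)
    (a : R) : Prop where
  mem : a ∈ K
  mem_nonZeroDivisors : α a ∈ nonZeroDivisors B
  exists_pow_mul_eq : ∀ z, ∃ m, ∃ r ∈ K ^ m, α a ^ m * z = α r
  dvd : ∀ r ∈ K, α a ∣ α r
  exists_pow_mul_eq_zero : ∀ r, α r = 0 → ∃ k, a ^ k * r = 0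

namespace IsBlowupAlgebra

variable {R B C : Type*} [CommRing R] [CommRing B] [CommRing C] {α : R →+* B} {K : Ideal R}
  {a : R} (h : IsBlowupAlgebra α K a)

include h in
theorem map_mem_nonZeroDivisors {p : R} (hp : p ∈ nonZeroDivisors R) :
    α p ∈ nonZeroDivisors B := by
  refine mem_nonZeroDivisors_iff_right.mpr fun z hz => ?_
  obtain ⟨m, r, -, hr⟩ := h.exists_pow_mul_eq z
  obtain ⟨k, hk⟩ := h.exists_pow_mul_eq_zero (r * p) (by
    rw [map_mul, ← hr, mul_assoc, hz, mul_zero])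
  rw [← mul_assoc] at hk
  have h1 := congr(α $(mem_nonZeroDivisors_iff_right.mp hp _ hk))
  rw [map_mul, map_pow, ← hr, map_zero, ← mul_assoc, ← pow_add, mul_comm] at h1
  exact mem_nonZeroDivisors_iff_right.mp (pow_mem h.mem_nonZeroDivisors (k + m)) _ h1

theorem _root_.pow_dvd_map_of_mem_pow {φ : R →+* C} (hφ : ∀ r ∈ K, φ a ∣ φ r) (m : ℕ) {r : R}
    (hr : r ∈ K ^ m) : φ a ^ m ∣ φ r := by
  have h1 : K.map φ ≤ Ideal.span {φ a} := Ideal.map_le_iff_le_comap.mpr fun r hr =>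
    Ideal.mem_span_singleton.mpr (hφ r hr)
  have h2 := Ideal.pow_right_mono h1 m
  rw [← Ideal.map_pow, Ideal.span_singleton_pow] at h2
  exact Ideal.mem_span_singleton.mp (h2 (Ideal.mem_map_of_mem φ hr))

include h in
/-- The universal property of the charts of a blow-up. -/
theorem existsUnique_lift (φ : R →+* C) (ha : φ a ∈ nonZeroDivisors C)
    (hφ : ∀ r ∈ K, φ a ∣ φ r) : ∃! g : B →+* C, g.comp α = φ := by
  let Q := Localization.Away (α a)
  let L := Localization.Away (φ a)
  have hQ : Function.Injective (algebraMap B Q) :=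
    IsLocalization.injective Q (Submonoid.powers_le.mpr h.mem_nonZeroDivisors)
  have hL : Function.Injective (algebraMap C L) :=
    IsLocalization.injective L (Submonoid.powers_le.mpr ha)
  have hu : IsUnit (algebraMap C L (φ a)) := IsLocalization.Away.algebraMap_isUnit (φ a)
  have hQu : IsUnit (algebraMap B Q (α a)) := IsLocalization.Away.algebraMap_isUnit (α a)
  let _ : Algebra R Q := ((algebraMap B Q).comp α).toAlgebra
  -- the localisations of `R` and of its chart at `a` coincide
  have : IsLocalization.Away a Q := by
    refine ⟨?_, ?_, ?_⟩
    · rintro ⟨_, k, rfl⟩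
      exact (map_pow (algebraMap R Q) a k).symm ▸ hQu.pow k
    · intro z
      obtain ⟨⟨b, ⟨_, k, rfl⟩⟩, hb⟩ := IsLocalization.surj (Submonoid.powers (α a)) z
      obtain ⟨m, r, -, hr⟩ := h.exists_pow_mul_eq b
      refine ⟨⟨r, ⟨a ^ (m + k), m + k, rfl⟩⟩, ?_⟩
      have h1 : z * algebraMap B Q (α a ^ k) = algebraMap B Q b := hb
      change z * algebraMap B Q (α (a ^ (m + k))) = algebraMap B Q (α r)
      rw [← hr, map_mul, ← h1, pow_add, map_mul, map_mul, map_pow α, map_pow α]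
      ring
    · intro x y hxy
      obtain ⟨k, hk⟩ := h.exists_pow_mul_eq_zero (x - y) (by
        rw [map_sub, sub_eq_zero]; exact hQ hxy)
      exact ⟨⟨a ^ k, k, rfl⟩, by rwa [mul_sub, sub_eq_zero] at hk⟩
  let ψ : Q →+* L := IsLocalization.Away.lift (g := (algebraMap C L).comp φ) a hu
  have hψ : ∀ r, ψ (algebraMap B Q (α r)) = algebraMap C L (φ r) := fun r =>
    IsLocalization.Away.lift_eq (g := (algebraMap C L).comp φ) a hu r
  have hrange : ∀ z, ψ (algebraMap B Q z) ∈ (algebraMap C L).range := fun z => by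
    obtain ⟨m, r, hrm, hr⟩ := h.exists_pow_mul_eq z
    obtain ⟨c, hc⟩ := pow_dvd_map_of_mem_pow hφ m hrm
    refine ⟨c, (hu.pow m).mul_left_cancel ?_⟩
    rw [← map_pow, ← map_mul, ← hc, ← hψ, ← hr, map_mul, map_mul, map_pow, map_pow, hψ, map_pow]
  let E : C ≃+* (algebraMap C L).range := RingEquiv.ofBijective (algebraMap C L).rangeRestrict
    ⟨fun x y h => hL congr(($h).1), (algebraMap C L).rangeRestrict_surjective⟩
  have hE : ∀ z, algebraMap C L (E.symm z) = z := fun z => congr(($(E.apply_symm_apply z)).1)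
  let g : B →+* C := E.symm.toRingHom.comp
    (RingHom.codRestrict (ψ.comp (algebraMap B Q)) (algebraMap C L).range hrange)
  have hg : ∀ z, algebraMap C L (g z) = ψ (algebraMap B Q z) := fun z => hE _
  refine ⟨g, RingHom.ext fun r => hL ((hg _).trans (hψ r)), fun g' hg' => RingHom.ext fun z => ?_⟩
  obtain ⟨m, r, -, hr⟩ := h.exists_pow_mul_eq z
  have key : ∀ g' : B →+* C, g'.comp α = φ → φ a ^ m * g' z = φ r := by
    rintro g' rfl
    rw [RingHom.comp_apply, RingHom.comp_apply, ← hr, map_mul, map_pow]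
  have h1 := (key g' hg').trans (key g (RingHom.ext fun r => hL ((hg _).trans (hψ r)))).symm
  refine sub_eq_zero.mp (mem_nonZeroDivisors_iff_right.mp (pow_mem ha m) _ ?_)
  rw [mul_comm, mul_sub, h1, sub_self]

include h in
theorem comp_equiv {B' : Type*} [CommRing B'] (E : B ≃+* B') :
    IsBlowupAlgebra (E.toRingHom.comp α) K a where
  mem := h.mem
  mem_nonZeroDivisors := mem_nonZeroDivisors_iff_right.mpr fun z hz => by
    have h1 : E.symm z * α a = 0 := by
      have := congr(E.symm $hz)
      rw [map_mul, map_zero] at this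
      simpa using this
    have := mem_nonZeroDivisors_iff_right.mp h.mem_nonZeroDivisors _ h1
    simpa using this
  exists_pow_mul_eq z := by
    obtain ⟨m, r, hrm, hr⟩ := h.exists_pow_mul_eq (E.symm z)
    refine ⟨m, r, hrm, ?_⟩
    have := congr(E $hr)
    simpa using this
  dvd r hr := map_dvd E (h.dvd r hr)
  exists_pow_mul_eq_zero r hr := h.exists_pow_mul_eq_zero r (by simpa using hr)

end IsBlowupAlgebra

section Rees

variable {R : Type u} [CommRing R] {K : Ideal R}

/-- The element `r` of `K ^ n` placed in degree `n` of the Rees algebra. -/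
def reesMonomial (n : ℕ) {r : R} (hr : r ∈ K ^ n) : reesAlgebra K :=
  ⟨Polynomial.monomial n r, reesAlgebra.monomial_mem.mpr hr⟩

theorem reesMonomial_mem (n : ℕ) {r : R} (hr : r ∈ K ^ n) :
    reesMonomial n hr ∈ reesPiece K n := mem_reesPiece.mpr ⟨r, rfl⟩

theorem exists_reesMonomial_eq {n : ℕ} {x : reesAlgebra K} (hx : x ∈ reesPiece K n) :
    ∃ (r : R) (hr : r ∈ K ^ n), reesMonomial n hr = x := by
  obtain ⟨r, hr⟩ := mem_reesPiece.mp hx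
  have h : r ∈ K ^ n := by
    have := x.2
    rw [← hr] at this
    exact reesAlgebra.monomial_mem.mp this
  exact ⟨r, h, Subtype.ext hr⟩

/-- The element `a` of `K` in degree one. -/
def reesGen {a : R} (ha : a ∈ K) : reesAlgebra K := reesMonomial 1 (by rwa [pow_one])

theorem reesGen_mem {a : R} (ha : a ∈ K) : reesGen ha ∈ reesPiece K 1 := reesMonomial_mem _ _

theorem reesMonomial_mul {m n : ℕ} {r s : R} (hr : r ∈ K ^ m) (hs : s ∈ K ^ n) :
    reesMonomial m hr * reesMonomial n hs =
      reesMonomial (m + n) (pow_add K m n ▸ Ideal.mul_mem_mul hr hs) :=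
  Subtype.ext (Polynomial.monomial_mul_monomial m n r s)

theorem reesGen_pow {a : R} (ha : a ∈ K) (m : ℕ) :
    reesGen ha ^ m = reesMonomial m (Ideal.pow_mem_pow ha m) := by
  refine Subtype.ext ?_
  refine (Polynomial.monomial_pow 1 a m).trans ?_
  rw [one_mul]
  rfl

/-- The structure map of the chart of the blow-up. -/
def reesAwayMap {a : R} (ha : a ∈ K) :
    R →+* HomogeneousLocalization.Away (reesPiece K) (reesGen ha) :=
  (HomogeneousLocalization.fromZeroRingHom (reesPiece K) _).comp (algebraMap R (reesPiece K 0))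

theorem algebraMap_mul_reesMonomial (r : R) {n : ℕ} {s : R} (hs : s ∈ K ^ n) :
    algebraMap R (reesAlgebra K) r * reesMonomial n hs =
      reesMonomial n (Ideal.mul_mem_left _ r hs) :=
  Subtype.ext (Polynomial.C_mul_monomial)

section

variable {a : R} (ha : a ∈ K)

/-- The map from the Rees algebra to its localisation at an element of degree one. -/
def reesLoc : reesAlgebra K →+* Localization.Away (reesGen ha) :=
  algebraMap (reesAlgebra K) (Localization.Away (reesGen ha))

theorem isUnit_reesLoc_reesGen : IsUnit (reesLoc ha (reesGen ha)) :=
  IsLocalization.Away.algebraMap_isUnit _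

theorem reesMonomial_eq_zero_iff {n : ℕ} {r : R} (hr : r ∈ K ^ n) :
    reesMonomial n hr = 0 ↔ r = 0 := by
  rw [← Subtype.coe_inj]
  exact Polynomial.monomial_eq_zero_iff r n

theorem reesLoc_mul_mk (m : ℕ) (x : reesAlgebra K) (d : Submonoid.powers (reesGen ha))
    (hd : (d : reesAlgebra K) = reesGen ha ^ m) :
    reesLoc ha (reesGen ha) ^ m * Localization.mk x d = reesLoc ha x := by
  rw [← map_pow, mul_comm, Localization.mk_eq_mk', ← hd]
  exact IsLocalization.mk'_spec (Localization.Away (reesGen ha)) x d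

theorem exists_pow_mul_eq_zero_of_reesLoc {x : reesAlgebra K} (hx : reesLoc ha x = 0) :
    ∃ k, reesGen ha ^ k * x = 0 := by
  obtain ⟨⟨_, k, rfl⟩, hk⟩ := (IsLocalization.map_eq_zero_iff (Submonoid.powers (reesGen ha))
    (Localization.Away (reesGen ha)) x).mp hx
  exact ⟨k, hk⟩

theorem exists_reesLoc_mul_val (z : HomogeneousLocalization.Away (reesPiece K) (reesGen ha)) :
    ∃ (n : ℕ) (r : R) (hr : r ∈ K ^ n),
      reesLoc ha (reesGen ha) ^ n * z.val = reesLoc ha (reesMonomial n hr) := by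
  obtain ⟨n, x, hx, rfl⟩ := HomogeneousLocalization.Away.mk_surjective (reesPiece K)
    (reesGen_mem ha) z
  have hx' : x ∈ reesPiece K n := by rwa [smul_eq_mul, mul_one] at hx
  obtain ⟨r, hr, rfl⟩ := exists_reesMonomial_eq hx'
  exact ⟨n, r, hr, reesLoc_mul_mk ha n _ _ rfl⟩

theorem val_reesAwayMap (r : R) : (reesAwayMap ha r).val =
    reesLoc ha (algebraMap R (reesAlgebra K) r) := rfl

theorem algebraMap_mul_reesGen_comm {r : R} (hr : r ∈ K) :
    algebraMap R (reesAlgebra K) r * reesGen ha = algebraMap R (reesAlgebra K) a * reesGen hr := by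
  refine Subtype.ext ((Polynomial.C_mul_monomial).trans (Eq.trans ?_ Polynomial.C_mul_monomial.symm))
  rw [mul_comm]

/-- A ring between `R` and the localised Rees algebra is the chart of the blow-up if it consists of
the fractions of degree zero. -/
theorem IsBlowupAlgebra.of_reesLoc {B : Type*} [CommRing B] (v : B →+* Localization.Away (reesGen ha))
    (hv : Function.Injective v) {α : R →+* B}
    (hα : ∀ r, v (α r) = reesLoc ha (algebraMap R (reesAlgebra K) r))
    (hB : ∀ z, ∃ (n : ℕ) (r : R) (hr : r ∈ K ^ n),
      reesLoc ha (reesGen ha) ^ n * v z = reesLoc ha (reesMonomial n hr))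
    (hK : ∀ r (hr : r ∈ K), ∃ z, reesLoc ha (reesGen ha) * v z = reesLoc ha (reesGen hr)) :
    IsBlowupAlgebra α K a := by
  have hu := isUnit_reesLoc_reesGen ha
  refine ⟨ha, mem_nonZeroDivisors_iff_right.mpr fun z hz => ?_, fun z => ?_, fun r hr => ?_,
    fun r hr => ?_⟩
  · obtain ⟨n, s, hs, hzs⟩ := hB z
    have h0 : v (α a) * v z = 0 := by rw [mul_comm, ← map_mul, hz, map_zero]
    have h1 : reesLoc ha (algebraMap R (reesAlgebra K) a * reesMonomial n hs) = 0 := by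
      rw [map_mul, ← hα, ← hzs, mul_left_comm, h0, mul_zero]
    rw [algebraMap_mul_reesMonomial] at h1
    obtain ⟨k, hk⟩ := exists_pow_mul_eq_zero_of_reesLoc ha h1
    rw [reesGen_pow, reesMonomial_mul, reesMonomial_eq_zero_iff, ← mul_assoc, ← pow_succ] at hk
    have h2 : reesGen ha ^ (k + 1) * reesMonomial n hs = 0 := by
      rw [reesGen_pow, reesMonomial_mul, reesMonomial_eq_zero_iff, hk]
    have h3 := congr(reesLoc ha $h2)
    rw [map_mul, map_pow, ← hzs, ← mul_assoc, ← pow_add, map_zero] at h3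
    refine hv ?_
    rw [map_zero]
    exact ((hu.pow (k + 1 + n)).mul_right_eq_zero).mp h3
  · obtain ⟨n, s, hs, hzs⟩ := hB z
    have h1 : algebraMap R (reesAlgebra K) (a ^ n) * reesMonomial n hs =
        reesGen ha ^ n * algebraMap R (reesAlgebra K) s := by
      rw [reesGen_pow, mul_comm (reesMonomial _ _), algebraMap_mul_reesMonomial,
        algebraMap_mul_reesMonomial]
      exact Subtype.ext congr(Polynomial.monomial n $(mul_comm _ _))
    refine ⟨n, s, hs, hv ((hu.pow n).mul_left_cancel ?_)⟩
    rw [map_mul, map_pow, mul_left_comm, hzs, hα, hα, ← map_pow, ← map_mul, ← map_pow, h1, map_mul,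
      map_pow]
  · obtain ⟨z, hz⟩ := hK r hr
    refine ⟨z, hv (hu.mul_left_cancel ?_)⟩
    rw [map_mul, mul_left_comm, hz, hα, hα, ← map_mul, ← map_mul, mul_comm,
      algebraMap_mul_reesGen_comm]
  · have h1 : reesLoc ha (algebraMap R (reesAlgebra K) r) = 0 := by rw [← hα, hr, map_zero]
    obtain ⟨k, hk⟩ := exists_pow_mul_eq_zero_of_reesLoc ha h1
    refine ⟨k, ?_⟩
    rw [mul_comm, reesGen_pow, algebraMap_mul_reesMonomial, reesMonomial_eq_zero_iff] at hk
    rw [mul_comm, hk]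

theorem reesLoc_mul_isLocalizationElem {r : R} (hr : r ∈ K) :
    reesLoc ha (reesGen ha) * HomogeneousLocalization.val
      (HomogeneousLocalization.Away.isLocalizationElem (reesGen_mem ha) (reesGen_mem hr)) =
        reesLoc ha (reesGen hr) := by
  have hspec := reesLoc_mul_mk ha 1 (reesGen hr ^ 1) ⟨reesGen ha ^ 1, 1, rfl⟩ rfl
  rw [pow_one (reesLoc ha (reesGen ha))] at hspec
  conv_rhs => rw [← pow_one (reesGen hr)]
  exact hspec

theorem isBlowupAlgebra_reesAwayMap : IsBlowupAlgebra (reesAwayMap ha) K a :=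
  .of_reesLoc ha (algebraMap _ _) (HomogeneousLocalization.val_injective _) (val_reesAwayMap ha)
    (exists_reesLoc_mul_val ha) fun _ hr =>
      ⟨HomogeneousLocalization.Away.isLocalizationElem (reesGen_mem ha) (reesGen_mem hr),
        reesLoc_mul_isLocalizationElem ha hr⟩

theorem reesAwayMap_mul_isLocalizationElem {r : R} (hr : r ∈ K) :
    reesAwayMap ha a *
      HomogeneousLocalization.Away.isLocalizationElem (reesGen_mem ha) (reesGen_mem hr) =
        reesAwayMap ha r := by
  refine HomogeneousLocalization.val_injective _
    ((isUnit_reesLoc_reesGen ha).mul_left_cancel ?_)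
  have h1 := reesLoc_mul_isLocalizationElem ha hr
  rw [HomogeneousLocalization.val_mul, mul_left_comm, val_reesAwayMap, val_reesAwayMap]
  refine (congrArg _ h1).trans ?_
  rw [← map_mul, ← map_mul, mul_comm (reesGen ha), algebraMap_mul_reesGen_comm]

end
end Rees

/-! ### The standard affine cover of a blow-up -/

section Blowup

variable {R : Type u} [CommRing R] {K : Ideal R} {a : R} (ha : a ∈ K)

/-- The affine open of the blow-up on which the ideal is generated by `a`. -/
def blowupOpen : (affineBlowup K).Opens := Proj.basicOpen (reesPiece K) (reesGen ha)

theorem isAffineOpen_blowupOpen : IsAffineOpen (blowupOpen ha) :=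
  Proj.isAffineOpen_basicOpen (reesPiece K) (reesGen ha) (reesGen_mem ha) one_pos

/-- The open immersion of the spectrum of the fractions of degree zero. -/
def blowupι : Spec (CommRingCat.of (HomogeneousLocalization.Away (reesPiece K) (reesGen ha))) ⟶
    affineBlowup K :=
  Proj.awayι (reesPiece K) (reesGen ha) (reesGen_mem ha) one_pos

instance : IsOpenImmersion (blowupι ha) :=
  inferInstanceAs (IsOpenImmersion (Proj.awayι (reesPiece K) (reesGen ha) (reesGen_mem ha) one_pos))

theorem opensRange_blowupι : (blowupι ha).opensRange = blowupOpen ha :=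
  Proj.opensRange_awayι _ _ _ _

theorem top_le_preimage_blowupOpen : ⊤ ≤ blowupι ha ⁻¹ᵁ blowupOpen ha := by
  rw [← opensRange_blowupι]
  exact fun x _ => ⟨x, rfl⟩

theorem blowupι_toSpec : blowupι ha ≫ affineBlowupToSpec K =
    Spec.map (CommRingCat.ofHom (reesAwayMap ha)) := by
  refine (Proj.awayι_toSpecZero_assoc (reesPiece K) (reesGen ha) (reesGen_mem ha) one_pos
    (Spec.map (CommRingCat.ofHom (algebraMap R (reesPiece K 0))))).trans ?_
  rw [← Spec.map_comp]
  rfl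

/-- The sections over a chart of the blow-up, as a ring of fractions of degree zero. -/
theorem exists_blowupOpen_equiv :
    ∃ E : HomogeneousLocalization.Away (reesPiece K) (reesGen ha) ≃+*
        Γ(affineBlowup K, blowupOpen ha),
      E.toRingHom.comp (reesAwayMap ha) = structMap (affineBlowupToSpec K) (blowupOpen ha) ∧
      ∀ q, (blowupι ha) ⁻¹ᵁ (affineBlowup K).basicOpen (E q) = PrimeSpectrum.basicOpen q := by
  have hb : Function.Bijective ((blowupι ha).appLE (blowupOpen ha) ⊤
      (top_le_preimage_blowupOpen ha)).hom := by
    have key := bijective_appLE_image (blowupι ha) ⊤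
    have e : (blowupι ha) ''ᵁ ⊤ = blowupOpen ha :=
      (blowupι ha).image_top_eq_opensRange.trans (opensRange_blowupι ha)
    generalize_proofs at key ⊢
    revert key
    generalize (blowupι ha) ''ᵁ ⊤ = U' at *
    subst e
    exact id
  let A := CommRingCat.of (HomogeneousLocalization.Away (reesPiece K) (reesGen ha))
  let E₁ : A ≃+* Γ(Spec A, ⊤) := (Scheme.ΓSpecIso A).symm.commRingCatIsoToRingEquiv
  let E₂ := RingEquiv.ofBijective _ hb
  have hE : ∀ q, ((blowupι ha).appLE (blowupOpen ha) ⊤ (top_le_preimage_blowupOpen ha)).hom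
      ((E₁.trans E₂.symm) q) = E₁ q := fun q => E₂.apply_symm_apply _
  refine ⟨E₁.trans E₂.symm, RingHom.ext fun r => hb.1 ((hE _).trans ?_), fun q => ?_⟩
  · rw [appLE_structMap (blowupι ha) (blowupι_toSpec ha)]
    have := structMap_comp_SpecMap (𝟙 (Spec A)) (reesAwayMap ha) ⊤ r
    rw [Category.id_comp] at this
    refine Eq.trans ?_ this.symm
    have h1 : (𝟙 (Spec A) : _ ⟶ _).appLE ⊤ ⊤
        (Scheme.Opens.le_preimage_top _ _) = 𝟙 _ := (Scheme.Hom.appLE_eq_app _).trans (by simp)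
    rw [structMap, CommRingCat.hom_comp, RingHom.comp_apply]
    exact congr($(h1).hom _).symm
  · refine Eq.trans ?_ (basicOpen_eq_of_affine (R := A) q)
    refine Eq.trans ?_ congr((Spec A).basicOpen $(hE q))
    exact ((Scheme.basicOpen_appLE _ _ _ _ _).trans (top_inf_eq _)).symm

theorem isBlowupAlgebra_structMap :
    IsBlowupAlgebra (structMap (affineBlowupToSpec K) (blowupOpen ha)) K a := by
  obtain ⟨E, hE, -⟩ := exists_blowupOpen_equiv ha
  rw [← hE]
  exact (isBlowupAlgebra_reesAwayMap ha).comp_equiv E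

theorem basicOpen_le_blowupOpen {r : R} (hr : r ∈ K) {q : Γ(affineBlowup K, blowupOpen ha)}
    (hq : structMap (affineBlowupToSpec K) (blowupOpen ha) a * q =
      structMap (affineBlowupToSpec K) (blowupOpen ha) r) :
    (affineBlowup K).basicOpen q ≤ blowupOpen hr := by
  obtain ⟨E, hE, hb⟩ := exists_blowupOpen_equiv ha
  let t := HomogeneousLocalization.Away.isLocalizationElem (reesGen_mem ha) (reesGen_mem hr)
  have h1 := congr(E $(reesAwayMap_mul_isLocalizationElem ha hr))
  have hq' : q = E t := by
    have h2 : structMap (affineBlowupToSpec K) (blowupOpen ha) a * (E t) =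
        structMap (affineBlowupToSpec K) (blowupOpen ha) r := by
      rw [← hE]
      exact (map_mul E _ _).symm.trans h1
    refine sub_eq_zero.mp (mem_nonZeroDivisors_iff_right.mp
      (isBlowupAlgebra_structMap ha).mem_nonZeroDivisors _ ?_)
    rw [mul_comm, mul_sub, hq, h2, sub_self]
  intro x hx
  have hx' : x ∈ (blowupι ha).opensRange := by
    rw [opensRange_blowupι]
    exact (affineBlowup K).basicOpen_le q hx
  obtain ⟨y, rfl⟩ := hx'
  have hy : y ∈ (blowupι ha) ⁻¹ᵁ (affineBlowup K).basicOpen (E t) := hq' ▸ hx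
  rw [hb] at hy
  have h3 := Proj.awayι_preimage_basicOpen (reesPiece K) (reesGen_mem ha) one_pos
    (reesGen_mem hr) one_pos
  have : y ∈ (blowupι ha) ⁻¹ᵁ blowupOpen hr := h3.ge hy
  exact this

theorem adjoin_reesGen_eq_top (K : Ideal R) :
    Algebra.adjoin (reesPiece K 0) (Set.range fun a : K => reesGen a.2) = ⊤ := by
  refine eq_top_iff.mpr fun x _ => ?_
  have key : ∀ p ∈ Algebra.adjoin R (Submodule.map (Polynomial.monomial 1 : R →ₗ[R] _) K :
      Set (Polynomial R)), ∀ hp : p ∈ reesAlgebra K, (⟨p, hp⟩ : reesAlgebra K) ∈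
        Algebra.adjoin (reesPiece K 0) (Set.range fun a : K => reesGen a.2) := by
    intro p hp
    induction hp using Algebra.adjoin_induction with
    | mem p hp =>
      obtain ⟨r, hr, rfl⟩ := hp
      exact fun _ => Algebra.subset_adjoin ⟨⟨r, hr⟩, rfl⟩
    | algebraMap r =>
      intro h
      have e : (⟨algebraMap R _ r, h⟩ : reesAlgebra K) =
        algebraMap (reesPiece K 0) (reesAlgebra K) (algebraMap R (reesPiece K 0) r) :=
          Subtype.ext rfl
      rw [e]
      exact Subalgebra.algebraMap_mem _ _
    | add p q hp hq h1 h2 =>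
      rw [adjoin_monomial_eq_reesAlgebra] at hp hq
      intro h
      have e : (⟨p + q, h⟩ : reesAlgebra K) = ⟨p, hp⟩ + ⟨q, hq⟩ := Subtype.ext rfl
      rw [e]
      exact Subalgebra.add_mem _ (h1 hp) (h2 hq)
    | mul p q hp hq h1 h2 =>
      rw [adjoin_monomial_eq_reesAlgebra] at hp hq
      intro h
      have e : (⟨p * q, h⟩ : reesAlgebra K) = ⟨p, hp⟩ * ⟨q, hq⟩ := Subtype.ext rfl
      rw [e]
      exact Subalgebra.mul_mem _ (h1 hp) (h2 hq)
  exact key x.1 ((adjoin_monomial_eq_reesAlgebra K).ge x.2) x.2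

theorem exists_mem_blowupOpen (K : Ideal R) (y : affineBlowup K) :
    ∃ (a : R) (ha : a ∈ K), y ∈ blowupOpen ha := by
  have key := Proj.iSup_basicOpen_eq_top' (reesPiece K) (fun a : K => reesGen a.2)
    (fun a => ⟨1, reesGen_mem a.2⟩) (adjoin_reesGen_eq_top K)
  have hy : y ∈ (⊤ : (affineBlowup K).Opens) := trivial
  obtain ⟨a, ha⟩ := TopologicalSpace.Opens.mem_iSup.mp (key.ge hy)
  exact ⟨a, a.2, ha⟩

end Blowup

/-! ### Formal blow-ups over an affine open -/

/-- The canonical morphism from an open to the spectrum of its sections corresponds to the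
identity on sections. -/
theorem structMap_toSpecΓ {S : Scheme.{u}} (U : S.Opens) (z : Γ(S, U)) :
    structMap U.toSpecΓ ⊤ z = (U.ι.appLE U ⊤ U.ι_preimage_self.ge).hom z := by
  have h : U.toSpecΓ.appLE ⊤ ⊤ (Scheme.Opens.le_preimage_top _ _) = U.toSpecΓ.appTop :=
    Scheme.Hom.appLE_eq_app _
  have h' := U.toSpecΓ_appTop
  have h2 : U.topIso.inv = U.ι.appLE U ⊤ U.ι_preimage_self.ge := by
    rw [Scheme.Opens.ι_appLE]
    rfl
  refine congr($(h).hom ((Scheme.ΓSpecIso Γ(S, U)).inv.hom z)).trans ?_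
  refine congr($(h').hom ((Scheme.ΓSpecIso Γ(S, U)).inv.hom z)).trans ?_
  rw [h2, CommRingCat.hom_comp, RingHom.comp_apply]
  congr 1
  exact congr($((Scheme.ΓSpecIso Γ(S, U)).inv_hom_id).hom z)

theorem CategoryTheory.IsPullback.of_eq_snd {C : Type*} [Category C] {P X Y Z : C} {fst : P ⟶ X}
    {snd snd' : P ⟶ Y} {f : X ⟶ Z} {g : Y ⟶ Z} (h : IsPullback fst snd f g) (e : snd = snd') :
    IsPullback fst snd' f g := e ▸ h

theorem AlgebraicGeometry.Scheme.appLE_congr_hom {X Y : Scheme.{u}} {f g : X ⟶ Y} (h : f = g)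
    {U : Y.Opens} {W : X.Opens} (e : W ≤ f ⁻¹ᵁ U) (x : Γ(Y, U)) :
    (f.appLE U W e).hom x = (g.appLE U W (h ▸ e)).hom x := by
  subst h; rfl

namespace PadicFormalScheme
variable {V : Type u} [CommRing V] {π : V} {X : PadicFormalScheme V π}

/-- The canonical morphism from the reduction of an affine open to the spectrum of its ring of
sections. -/
abbrev toSpecSections (X : PadicFormalScheme V π) (U : X.Open) (n : ℕ) :
    (U.carrier n).toScheme ⟶ Spec (CommRingCat.of (X.sections U)) :=
  (U.carrier n).toSpecΓ ≫ Spec.map (CommRingCat.ofHom (X.reduction U n))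

theorem structMap_toSpecSections (U : X.Open) (n : ℕ) (x : X.sections U) :
    structMap (X.toSpecSections U n) ⊤ x = ((U.carrier n).ι.appLE (U.carrier n) ⊤
      (U.carrier n).ι_preimage_self.ge).hom (X.reduction U n x) :=
  (structMap_comp_SpecMap _ _ _ _).trans (structMap_toSpecΓ _ _)

/-- The reductions of an affine open are the reductions of the spectrum of its ring of
sections. -/
theorem isPullback_toSpecSections {U : X.Open} (hU : U.IsAffine) (n : ℕ) :
    IsPullback (X.toSpecSections U n) ((U.carrier n).ι ≫ X.str n)
      (Spec.map (CommRingCat.ofHom (algebraMap V (X.sections U)))) (baseIncl V π n) := by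
  have hq : ∀ v, structMap (X.str n) (U.carrier n) (Ideal.Quotient.mk _ v) =
      structMap (X.toBase n) (U.carrier n) v := fun v =>
    (structMap_comp_SpecMap (X.str n) _ (U.carrier n) v).symm
  have hpo : IsPushout (CommRingCat.ofHom (algebraMap V (X.sections U)))
      (CommRingCat.ofHom (Ideal.Quotient.mk (Ideal.span {π ^ (n + 1)})))
      (CommRingCat.ofHom (X.reduction U n))
      (CommRingCat.ofHom (structMap (X.str n) (U.carrier n))) := by
    refine isPushout_of_surjective ?_ Ideal.Quotient.mk_surjective (reduction_surjective hU n) ?_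
    · ext v
      exact (reduction_algebraMap _ _ _ _).trans (hq v).symm
    · intro x hx
      obtain ⟨y, rfl⟩ := exists_eq_pow_mul_of_reduction_eq_zero hU hx
      refine Ideal.mul_mem_right _ _ (Ideal.mem_map_of_mem _ ?_)
      exact Ideal.Quotient.eq_zero_iff_mem.mpr (Ideal.mem_span_singleton_self _)
  have : IsAffine (U.carrier n).toScheme := hU n
  have : IsIso (U.carrier n).toSpecΓ := by
    delta Scheme.Opens.toSpecΓ
    infer_instance
  have e : (U.carrier n).toSpecΓ ≫ Spec.map (CommRingCat.ofHom (structMap (X.str n) (U.carrier n)))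
      = (U.carrier n).ι ≫ X.str n := by
    refine hom_ext_of_structMap fun a => ?_
    rw [structMap_comp_SpecMap]
    refine (structMap_toSpecΓ _ _).trans ?_
    exact appLE_structMap _ rfl _ _
  rw [← e]
  have h1 : IsPullback (U.carrier n).toSpecΓ ((U.carrier n).toSpecΓ ≫
      Spec.map (CommRingCat.ofHom (structMap (X.str n) (U.carrier n))))
      (Spec.map (CommRingCat.ofHom (structMap (X.str n) (U.carrier n)))) (𝟙 _) :=
    .of_horiz_isIso ⟨(Category.comp_id _).symm⟩
  have h2 := h1.paste_horiz (hpo.op.map Scheme.Spec).flip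
  rw [Category.id_comp] at h2
  exact h2

theorem IdealSystem.level_pullback_eq_span_of_dvd (I : X.IdealSystem) {W : PadicFormalScheme V π}
    (f : W ⟶ X) {U : X.Open} (hU : U.IsAffine) {B : W.Open} (hB : B.IsAffine)
    (e : B ≤ U.preimage f) {a : X.sections U} (ha : a ∈ I.sectionIdeal U hU)
    (hd : ∀ r ∈ I.sectionIdeal U hU, mapLE f U B e a ∣ mapLE f U B e r) (n : ℕ) :
    (I.pullback f).level hB n = Ideal.span {W.reduction B n (mapLE f U B e a)} := by
  rw [I.level_pullback f hU hB e]
  refine le_antisymm (Ideal.map_le_iff_le_comap.mpr fun y hy => ?_)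
    ((Ideal.span_singleton_le_iff_mem _).mpr ?_)
  · obtain ⟨r, hr, rfl⟩ := I.exists_mem_sectionIdeal hU n hy
    rw [Ideal.mem_comap, Ideal.mem_span_singleton]
    exact map_dvd (W.reduction B n) (hd r hr)
  · exact Ideal.mem_map_of_mem _ ((I.mem_sectionIdeal hU a).mp ha n)

theorem IsCompletion.isChart_comp {Y : Scheme.{u}} {R : Type u} [CommRing R]
    {s : Y ⟶ Spec (CommRingCat.of R)} {φ : V →+* R} {C : PadicFormalScheme V π}
    {e : ∀ n, C.obj n ⟶ Y} (h : IsCompletion (s ≫ Spec.map (CommRingCat.ofHom φ)) C e)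
    {O : Y.Opens} (hO : IsAffineOpen O) :
    IsChart (h.preimage O) ((structMap s O).comp φ) (h.sectionsMap O) := by
  have e : structMap (s ≫ Spec.map (CommRingCat.ofHom φ)) O = (structMap s O).comp φ :=
    RingHom.ext fun v => structMap_comp_SpecMap s φ O v
  rw [← e]
  exact h.isChart hO

/-- The structure morphism to `Spec V` of the blow-up of an affine open. -/
abbrev blowBase (I : X.IdealSystem) {U : X.Open} (hU : U.IsAffine) :
    affineBlowup (I.sectionIdeal U hU) ⟶ Spec (CommRingCat.of V) :=
  affineBlowupToSpec (I.sectionIdeal U hU) ≫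
    Spec.map (CommRingCat.ofHom (algebraMap V (X.sections U)))

/-- `f : W ⟶ X` factors through the affine open `U` and `W` is, compatibly with the morphisms to
`U`, the completion of the blow-up of the spectrum of the ring of sections over `U`. -/
structure IsBlowupModel (I : X.IdealSystem) {U : X.Open} (hU : U.IsAffine)
    {W : PadicFormalScheme V π} (f : W ⟶ X)
    (e : ∀ n, W.obj n ⟶ affineBlowup (I.sectionIdeal U hU)) : Prop where
  isCompletion : IsCompletion (blowBase I hU) W e
  le_preimage : ⊤ ≤ U.preimage f
  structMap_eq : ∀ n r, structMap (e n ≫ affineBlowupToSpec (I.sectionIdeal U hU)) ⊤ r =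
    ((f.app n).appLE (U.carrier n) ⊤ (Open.carrier_le_preimage le_preimage n)).hom
      (X.reduction U n r)

theorem structMap_morphismRestrict_toSpecSections {W : PadicFormalScheme V π} (b : W ⟶ X)
    (U : X.Open) (n : ℕ) (r : X.sections U) :
    structMap ((b.app n ∣_ U.carrier n) ≫ X.toSpecSections U n) ⊤ r =
      (((ι (U.preimage b) ≫ b).app n).appLE (U.carrier n) ⊤
        (Open.carrier_le_preimage (Y := X) (X := W.restrict (U.preimage b)) (U := ⊤)
          (by rw [Open.preimage_comp, preimage_ι_self]) n)).hom (X.reduction U n r) := by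
  refine (appLE_structMap (b.app n ∣_ U.carrier n) rfl (U := ⊤) (U' := ⊤)
    (Scheme.Hom.preimage_top _).ge r).symm.trans ?_
  refine congr(((b.app n ∣_ U.carrier n).appLE ⊤ ⊤ (Scheme.Hom.preimage_top _).ge).hom
    $(structMap_toSpecSections U n r)).trans ?_
  exact (Scheme.appLE_appLE _ _ _ _ _).trans (Scheme.appLE_congr_hom (morphismRestrict_ι _ _) _ _)

theorem IsFormalBlowup.exists_isBlowupModel {I : X.IdealSystem} {W : PadicFormalScheme V π}
    {b : W ⟶ X} (hb : IsFormalBlowup I b) {U : X.Open} (hU : U.IsAffine) :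
    ∃ e, IsBlowupModel I hU (ι (U.preimage b) ≫ b) e := by
  obtain ⟨e, he, hp⟩ := hb U hU
  refine ⟨e, ⟨⟨he, fun n => ?_⟩, by rw [Open.preimage_comp, preimage_ι_self], fun n r => ?_⟩⟩
  · have h := (hp n).paste_vert (isPullback_toSpecSections hU n)
    have e1 : (b.app n ∣_ U.carrier n) ≫ (U.carrier n).ι ≫ X.str n =
        (W.restrict (U.preimage b)).str n := by
      rw [← Category.assoc, morphismRestrict_ι, Category.assoc, b.comp_str]
      rfl
    exact h.of_eq_snd e1
  · refine congr(structMap $((hp n).w) ⊤ r).trans ?_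
    exact structMap_morphismRestrict_toSpecSections b U n r

theorem isFormalBlowup_of_isBlowupModel {I : X.IdealSystem} {W : PadicFormalScheme V π}
    {b : W ⟶ X} (H : ∀ (U : X.Open) (hU : U.IsAffine),
      ∃ e, IsBlowupModel I hU (ι (U.preimage b) ≫ b) e) : IsFormalBlowup I b := by
  intro U hU
  obtain ⟨e, h⟩ := H U hU
  refine ⟨e, h.isCompletion.trans_comp, fun n => ?_⟩
  have hp := h.isCompletion.isPullback n
  have e1 : (W.restrict (U.preimage b)).str n =
      (b.app n ∣_ U.carrier n) ≫ (U.carrier n).ι ≫ X.str n := by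
    rw [← Category.assoc, morphismRestrict_ι, Category.assoc, b.comp_str]
    rfl
  have hw : e n ≫ affineBlowupToSpec (I.sectionIdeal U hU) =
      (b.app n ∣_ U.carrier n) ≫ X.toSpecSections U n :=
    hom_ext_of_structMap fun r =>
      (h.structMap_eq n r).trans (structMap_morphismRestrict_toSpecSections b U n r).symm
  have hp' : IsPullback (e n) ((b.app n ∣_ U.carrier n) ≫ (U.carrier n).ι ≫ X.str n)
      (affineBlowupToSpec (I.sectionIdeal U hU) ≫
        Spec.map (CommRingCat.ofHom (algebraMap V (X.sections U)))) (baseIncl V π n) :=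
    hp.of_eq_snd e1
  exact IsPullback.of_bot hp' hw (isPullback_toSpecSections hU n)

namespace IsBlowupModel

variable {I : X.IdealSystem} {U : X.Open} {hU : U.IsAffine} {W : PadicFormalScheme V π}
  {f : W ⟶ X} {e : ∀ n, W.obj n ⟶ affineBlowup (I.sectionIdeal U hU)}
  (h : IsBlowupModel I hU f e)

include h in
theorem sectionsMap_comp (O : (affineBlowup (I.sectionIdeal U hU)).Opens) :
    (h.isCompletion.sectionsMap O).comp (structMap (affineBlowupToSpec _) O) =
      mapLE f U (h.isCompletion.preimage O) (le_top.trans h.le_preimage) := by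
  refine RingHom.ext fun r => sections_ext fun n => ?_
  rw [RingHom.comp_apply, IsCompletion.reduction_sectionsMap, appLE_structMap (e n) rfl,
    reduction_mapLE, ← res_structMap _ le_top, h.structMap_eq, Scheme.res_appLE]

variable {a : X.sections U} (ha : a ∈ I.sectionIdeal U hU)

/-- The affine open on which the ideal is generated by `a`. -/
def chart : W.Open := h.isCompletion.preimage (blowupOpen ha)

/-- The sections of the blow-up algebra on its open. -/
def chartMap : Γ(affineBlowup (I.sectionIdeal U hU), blowupOpen ha) →+* W.sections (h.chart ha) :=
  h.isCompletion.sectionsMap (blowupOpen ha)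

/-- The blow-up algebra as an algebra over the sections of the base. -/
abbrev chartAlg (ha : a ∈ I.sectionIdeal U hU) :
    X.sections U →+* Γ(affineBlowup (I.sectionIdeal U hU), blowupOpen ha) :=
  structMap (affineBlowupToSpec (I.sectionIdeal U hU)) (blowupOpen ha)

theorem chart_le : h.chart ha ≤ U.preimage f := le_top.trans h.le_preimage

theorem chartMap_chartAlg (r : X.sections U) :
    h.chartMap ha (chartAlg ha r) = mapLE f U (h.chart ha) (h.chart_le ha) r :=
  congr($(h.sectionsMap_comp (blowupOpen ha)) r)

theorem isChart : IsChart (h.chart ha)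
    ((chartAlg ha).comp (algebraMap V (X.sections U))) (h.chartMap ha) :=
  h.isCompletion.isChart_comp (isAffineOpen_blowupOpen ha)

include h in
theorem exists_mem_chart (x : W.obj 0) : ∃ (a : X.sections U) (ha : a ∈ I.sectionIdeal U hU),
    x ∈ (h.chart ha).carrier 0 :=
  exists_mem_blowupOpen (I.sectionIdeal U hU) (e 0 x)

include h in
theorem levelTorsionFree (hX : X.TorsionFree) : W.LevelTorsionFree := by
  refine levelTorsionFree_of_charts fun x => ?_
  obtain ⟨a, ha, hx⟩ := h.exists_mem_chart x
  exact ⟨h.chart ha, _, inferInstance, _, _, hx, h.isChart ha,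
    (isBlowupAlgebra_structMap ha).map_mem_nonZeroDivisors (hX.mem_nonZeroDivisors U)⟩

theorem level_pullback_chart (n : ℕ) : (I.pullback f).level (h.isChart ha).isAffine n =
    Ideal.span {W.reduction _ n (mapLE f U (h.chart ha) (h.chart_le ha) a)} := by
  refine I.level_pullback_eq_span_of_dvd f hU (h.isChart ha).isAffine (h.chart_le ha) ha
    (fun r hr => ?_) n
  rw [← h.chartMap_chartAlg ha, ← h.chartMap_chartAlg ha]
  exact map_dvd (h.chartMap ha) ((isBlowupAlgebra_structMap ha).dvd r hr)

include h in
theorem isLocallyPrincipal : (I.pullback f).IsLocallyPrincipal := fun x => by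
  obtain ⟨a, ha, hx⟩ := h.exists_mem_chart x
  exact ⟨h.chart ha, (h.isChart ha).isAffine, _, hx, h.level_pullback_chart ha⟩

end IsBlowupModel

end PadicFormalScheme

/-! ### Local generators of inverse image ideals -/

/-- The ideal generated by the image of `K` is generated by the image of the element `a` of `K`,
and it contains a power of `p`. -/
structure IsExceptionalGenerator {R C : Type*} [CommRing R] [CommRing C] (φ : R →+* C)
    (K : Ideal R) (p : C) (a : R) : Prop where
  mem : a ∈ K
  exists_mul_eq : ∃ (N : ℕ) (d : C), φ a * d = p ^ N
  dvd : ∀ r ∈ K, φ a ∣ φ r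

namespace IsExceptionalGenerator

variable {R C C' : Type*} [CommRing R] [CommRing C] [CommRing C'] {φ : R →+* C} {K : Ideal R}
  {p : C} {a : R} (h : IsExceptionalGenerator φ K p a)

include h in
theorem mem_nonZeroDivisors (hp : p ∈ nonZeroDivisors C) : φ a ∈ nonZeroDivisors C := by
  obtain ⟨N, d, hd⟩ := h.exists_mul_eq
  have := pow_mem hp N
  rw [← hd] at this
  exact (mul_mem_nonZeroDivisors.mp this).1

include h in
theorem comp (ψ : C →+* C') : IsExceptionalGenerator (ψ.comp φ) K (ψ p) a where
  mem := h.mem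
  exists_mul_eq := by
    obtain ⟨N, d, hd⟩ := h.exists_mul_eq
    exact ⟨N, ψ d, by rw [RingHom.comp_apply, ← map_mul, hd, map_pow]⟩
  dvd r hr := map_dvd ψ (h.dvd r hr)

end IsExceptionalGenerator

namespace PadicFormalScheme

variable {V : Type u} [CommRing V] {π : V} {X T : PadicFormalScheme V π}

section

variable {B : T.Open} (hB : B.IsAffine)

include hB in
/-- A section that divides `π ^ N` modulo `π ^ (N + 1)` divides `π ^ N`: the quotient is corrected
by the inverse of an element congruent to `1` modulo `π`. -/
theorem exists_mul_eq_pow_of_reduction {c : T.sections B} {N : ℕ}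
    (h : T.reduction B N (algebraMap V _ (π ^ N)) ∈ Ideal.span {T.reduction B N c}) :
    ∃ d, c * d = algebraMap V _ (π ^ N) := by
  obtain ⟨y, hy⟩ := Ideal.mem_span_singleton.mp h
  obtain ⟨d, rfl⟩ := reduction_surjective hB N y
  obtain ⟨z, hz⟩ := exists_eq_pow_mul_of_reduction_eq_zero hB
    (x := algebraMap V _ (π ^ N) - c * d) (n := N) (by rw [map_sub, hy, map_mul, sub_self])
  obtain ⟨u, hu⟩ := isUnit_one_add_mul (-z)
  refine ⟨d * ↑u⁻¹, ?_⟩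
  have h1 : c * d = algebraMap V _ (π ^ N) * u := by
    rw [hu]
    rw [pow_succ, map_mul] at hz
    linear_combination -hz
  rw [← mul_assoc, h1, mul_assoc, Units.mul_inv, mul_one]

include hB in
/-- A divisor of `π ^ N` belongs to an ideal if it does so modulo `π ^ (N + 1)`. -/
theorem mem_of_reduction_mem {c d : T.sections B} {N : ℕ} (hd : c * d = algebraMap V _ (π ^ N))
    {L : Ideal (T.sections B)} (h : T.reduction B N c ∈ L.map (T.reduction B N)) : c ∈ L := by
  obtain ⟨k, hk, hkc⟩ := (Ideal.mem_map_iff_of_surjective _ (reduction_surjective hB N)).mp h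
  obtain ⟨z, hz⟩ := exists_eq_pow_mul_of_reduction_eq_zero hB
    (x := c - k) (n := N) (by rw [map_sub, hkc, sub_self])
  have hu := isUnit_one_add_mul (-(d * z))
  have h1 : c * (1 + algebraMap V _ π * -(d * z)) = k := by
    rw [pow_succ, map_mul, ← hd] at hz
    linear_combination hz
  rw [← h1] at hk
  exact (Ideal.mul_unit_mem_iff_mem _ hu).mp hk

include hB in
/-- A divisor of `π ^ N` divides a section if it does so modulo `π ^ (N + 1)`. -/
theorem dvd_of_reduction_mem {c d x : T.sections B} {N : ℕ}
    (hd : c * d = algebraMap V _ (π ^ N))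
    (h : T.reduction B N x ∈ Ideal.span {T.reduction B N c}) : c ∣ x := by
  obtain ⟨y, hy⟩ := Ideal.mem_span_singleton.mp h
  obtain ⟨w, rfl⟩ := reduction_surjective hB N y
  obtain ⟨z, hz⟩ := exists_eq_pow_mul_of_reduction_eq_zero hB
    (x := x - c * w) (n := N) (by rw [map_sub, hy, map_mul, sub_self])
  refine ⟨w + d * algebraMap V _ π * z, ?_⟩
  rw [pow_succ, map_mul, ← hd] at hz
  linear_combination hz

theorem exists_mem_basicOpen_of_span_eq_top {S : Set (T.sections B)} (h : Ideal.span S = ⊤)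
    {x : T.obj 0} (hx : x ∈ B.carrier 0) :
    ∃ d ∈ S, x ∈ (T.obj 0).basicOpen (T.reduction B 0 d) := by
  let g : T.sections B →+* (T.obj 0).presheaf.stalk x :=
    ((T.obj 0).presheaf.germ (B.carrier 0) x hx).hom.comp (T.reduction B 0)
  by_contra! H
  have h1 : Ideal.span S ≤ (IsLocalRing.maximalIdeal _).comap g := Ideal.span_le.mpr fun d hd => by
    have := H d hd
    rw [Scheme.mem_basicOpen _ _ _ hx] at this
    exact this
  rw [h] at h1
  have h2 := h1 (Submodule.mem_top (x := 1))
  rw [Ideal.mem_comap, map_one] at h2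
  exact (Ideal.ne_top_iff_one _).mp (IsLocalRing.maximalIdeal.isMaximal _).ne_top h2

end

/-- If the generator `c` of the ideal generated by `K` divides every element of `K`, then the
quotients generate the unit ideal. -/
theorem _root_.Ideal.span_quotients_eq_top {R C : Type*} [CommRing R] [CommRing C] {φ : R →+* C}
    {K : Ideal R} {c : C} (hc : c ∈ nonZeroDivisors C) (hcK : c ∈ K.map φ)
    (hd : ∀ r ∈ K, c ∣ φ r) : Ideal.span {d | ∃ r ∈ K, φ r = c * d} = ⊤ := by
  have h1 : K.map φ ≤ Ideal.span {c} * Ideal.span {d | ∃ r ∈ K, φ r = c * d} :=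
    Ideal.map_le_iff_le_comap.mpr fun r hr => by
      obtain ⟨d, hd⟩ := hd r hr
      rw [Ideal.mem_comap, hd]
      exact Ideal.mul_mem_mul (Ideal.mem_span_singleton_self c) (Ideal.subset_span ⟨r, hr, hd⟩)
  obtain ⟨d, hdm, hd⟩ := Ideal.mem_span_singleton_mul.mp (h1 hcK)
  have h2 : d - 1 = 0 := mem_nonZeroDivisors_iff_right.mp hc _ (by
    rw [sub_mul, one_mul, mul_comm, hd, sub_self])
  rw [Ideal.eq_top_iff_one, ← sub_eq_zero.mp h2]
  exact hdm

theorem IdealSystem.map_reduction_sectionIdeal (I : X.IdealSystem) {U : X.Open} (hU : U.IsAffine)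
    (n : ℕ) : (I.sectionIdeal U hU).map (X.reduction U n) = I.level hU n := by
  refine le_antisymm (Ideal.map_le_iff_le_comap.mpr fun x hx =>
    (I.mem_sectionIdeal hU x).mp hx n) fun y hy => ?_
  obtain ⟨x, hx, rfl⟩ := I.exists_mem_sectionIdeal hU n hy
  exact Ideal.mem_map_of_mem _ hx

theorem IdealSystem.map_map_sectionIdeal (I : X.IdealSystem) {U : X.Open} (hU : U.IsAffine)
    (t : T ⟶ X) {B : T.Open} (hB : B.IsAffine) (e : B ≤ U.preimage t) (n : ℕ) :
    ((I.sectionIdeal U hU).map (mapLE t U B e)).map (T.reduction B n) =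
      (I.pullback t).level hB n := by
  rw [I.level_pullback t hU hB e, ← I.map_reduction_sectionIdeal hU n, Ideal.map_map,
    Ideal.map_map]
  rfl

variable (T) in
/-- The restriction of sections to a smaller open. -/
def resOpen {B B' : T.Open} (h : B' ≤ B) : T.sections B →+* T.sections B' := mapLE (𝟙 T) B B' h

theorem resOpen_algebraMap {B B' : T.Open} (h : B' ≤ B) (v : V) :
    T.resOpen h (algebraMap V _ v) = algebraMap V _ v := mapLE_algebraMap (𝟙 T) _ v

theorem isUnit_resOpen_of_le_basicOpen {B B' : T.Open} (hB' : B'.IsAffine) (h : B' ≤ B)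
    {d : T.sections B} (hd : B'.carrier 0 ≤ (T.obj 0).basicOpen (T.reduction B 0 d)) :
    IsUnit (T.resOpen h d) := by
  refine isUnit_of_reduction_zero hB' ?_
  have h1 := (AlgebraicGeometry.Scheme.isUnit_res_self_basicOpen (T.obj 0)
    (T.reduction B 0 d)).map ((Hom.app (𝟙 T) 0).appLE
      ((T.obj 0).basicOpen (T.reduction B 0 d)) (B'.carrier 0) (show _ ≤ (𝟙 (T.obj 0)) ⁻¹ᵁ _ from hd)).hom
  rw [Scheme.appLE_res] at h1
  exact h1

theorem resOpen_mapLE {t : T ⟶ X} {U : X.Open} {B B' : T.Open} (e : B ≤ U.preimage t)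
    (h : B' ≤ B) (r : X.sections U) :
    T.resOpen h (mapLE t U B e r) = mapLE t U B' (h.trans e) r :=
  (mapLE_mapLE (𝟙 T) t e (U'' := B') h r).trans (mapLE_congr (Category.id_comp t) _ r)

/-- Where the inverse image ideal is locally principal, it is locally generated by a section of
the ideal on the base. -/
theorem exists_isExceptionalGenerator {I : X.IdealSystem} (hI : I.IsOpen) {U : X.Open}
    (hU : U.IsAffine) (hT : T.LevelTorsionFree) {t : T ⟶ X} (ht : U.preimage t = ⊤)
    (hp : (I.pullback t).IsLocallyPrincipal) {A : T.Open} {x : T.obj 0} (hx : x ∈ A.carrier 0) :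
    ∃ (B : T.Open) (a : X.sections U) (e : B ≤ U.preimage t), B ≤ A ∧ B.IsAffine ∧
      x ∈ B.carrier 0 ∧
      IsExceptionalGenerator (mapLE t U B e) (I.sectionIdeal U hU) (algebraMap V _ π) a := by
  obtain ⟨U₁, hU₁, c₁, hx₁, hc₁⟩ := hp x
  obtain ⟨U₂, hU₂, N, hx₂, hN⟩ := hI.pullback t x
  obtain ⟨B, hB, hBle, hxB⟩ : ∃ B : T.Open, B.IsAffine ∧ B ≤ A ⊓ U₁ ⊓ U₂ ∧ x ∈ B.carrier 0 :=
    Open.exists_isAffine_le ⟨⟨hx, hx₁⟩, hx₂⟩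
  have hB₁ : B ≤ U₁ := hBle.trans (inf_le_left.trans inf_le_right)
  have hB₂ : B ≤ U₂ := hBle.trans inf_le_right
  have e : B ≤ U.preimage t := ht ▸ le_top
  let c := T.resOpen hB₁ c₁
  have hlev : ∀ n, (I.pullback t).level hB n = Ideal.span {T.reduction B n c} := fun n => by
    have := IdealSystem.level_pullback_eq_span (𝟙 T) hB hB₁ hc₁ n
    rwa [IdealSystem.pullback_id] at this
  have hπ : T.reduction B N (algebraMap V _ (π ^ N)) ∈ Ideal.span {T.reduction B N c} := by
    have := IdealSystem.structMap_mem_level_pullback (𝟙 T) hB hB₂ (hN N)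
    rw [IdealSystem.pullback_id, hlev] at this
    rwa [reduction_algebraMap]
  obtain ⟨d, hd⟩ := exists_mul_eq_pow_of_reduction hB hπ
  have hmap := fun n => (I.map_map_sectionIdeal hU t hB e n).trans (hlev n)
  have hcK : c ∈ (I.sectionIdeal U hU).map (mapLE t U B e) := by
    refine mem_of_reduction_mem hB hd ?_
    rw [hmap]
    exact Ideal.mem_span_singleton_self _
  have hdvd : ∀ r ∈ I.sectionIdeal U hU, c ∣ mapLE t U B e r := fun r hr => by
    refine dvd_of_reduction_mem hB hd ?_
    rw [← hmap]
    exact Ideal.mem_map_of_mem _ (Ideal.mem_map_of_mem _ hr)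
  have hcn : c ∈ nonZeroDivisors (T.sections B) := by
    have := pow_mem (hT.torsionFree.mem_nonZeroDivisors B) N
    rw [← map_pow, ← hd] at this
    exact (mul_mem_nonZeroDivisors.mp this).1
  -- near `x` one of the quotients of the elements `a` of the ideal by `c` is a unit, and then `a`
  -- is a generator
  obtain ⟨q, ⟨a, ha, haq⟩, hxq⟩ := exists_mem_basicOpen_of_span_eq_top
    (Ideal.span_quotients_eq_top hcn hcK hdvd) hxB
  obtain ⟨Q, hQ⟩ := Open.exists_carrier_eq (X := T) 0 ((T.obj 0).basicOpen (T.reduction B 0 q))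
  obtain ⟨B', hB', hB'le, hxB'⟩ : ∃ B' : T.Open, B'.IsAffine ∧ B' ≤ B ⊓ Q ∧ x ∈ B'.carrier 0 :=
    Open.exists_isAffine_le ⟨hxB, hQ.ge hxq⟩
  have hBB : B' ≤ B := hB'le.trans inf_le_left
  have hu : IsUnit (T.resOpen hBB q) := isUnit_resOpen_of_le_basicOpen hB' hBB
    (hQ ▸ (show B' ≤ Q from hB'le.trans inf_le_right) 0)
  obtain ⟨u, hu⟩ := hu
  have hφ : mapLE t U B' (hBB.trans e) a = T.resOpen hBB c * u := by
    rw [← resOpen_mapLE e hBB, haq, map_mul, hu]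
  refine ⟨B', a, hBB.trans e, hBB.trans (hBle.trans (inf_le_left.trans inf_le_left)), hB', hxB',
    ⟨ha, ⟨N, ↑u⁻¹ * T.resOpen hBB d, ?_⟩, fun r hr => ?_⟩⟩
  · rw [hφ, mul_assoc, Units.mul_inv_cancel_left, ← map_mul, hd, resOpen_algebraMap, map_pow]
  · rw [hφ, ← resOpen_mapLE e hBB]
    exact Units.mul_right_dvd.mpr (map_dvd _ (hdvd r hr))

end PadicFormalScheme

/-! ### The universal property of the blow-up over an affine open -/

namespace PadicFormalScheme

variable {V : Type u} [CommRing V] {π : V} {X : PadicFormalScheme V π}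

theorem preimage_ι_top_le {B : X.Open} {T : PadicFormalScheme V π} {t : X ⟶ T} {U : T.Open}
    (e : B ≤ U.preimage t) : (⊤ : (X.restrict B).Open) ≤ U.preimage (ι B ≫ t) := by
  rw [Open.preimage_comp]
  exact (preimage_ι_eq_top e).ge

/-- An exceptional generator over an open is one for the restriction to that open. -/
theorem isExceptionalGenerator_restrict {T : PadicFormalScheme V π} {t : T ⟶ X} {U : X.Open}
    {B : T.Open} {e : B ≤ U.preimage t} {K : Ideal (X.sections U)} {a : X.sections U}
    (h : IsExceptionalGenerator (mapLE t U B e) K (algebraMap V _ π) a) :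
    IsExceptionalGenerator (mapLE (ι B ≫ t) U ⊤ (preimage_ι_top_le e)) K
      (algebraMap V ((T.restrict B).sections ⊤) π) a := by
  let ρ : T.sections B →+* (T.restrict B).sections ⊤ := mapLE (ι B) B ⊤ (preimage_ι_self B).ge
  have h2 : ρ.comp (mapLE t U B e) = mapLE (ι B ≫ t) U ⊤ (preimage_ι_top_le e) :=
    RingHom.ext fun r => mapLE_mapLE (ι B) t e (preimage_ι_self B).ge r
  have h3 : ρ (algebraMap V _ π) = algebraMap V _ π := mapLE_algebraMap (ι B) _ π
  rw [← h2, ← h3]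
  exact h.comp ρ

namespace IsBlowupModel

variable {I : X.IdealSystem} {U : X.Open} {hU : U.IsAffine} {W : PadicFormalScheme V π}
  {f : W ⟶ X} {e : ∀ n, W.obj n ⟶ affineBlowup (I.sectionIdeal U hU)}
  (h : IsBlowupModel I hU f e)

/-- A morphism along which `a` generates the inverse image ideal has image in the corresponding
chart of the blow-up. -/
theorem top_le_preimage_chart {T : PadicFormalScheme V π} (hT : T.LevelTorsionFree)
    {t : T ⟶ X} (ht : ⊤ ≤ U.preimage t) {a : X.sections U}
    (ha : IsExceptionalGenerator (mapLE t U ⊤ ht) (I.sectionIdeal U hU) (algebraMap V _ π) a)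
    (g : T ⟶ W) (hg : g ≫ f = t) : ⊤ ≤ (h.chart ha.mem).preimage g := by
  refine Open.le_of_carrier_le 0 fun x _ => ?_
  obtain ⟨r, hr, hxr⟩ := h.exists_mem_chart (g.app 0 x)
  obtain ⟨q, hq⟩ := (isBlowupAlgebra_structMap hr).dvd a ha.mem
  let O : T.Open := (h.chart hr).preimage g
  have hxO : x ∈ O.carrier 0 := hxr
  have hO : IsExceptionalGenerator (mapLE t U O (le_top.trans ht)) (I.sectionIdeal U hU)
      (algebraMap V _ π) a := by
    have h1 := ha.comp (T.resOpen (le_top : O ≤ ⊤))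
    have h2 : (T.resOpen (le_top : O ≤ ⊤)).comp (mapLE t U ⊤ ht) =
        mapLE t U O (le_top.trans ht) :=
      RingHom.ext fun r => resOpen_mapLE ht le_top r
    rwa [h2, resOpen_algebraMap] at h1
  let G : Γ(affineBlowup (I.sectionIdeal U hU), blowupOpen hr) →+* T.sections O :=
    (mapLE g (h.chart hr) O le_rfl).comp (h.chartMap hr)
  have hG : ∀ s, G (chartAlg hr s) = mapLE t U O (le_top.trans ht) s := fun s => by
    have h1 : G (chartAlg hr s) = mapLE g (h.chart hr) O le_rfl
      (h.chartMap hr (chartAlg hr s)) := rfl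
    rw [h1, h.chartMap_chartAlg hr, mapLE_mapLE]
    exact mapLE_congr hg _ s
  -- both `a` and `r` generate the ideal over `O`, so that their quotient is a unit
  have hu : IsUnit (G q) := by
    obtain ⟨s, hs⟩ := hO.dvd r hr
    have hn := hO.mem_nonZeroDivisors (hT.torsionFree.mem_nonZeroDivisors O)
    have h1 := congr(G $hq)
    rw [map_mul, hG, hG, hs] at h1
    refine IsUnit.of_mul_eq_one s ?_
    refine sub_eq_zero.mp (mem_nonZeroDivisors_iff_right.mp hn _ ?_)
    linear_combination -h1
  have hu0 := hu.map (T.reduction O 0)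
  have hmem : x ∈ (T.obj 0).basicOpen (T.reduction O 0 (G q)) := by
    rw [Scheme.basicOpen_of_isUnit _ hu0]
    exact hxO
  have hred : T.reduction O 0 (G q) = ((g.app 0 ≫ e 0).appLE (blowupOpen hr) (O.carrier 0)
      (Open.carrier_le_preimage (f := g) (U' := h.chart hr) le_rfl 0)).hom q :=
    Scheme.appLE_appLE (g.app 0) (e 0) _ _ q
  rw [hred] at hmem
  exact basicOpen_le_blowupOpen hr ha.mem hq.symm ((Scheme.basicOpen_appLE _ _ _ _ _).le hmem).2

include h in
/-- The universal property of the blow-up for affine test objects on which the inverse image ideal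
is generated by one element of the ideal. -/
theorem existsUnique_of_isExceptionalGenerator {T : PadicFormalScheme V π}
    (hT : T.LevelTorsionFree)
    {t : T ⟶ X} (ht : ⊤ ≤ U.preimage t) {a : X.sections U}
    (ha : IsExceptionalGenerator (mapLE t U ⊤ ht) (I.sectionIdeal U hU) (algebraMap V _ π) a) :
    ∃! g : T ⟶ W, g ≫ f = t := by
  have hB := isBlowupAlgebra_structMap ha.mem
  obtain ⟨G, hG, hGu⟩ := hB.existsUnique_lift (mapLE t U ⊤ ht)
    (ha.mem_nonZeroDivisors (hT.torsionFree.mem_nonZeroDivisors ⊤)) ha.dvd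
  have hc := h.isChart ha.mem
  obtain ⟨g, ⟨eg, hg⟩, hgu⟩ := hc.existsUnique_hom G (by
    rw [← RingHom.comp_assoc, hG]
    exact RingHom.ext fun v => mapLE_algebraMap t ht v)
  have hcomp : ∀ (g : T ⟶ W) (eg : ⊤ ≤ (h.chart ha.mem).preimage g) (s : X.sections U),
      mapLE g (h.chart ha.mem) ⊤ eg (h.chartMap ha.mem (chartAlg ha.mem s)) =
        mapLE (g ≫ f) U ⊤ (eg.trans (Open.preimage_mono g (h.chart_le ha.mem))) s :=
    fun g eg s => by rw [h.chartMap_chartAlg, mapLE_mapLE]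
  refine ⟨g, ?_, fun g' hg' => ?_⟩
  · refine (isChart_id hU).hom_ext (eg.trans (Open.preimage_mono g (h.chart_le ha.mem))) ht
      fun s => ?_
    refine (hcomp g eg s).symm.trans ?_
    exact congr($hg (chartAlg ha.mem s)).trans congr($hG s)
  · have eg' := h.top_le_preimage_chart hT ht ha g' hg'
    refine hgu g' ⟨eg', hGu _ (RingHom.ext fun s => ?_)⟩
    exact (hcomp g' eg' s).trans (mapLE_congr hg' _ s)

/-- The completion of the blow-up of the spectrum of the sections over an affine open represents
the blow-up functor over that open. -/
theorem isUniversalOver (hX : X.TorsionFree) (hI : I.IsOpen) :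
    (blowModuli X I).IsUniversalOver U (W := W) ⟨f, h.isLocallyPrincipal⟩ where
  isTest := h.levelTorsionFree hX
  preimage_anchor := le_antisymm le_top h.le_preimage
  existsUnique T σ hT hσ := by
    refine (isSheaf_blowModuli I).existsUnique_of_locally _ σ fun A x hx => ?_
    obtain ⟨B, a, e, hBA, hB, hxB, ha⟩ := exists_isExceptionalGenerator hI hU hT hσ σ.2 hx
    obtain ⟨g, hg, hgu⟩ := h.existsUnique_of_isExceptionalGenerator
      ((blowModuli X I).isTest_of_isOpenImm (ι B) hT)
      (preimage_ι_top_le e) (isExceptionalGenerator_restrict ha)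
    exact ⟨B, hBA, hxB, g, Subtype.ext hg, fun g' hg' => hgu g' congr(($hg').1)⟩

end IsBlowupModel

end PadicFormalScheme

/-! ### The universal property and the existence of admissible formal blow-ups -/

namespace PadicFormalScheme

variable {V : Type u} [CommRing V] {π : V} {X : PadicFormalScheme V π}

/-- Universality can be checked over the affine opens of the base. -/
theorem Moduli.IsSheaf.isUniversal_of_restrict {Φ : Moduli X} (hΦ : Φ.IsSheaf)
    {W : PadicFormalScheme V π} {ξ : Φ.obj W} (H : ∀ U : X.Open, U.IsAffine →
      Φ.IsUniversalOver U (Φ.map (ι (U.preimage (Φ.anchor ξ))) ξ)) : Φ.IsUniversal ξ := by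
  refine ⟨Φ.isTest_of_cover fun x => ?_, fun T σ hT => ?_⟩
  · obtain ⟨U, hU, -, hx⟩ := Open.exists_isAffine_le (U := (⊤ : X.Open))
      (x := (Φ.anchor ξ).app 0 x) trivial
    exact ⟨_, ι (U.preimage (Φ.anchor ξ)), inferInstance, by rw [opensRange_ι]; exact hx,
      (H U hU).isTest⟩
  · refine hΦ.existsUnique_of_locally ξ σ fun A x hx => ?_
    obtain ⟨U, hU, -, hxU⟩ := Open.exists_isAffine_le (U := (⊤ : X.Open))
      (x := (Φ.anchor σ).app 0 x) trivial
    obtain ⟨B, hBA, hBU, hxB⟩ : ∃ B ≤ A, B ≤ U.preimage (Φ.anchor σ) ∧ x ∈ B.carrier 0 :=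
      ⟨A ⊓ U.preimage (Φ.anchor σ), inf_le_left, inf_le_right, ⟨hx, hxU⟩⟩
    have hB : U.preimage (Φ.anchor (Φ.map (ι B) σ)) = ⊤ := by
      rw [Φ.anchor_map, Open.preimage_comp]
      exact preimage_ι_eq_top hBU
    obtain ⟨g, hg, hgu⟩ := (H U hU).existsUnique _ (Φ.map (ι B) σ)
      (Φ.isTest_of_isOpenImm (ι B) hT) hB
    refine ⟨B, hBA, hxB, g ≫ ι _, ?_, fun g' hg' => ?_⟩
    · dsimp only at hg ⊢
      rw [Φ.map_comp, hg]
    · have h1 : (opensRange (ι (U.preimage (Φ.anchor ξ)))).preimage g' = ⊤ := by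
        rw [opensRange_ι, ← Open.preimage_comp, ← Φ.anchor_map, hg', hB]
      have h2 := lift_comp (ι (U.preimage (Φ.anchor ξ))) g' h1
      refine h2.symm.trans (congrArg (· ≫ ι _) (hgu _ ?_))
      dsimp only
      rw [← Φ.map_comp, h2, hg']

/-- The admissible formal blow-up is universal among the torsion-free formal schemes to which the
ideal pulls back to a locally principal one. -/
theorem IsFormalBlowup.exists_isUniversal (hX : X.TorsionFree) {I : X.IdealSystem}
    (hI : I.IsOpen) {W : PadicFormalScheme V π} {b : W ⟶ X} (hb : IsFormalBlowup I b) :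
    ∃ hp : (I.pullback b).IsLocallyPrincipal,
      (blowModuli X I).IsUniversal (W := W) ⟨b, hp⟩ := by
  have hp : (I.pullback b).IsLocallyPrincipal := .of_cover fun x => by
    obtain ⟨U, hU, -, hx⟩ := Open.exists_isAffine_le (U := (⊤ : X.Open)) (x := b.app 0 x) trivial
    obtain ⟨e, h⟩ := hb.exists_isBlowupModel hU
    refine ⟨_, ι (U.preimage b), inferInstance, by rw [opensRange_ι]; exact hx, ?_⟩
    rw [← IdealSystem.pullback_comp]
    exact h.isLocallyPrincipal
  refine ⟨hp, (isSheaf_blowModuli I).isUniversal_of_restrict fun U hU => ?_⟩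
  obtain ⟨e, h⟩ := hb.exists_isBlowupModel hU
  exact h.isUniversalOver hX hI

/-- The sections of the completion of a scheme over `Spec R` as an `R`-algebra. -/
theorem IsCompletion.exists_ringHom_top {Y : Scheme.{u}} {R : Type u} [CommRing R]
    {s : Y ⟶ Spec (CommRingCat.of R)} {φ : V →+* R} {W : PadicFormalScheme V π}
    {e : ∀ n, W.obj n ⟶ Y} (hc : IsCompletion (s ≫ Spec.map (CommRingCat.ofHom φ)) W e) :
    ∃ g : R →+* W.sections ⊤, g.comp φ = algebraMap V _ ∧
      ∀ n r, W.reduction ⊤ n (g r) = structMap (e n ≫ s) ⊤ r := by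
  have hgn : ∀ n r, W.reduction _ n (hc.sectionsMap ⊤ (structMap s ⊤ r)) =
      structMap (e n ≫ s) ⊤ r := fun n r => appLE_structMap (e n) rfl le_top r
  refine ⟨(hc.sectionsMap ⊤).comp (structMap s ⊤), RingHom.ext fun v => sections_ext fun n => ?_,
    hgn⟩
  refine (hgn n _).trans ?_
  rw [reduction_algebraMap, ← structMap_comp_SpecMap, Category.assoc]
  exact congr(structMap $(hc.comp_eq_toBase n) ⊤ v)

/-- The completion of the blow-up of the spectrum of the sections over an affine open, as a formal
scheme over the base. -/
theorem exists_isBlowupModel (I : X.IdealSystem) {U : X.Open} (hU : U.IsAffine) :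
    ∃ (W : PadicFormalScheme V π) (f : W ⟶ X)
      (e : ∀ n, W.obj n ⟶ affineBlowup (I.sectionIdeal U hU)), IsBlowupModel I hU f e := by
  have hc := isCompletion_completion (π := π) (blowBase I hU)
  obtain ⟨g, hg, hgn⟩ := hc.exists_ringHom_top
  obtain ⟨f, ⟨ef, hf⟩, -⟩ := (isChart_id hU).existsUnique_hom g hg
  exact ⟨_, f, _, hc, ef, fun n r => (hgn n r).symm.trans congr(Subtype.val ($hf r) n).symm⟩

/-- A blow-up model is transported along an isomorphism. -/
theorem IsBlowupModel.of_iso {I : X.IdealSystem} {U : X.Open} {hU : U.IsAffine}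
    {W W' : PadicFormalScheme V π} {f : W ⟶ X}
    {e : ∀ n, W.obj n ⟶ affineBlowup (I.sectionIdeal U hU)}
    (h : IsBlowupModel I hU f e) (j : W' ≅ W) {f' : W' ⟶ X} (hf : j.hom ≫ f = f') :
    IsBlowupModel I hU f' fun n => j.hom.app n ≫ e n := by
  subst hf
  refine ⟨⟨fun n => ?_, fun n => ?_⟩, ?_, fun n r => ?_⟩
  · rw [← Category.assoc, j.hom.trans_comp, Category.assoc, h.isCompletion.trans_comp]
  · have : IsIso (j.hom.app n) := ⟨j.inv.app n, by rw [← comp_app, j.hom_inv_id]; rfl,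
      by rw [← comp_app, j.inv_hom_id]; rfl⟩
    have h1 : IsPullback (j.hom.app n) (W'.str n) (W.str n) (𝟙 _) :=
      .of_horiz_isIso ⟨by rw [j.hom.comp_str, Category.comp_id]⟩
    have h2 := h1.paste_horiz (h.isCompletion.isPullback n)
    rwa [Category.id_comp] at h2
  · rw [Open.preimage_comp]
    exact Open.preimage_mono j.hom h.le_preimage
  · rw [Category.assoc, ← appLE_structMap (j.hom.app n) rfl (U := ⊤) le_top, h.structMap_eq]
    exact Scheme.appLE_appLE _ _ _ _ _

/-- The admissible formal blow-up exists. -/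
theorem exists_isFormalBlowup (hX : X.TorsionFree) {I : X.IdealSystem} (hI : I.IsOpen) :
    ∃ (W : PadicFormalScheme V π) (b : W ⟶ X), IsFormalBlowup I b := by
  obtain ⟨W, b, hb⟩ := (isSheaf_blowModuli I).exists_isUniversal fun U hU => by
    obtain ⟨W, f, e, h⟩ := exists_isBlowupModel I hU
    exact ⟨W, _, h.isUniversalOver hX hI⟩
  refine ⟨W, b.1, isFormalBlowup_of_isBlowupModel fun U hU => ?_⟩
  obtain ⟨W', f, e, h⟩ := exists_isBlowupModel I hU
  obtain ⟨j, hj⟩ := (hb.isUniversalOver.restrict le_top).existsUnique_iso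
    (h.isUniversalOver hX hI)
  exact ⟨_, h.of_iso j congr(($hj).1)⟩

end PadicFormalScheme

/-! ### Normalised blow-ups -/

namespace PadicFormalScheme

variable {V : Type u} [CommRing V] {π : V} {X : PadicFormalScheme V π}

variable (X) in
/-- The functor represented by the normalised blow-up: morphisms pulling back the ideal to a
locally principal one, on torsion-free normal test objects. -/
def normBlowModuli (I : X.IdealSystem) : Moduli X where
  obj T := {t : T ⟶ X // (I.pullback t).IsLocallyPrincipal}
  map f t := (blowModuli X I).map f t
  map_id := (blowModuli X I).map_id
  map_comp := (blowModuli X I).map_comp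
  anchor t := t.1
  anchor_map _ _ := rfl
  IsTest := (normModuli X).IsTest
  isTest_of_isOpenImm j _ h := (normModuli X).isTest_of_isOpenImm j h
  isTest_of_cover := (normModuli X).isTest_of_cover

/-- The normalised blow-up is universal among the torsion-free normal formal schemes to which the
ideal pulls back to a locally principal one. -/
theorem IsNormalizedBlowup.exists_isUniversal (hX : X.TorsionFree) {I : X.IdealSystem}
    (hI : I.IsOpen) {N : PadicFormalScheme V π} {p : N ⟶ X} (hp : IsNormalizedBlowup I p) :
    ∃ h : (I.pullback p).IsLocallyPrincipal,
      (normBlowModuli X I).IsUniversal (W := N) ⟨p, h⟩ := by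
  obtain ⟨W, b, f, hb, hf, rfl⟩ := hp
  obtain ⟨hb', hbu⟩ := hb.exists_isUniversal hX hI
  have hfu := hf.isUniversal
  refine ⟨by rw [I.pullback_comp]; exact hb'.pullback f, hfu.isTest, fun T σ hT => ?_⟩
  obtain ⟨g, hg, hgu⟩ := hbu.existsUnique T σ hT.1
  obtain ⟨h, hh, hhu⟩ := hfu.existsUnique T g hT
  refine ⟨h, Subtype.ext ?_, fun h' hh' => hhu h' (hgu (h' ≫ f) (Subtype.ext ?_))⟩
  · have h1 : h ≫ f = g := hh
    have h2 : g ≫ b = σ.1 := congr(($hg).1)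
    exact (Category.assoc _ _ _).symm.trans (h1 ▸ h2)
  · exact (Category.assoc _ _ _).trans congr(($hh').1)

/-- The normalised blow-up exists. -/
theorem exists_isNormalizedBlowup (hX : X.TorsionFree) {I : X.IdealSystem} (hI : I.IsOpen) :
    ∃ (N : PadicFormalScheme V π) (p : N ⟶ X), IsNormalizedBlowup I p := by
  obtain ⟨W, b, hb⟩ := exists_isFormalBlowup hX hI
  obtain ⟨N, f, hf⟩ := exists_isGenericNormalization W
  exact ⟨N, _, W, b, f, hb, hf, rfl⟩

theorem IdealSystem.level_eq_span_congr {J J' : X.IdealSystem} (h : J = J') {B : X.Open}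
    (hB : B.IsAffine) {c c' : X.sections B} (hc : c = c') {n : ℕ}
    (H : J.level hB n = Ideal.span {X.reduction B n c}) :
    J'.level hB n = Ideal.span {X.reduction B n c'} := by
  subst h hc; exact H

theorem IdealSystem.level_of_le_eq_span (J : X.IdealSystem) {B : X.Open} (hB : B.IsAffine)
    {B' : X.Open} (hB' : B'.IsAffine) (h : B' ≤ B) {c : X.sections B}
    (hc : ∀ n, J.level hB n = Ideal.span {X.reduction B n c}) (n : ℕ) :
    J.level hB' n = Ideal.span {X.reduction B' n (X.resOpen h c)} := by
  have := IdealSystem.level_pullback_eq_span (𝟙 X) hB' h hc n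
  rwa [IdealSystem.pullback_id] at this

/-- A section of the ideal that generates the inverse image ideal is, locally, an exceptional
generator. -/
theorem isExceptionalGenerator_of_level {T : PadicFormalScheme V π} {I : X.IdealSystem}
    (hI : I.IsOpen) {U : X.Open} (hU : U.IsAffine) {t : T ⟶ X} {B : T.Open} (hB : B.IsAffine)
    (e : B ≤ U.preimage t) {a : X.sections U} (ha : a ∈ I.sectionIdeal U hU)
    (hlev : ∀ n, (I.pullback t).level hB n = Ideal.span {T.reduction B n (mapLE t U B e a)})
    {x : T.obj 0} (hx : x ∈ B.carrier 0) :
    ∃ (B' : T.Open) (h : B' ≤ B), x ∈ B'.carrier 0 ∧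
      IsExceptionalGenerator (mapLE t U B' (h.trans e)) (I.sectionIdeal U hU)
        (algebraMap V _ π) a := by
  obtain ⟨U₂, hU₂, N, hx₂, hN⟩ := hI.pullback t x
  obtain ⟨B', hB', hle, hxB'⟩ : ∃ B' : T.Open, B'.IsAffine ∧ B' ≤ B ⊓ U₂ ∧ x ∈ B'.carrier 0 :=
    Open.exists_isAffine_le ⟨hx, hx₂⟩
  have h₁ : B' ≤ B := hle.trans inf_le_left
  have h₂ : B' ≤ U₂ := hle.trans inf_le_right
  have hlev' : ∀ n, (I.pullback t).level hB' n =
      Ideal.span {T.reduction B' n (mapLE t U B' (h₁.trans e) a)} := fun n => by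
    rw [(I.pullback t).level_of_le_eq_span hB hB' h₁ hlev, resOpen_mapLE]
  have hπ : T.reduction B' N (algebraMap V _ (π ^ N)) ∈
      Ideal.span {T.reduction B' N (mapLE t U B' (h₁.trans e) a)} := by
    have := IdealSystem.structMap_mem_level_pullback (𝟙 T) hB' h₂ (hN N)
    rw [IdealSystem.pullback_id, hlev'] at this
    rwa [reduction_algebraMap]
  obtain ⟨d, hd⟩ := exists_mul_eq_pow_of_reduction hB' hπ
  refine ⟨B', h₁, hxB', ha, ⟨N, d, by rw [hd, map_pow]⟩, fun r hr => ?_⟩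
  refine dvd_of_reduction_mem hB' hd ?_
  rw [← hlev', ← I.map_map_sectionIdeal hU t hB' (h₁.trans e)]
  exact Ideal.mem_map_of_mem _ (Ideal.mem_map_of_mem _ hr)

namespace IsBlowupModel

section

variable {I : X.IdealSystem} {U : X.Open} {hU : U.IsAffine} {W : PadicFormalScheme V π}
  {f : W ⟶ X} {e : ∀ n, W.obj n ⟶ affineBlowup (I.sectionIdeal U hU)}
  (h : IsBlowupModel I hU f e)

/-- An open on which `a` generates the inverse image ideal is sent to the chart of `a`. -/
theorem le_preimage_chart (hI : I.IsOpen) {T : PadicFormalScheme V π} (hT : T.LevelTorsionFree)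
    {t : T ⟶ X} {g : T ⟶ W} (hg : g ≫ f = t) {B : T.Open} (hB : B.IsAffine)
    (e : B ≤ U.preimage t) {a : X.sections U} (ha : a ∈ I.sectionIdeal U hU)
    (hlev : ∀ n, (I.pullback t).level hB n = Ideal.span {T.reduction B n (mapLE t U B e a)}) :
    B ≤ (h.chart ha).preimage g := by
  refine Open.le_of_carrier_le 0 fun x hx => ?_
  obtain ⟨B', hB'B, hxB', ha'⟩ := isExceptionalGenerator_of_level hI hU hB e ha hlev hx
  have h1 := h.top_le_preimage_chart (hT.of_isOpenImm (ι B')) _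
    (isExceptionalGenerator_restrict ha') (ι B' ≫ g) (by rw [Category.assoc, hg])
  exact h1 0 (x := ⟨x, hxB'⟩) trivial

end

/-- The preimage of the chart of `a` under the comparison map of blow-ups is the chart of the
inverse image of `a`. -/
theorem isAffine_preimage_chart {X' : PadicFormalScheme V π} {φ : X' ⟶ X} {I : X.IdealSystem}
    (hI : I.IsOpen) (hX' : X'.TorsionFree) {U : X.Open} {hU : U.IsAffine}
    {hU' : (U.preimage φ).IsAffine} {W W' : PadicFormalScheme V π} {f : W ⟶ X} {f' : W' ⟶ X'}
    {e : ∀ n, W.obj n ⟶ affineBlowup (I.sectionIdeal U hU)}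
    {e' : ∀ n, W'.obj n ⟶ affineBlowup ((I.pullback φ).sectionIdeal (U.preimage φ) hU')}
    (h : IsBlowupModel I hU f e) (h' : IsBlowupModel (I.pullback φ) hU' f' e')
    {g : W' ⟶ W} (hg : g ≫ f = f' ≫ φ) {a : X.sections U} (ha : a ∈ I.sectionIdeal U hU) :
    ((h.chart ha).preimage g).IsAffine := by
  have ha' : mapLE φ U _ le_rfl a ∈ (I.pullback φ).sectionIdeal (U.preimage φ) hU' := by
    rw [IdealSystem.mem_sectionIdeal]
    intro n
    rw [I.level_pullback φ hU hU' le_rfl]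
    exact Ideal.mem_map_of_mem _ ((I.mem_sectionIdeal hU a).mp ha n)
  have hW' := h'.levelTorsionFree hX'
  suffices (h.chart ha).preimage g = h'.chart ha' by
    rw [this]
    exact (h'.isChart ha').isAffine
  refine le_antisymm (Open.le_of_carrier_le 0 fun x hx => ?_) ?_
  · obtain ⟨B, hB, hBle, hxB⟩ := Open.exists_isAffine_le hx
    have eB : B ≤ (U.preimage φ).preimage f' := le_top.trans h'.le_preimage
    refine h'.le_preimage_chart (hI.pullback φ) hW' (Category.id_comp f') hB eB ha'
      (fun n => ?_) 0 hxB
    have h1 : (I.pullback φ).pullback f' = (I.pullback f).pullback g := by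
      rw [← I.pullback_comp, ← I.pullback_comp, hg]
    have h2 : mapLE f' (U.preimage φ) B eB (mapLE φ U _ le_rfl a) =
        mapLE g (h.chart ha) B hBle (mapLE f U _ (h.chart_le ha) a) :=
      (mapLE_mapLE _ _ _ _ _).trans ((mapLE_congr hg.symm _ a).trans (mapLE_mapLE _ _ _ _ _).symm)
    exact IdealSystem.level_eq_span_congr h1.symm _ h2.symm
      (IdealSystem.level_pullback_eq_span g hB hBle (h.level_pullback_chart ha) n)
  · have eB : h'.chart ha' ≤ U.preimage (f' ≫ φ) := by
      rw [Open.preimage_comp]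
      exact h'.chart_le ha'
    refine h.le_preimage_chart hI hW' hg (h'.isChart ha').isAffine eB ha fun n => ?_
    have h1 : I.pullback (f' ≫ φ) = (I.pullback φ).pullback f' := I.pullback_comp f' φ
    have h2 : mapLE f' (U.preimage φ) (h'.chart ha') (h'.chart_le ha') (mapLE φ U _ le_rfl a) =
        mapLE (f' ≫ φ) U (h'.chart ha') eB a := mapLE_mapLE _ _ _ _ _
    exact IdealSystem.level_eq_span_congr h1.symm _ h2 (h'.level_pullback_chart ha' n)

end IsBlowupModel

/-! ### Affineness of the comparison morphisms -/

theorem isAffineMor_of_cover {W W' : PadicFormalScheme V π} {g : W' ⟶ W}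
    (H : ∀ x : W.obj 0, ∃ Q : W.Open, x ∈ Q.carrier 0 ∧ Q.IsAffine ∧ (Q.preimage g).IsAffine) :
    IsAffineMor g := fun n => by
  refine isAffineHom_of_forall_exists_isAffineOpen (g.app n) fun x => ?_
  obtain ⟨y, hy⟩ := Open.exists_point n x
  obtain ⟨Q, hyQ, hQ, hQ'⟩ := H y
  exact ⟨Q.carrier n, (hy Q).mpr hyQ, hQ n, hQ' n⟩

/-- Affineness of the preimages of the opens contained in `P` can be checked after restriction. -/
theorem exists_isAffine_preimage_of_restrict {W W' : PadicFormalScheme V π} {g : W' ⟶ W}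
    {P : W.Open} {g' : W'.restrict (P.preimage g) ⟶ W.restrict P} (hg : g' ≫ ι P = ι _ ≫ g)
    {C : (W.restrict P).Open} (hC : C.IsAffine) (hC' : (C.preimage g').IsAffine) :
    ∃ Q : W.Open, Q.IsAffine ∧ (Q.preimage g).IsAffine ∧
      ∀ x, x ∈ C.carrier 0 → (ι P).app 0 x ∈ Q.carrier 0 := by
  obtain ⟨Q, hQ⟩ := Open.exists_carrier_eq (X := W) 0 (((ι P).app 0) ''ᵁ C.carrier 0)
  refine ⟨Q, Open.isAffine_of_zero ?_, Open.isAffine_of_zero ?_, fun x hx => ?_⟩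
  · rw [hQ]
    exact (hC 0).image_of_isOpenImmersion _
  · have h0 := congr(Hom.app $hg 0)
    have h1 : (Q.preimage g).carrier 0 =
        ((ι (P.preimage g)).app 0) ''ᵁ (C.preimage g').carrier 0 := by
      change g.app 0 ⁻¹ᵁ Q.carrier 0 = _
      rw [hQ]
      refine TopologicalSpace.Opens.ext (Set.ext fun y => ⟨?_, ?_⟩)
      · rintro ⟨z, hz, hzy⟩
        have hzy : (ι P).app 0 z = g.app 0 y := hzy
        have hy : y ∈ (P.preimage g).carrier 0 := by
          change g.app 0 y ∈ P.carrier 0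
          rw [← hzy]
          exact z.2
        refine ⟨⟨y, hy⟩, ?_, rfl⟩
        have h2 : (ι P).app 0 (g'.app 0 ⟨y, hy⟩) = g.app 0 y :=
          congr(($h0 : _ → _) ⟨y, hy⟩)
        have h3 : g'.app 0 ⟨y, hy⟩ = z := ((ι P).app 0).injective (h2.trans hzy.symm)
        change g'.app 0 ⟨y, hy⟩ ∈ C.carrier 0
        exact (congrArg (· ∈ C.carrier 0) h3).mpr hz
      · rintro ⟨z, hz, rfl⟩
        exact ⟨g'.app 0 z, hz, congr(($h0 : _ → _) z)⟩
    rw [h1]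
    exact (hC' 0).image_of_isOpenImmersion _
  · rw [hQ]
    exact ⟨x, hx, rfl⟩

/-- The comparison maps of the blow-ups along an affine morphism are affine. -/
theorem IsFormalBlowup.isAffineMor {X' : PadicFormalScheme V π} {φ : X' ⟶ X}
    (hφ : IsAffineMor φ) {I : X.IdealSystem} (hI : I.IsOpen) (hX' : X'.TorsionFree)
    {W W' : PadicFormalScheme V π} {b : W ⟶ X} {b' : W' ⟶ X'} (hb : IsFormalBlowup I b)
    (hb' : IsFormalBlowup (I.pullback φ) b') {g : W' ⟶ W} (hg : g ≫ b = b' ≫ φ) :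
    IsAffineMor g := by
  refine isAffineMor_of_cover fun x => ?_
  obtain ⟨U, hU, -, hx⟩ := Open.exists_isAffine_le (U := (⊤ : X.Open)) (x := b.app 0 x) trivial
  have hU' : (U.preimage φ).IsAffine := fun n => by
    have := hφ n
    exact (hU n).preimage (φ.app n)
  obtain ⟨e, h⟩ := hb.exists_isBlowupModel hU
  obtain ⟨e', h'⟩ := hb'.exists_isBlowupModel hU'
  have hP : (U.preimage φ).preimage b' = (U.preimage b).preimage g := by
    rw [← Open.preimage_comp, ← Open.preimage_comp, hg]
  revert e' h'
  rw [hP]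
  intro e' h'
  obtain ⟨a, ha, hxa⟩ := h.exists_mem_chart ⟨x, hx⟩
  have hgr := restrictHom_ι g (U.preimage b)
  obtain ⟨Q, hQ, hQ', hxQ⟩ := exists_isAffine_preimage_of_restrict hgr
    (h.isChart ha).isAffine (h.isAffine_preimage_chart hI hX' h' (by
      rw [← Category.assoc, hgr, Category.assoc, Category.assoc, hg]) ha)
  exact ⟨Q, hxQ _ hxa, hQ, hQ'⟩

/-- The comparison maps of the normalised blow-ups along an affine morphism are affine. -/
theorem IsNormalizedBlowup.isAffineMor {X' : PadicFormalScheme V π} {φ : X' ⟶ X}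
    (hφ : IsAffineMor φ) {I : X.IdealSystem} (hI : I.IsOpen) (hX : X.TorsionFree)
    (hX' : X'.TorsionFree)
    {N N' : PadicFormalScheme V π} {p : N ⟶ X} {p' : N' ⟶ X'} (hp : IsNormalizedBlowup I p)
    (hp' : IsNormalizedBlowup (I.pullback φ) p') {g : N' ⟶ N} (hg : g ≫ p = p' ≫ φ) :
    IsAffineMor g := by
  have hN' := (hp'.exists_isUniversal hX' (hI.pullback φ)).2.isTest
  obtain ⟨W, b, f, hb, hf, rfl⟩ := hp
  obtain ⟨W', b', f', hb', hf', rfl⟩ := hp'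
  obtain ⟨hbp, hbu⟩ := hb.exists_isUniversal hX hI
  obtain ⟨hbp', hbu'⟩ := hb'.exists_isUniversal hX' (hI.pullback φ)
  obtain ⟨r, hr, -⟩ := hbu.existsUnique W'
    ⟨b' ≫ φ, by rw [I.pullback_comp]; exact hbp'⟩ hbu'.isTest
  have hr' : r ≫ b = b' ≫ φ := congr(($hr).1)
  have hra := hb.isAffineMor hφ hI hX' hb' hr'
  have hgr : g ≫ f = f' ≫ r := by
    refine (hbu.existsUnique N' ⟨f' ≫ b' ≫ φ, ?_⟩ hN'.1).unique (Subtype.ext ?_) (Subtype.ext ?_)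
    · rw [I.pullback_comp, I.pullback_comp]
      exact hbp'.pullback f'
    · exact (Category.assoc _ _ _).trans (hg.trans (Category.assoc _ _ _))
    · exact (Category.assoc _ _ _).trans (congrArg _ hr')
  intro n
  have h1 := hf'.isAffine n
  have h2 := hra n
  have h3 := hf.isAffine n
  have h4 : IsAffineHom (g.app n ≫ f.app n) := by
    rw [show g.app n ≫ f.app n = f'.app n ≫ r.app n from congr(Hom.app $hgr n)]
    infer_instance
  exact IsAffineHom.of_comp (g.app n) (f.app n)

end PadicFormalScheme

/-! ### Directed colimits of rings -/

/-- `B`, with the maps `o i`, is the colimit of the directed system of rings `G`. -/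
structure IsDirectedColimit {ι : Type u} [Preorder ι] {G : ι → Type u} [∀ i, CommRing (G i)]
    (f : ∀ i j, i ≤ j → G i →+* G j) {B : Type u} [CommRing B] (o : ∀ i, G i →+* B) : Prop where
  map_eq : ∀ i j h x, o j (f i j h x) = o i x
  exists_eq : ∀ z, ∃ i x, o i x = z
  exists_map_eq_zero : ∀ i x, o i x = 0 → ∃ j h, f i j h x = 0
  existsUnique_lift : ∀ {C : Type u} [CommRing C] (g : ∀ i, G i →+* C),
    (∀ i j h x, g j (f i j h x) = g i x) → ∃! g' : B →+* C, ∀ i x, g' (o i x) = g i x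

theorem exists_isDirectedColimit {ι : Type u} [Preorder ι] [IsDirectedOrder ι] [Nonempty ι]
    {G : ι → Type u} [∀ i, CommRing (G i)] (f : ∀ i j, i ≤ j → G i →+* G j)
    (hf : ∀ i x, f i i le_rfl x = x)
    (hf' : ∀ i j k hij hjk x, f j k hjk (f i j hij x) = f i k (le_trans hij hjk) x) :
    ∃ (B : Type u) (_ : CommRing B) (o : ∀ i, G i →+* B), IsDirectedColimit f o := by
  have : DirectedSystem G fun i j h => f i j h :=
    ⟨fun i x => hf i x, fun k j i hij hjk x => hf' _ _ _ hij hjk x⟩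
  refine ⟨Ring.DirectLimit G (f · · ·), inferInstance,
    Ring.DirectLimit.of G (f · · ·), fun i j h x => Ring.DirectLimit.of_f h x,
    Ring.DirectLimit.exists_of, fun i x hx => Ring.DirectLimit.of.zero_exact hx,
    fun {C} _ g hg => ⟨Ring.DirectLimit.lift G (f · · ·) C g hg,
      fun i x => Ring.DirectLimit.lift_of C g hg i x, fun g' hg' => ?_⟩⟩
  refine Ring.DirectLimit.hom_ext C fun i => RingHom.ext fun x => ?_
  exact (hg' i x).trans (Ring.DirectLimit.lift_of C g hg i x).symm

namespace IsDirectedColimit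

variable {ι : Type u} [Preorder ι] {G : ι → Type u} [∀ i, CommRing (G i)]
    {f : ∀ i j, i ≤ j → G i →+* G j} {B : Type u} [CommRing B] {o : ∀ i, G i →+* B}
    (ho : IsDirectedColimit f o) {p : ∀ i, G i} (hp : ∀ i j h, f i j h (p i) = p j) {P : B}
    (hP : ∀ i, o i (p i) = P)

include ho hp hP

theorem mem_nonZeroDivisors (h : ∀ i, p i ∈ nonZeroDivisors (G i)) : P ∈ nonZeroDivisors B := by
  refine mem_nonZeroDivisors_iff_right.mpr fun z hz => ?_
  obtain ⟨i, x, rfl⟩ := ho.exists_eq z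
  rw [← hP i, ← map_mul] at hz
  obtain ⟨j, hij, hx⟩ := ho.exists_map_eq_zero i _ hz
  rw [map_mul, hp] at hx
  rw [← ho.map_eq i j hij, mem_nonZeroDivisors_iff_right.mp (h j) _ hx, map_zero]

omit hp hP in
/-- Finitely many elements of the colimit come from a common member of the system. -/
theorem exists_lift_sequence [IsDirectedOrder ι] (i₀ : ι) (c : ℕ → B) (hc : c 0 = 1) (d : ℕ) :
    ∃ i, i₀ ≤ i ∧ ∃ c' : ℕ → G i, c' 0 = 1 ∧ ∀ k ≤ d, o i (c' k) = c k := by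
  induction d with
  | zero =>
    refine ⟨i₀, le_rfl, fun _ => 1, rfl, fun k hk => ?_⟩
    rw [Nat.le_zero.mp hk, hc, map_one]
  | succ d ih =>
    obtain ⟨i, hi, c', hc', h⟩ := ih
    obtain ⟨j, x, hx⟩ := ho.exists_eq (c (d + 1))
    obtain ⟨k, hik, hjk⟩ := exists_ge_ge i j
    refine ⟨k, hi.trans hik, Function.update (fun m => f i k hik (c' m)) (d + 1) (f j k hjk x),
      ?_, fun m hm => ?_⟩
    · rw [Function.update_of_ne (by omega), hc', map_one]
    · rcases Nat.le_succ_iff.mp hm with hm | rfl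
      · rw [Function.update_of_ne (by omega), ho.map_eq, h m hm]
      · rw [Function.update_self, ho.map_eq, hx]

/-- Normality passes to directed colimits: an equation of integrality over the colimit comes from
one over a member of the system. -/
theorem isNormalWrt [IsDirectedOrder ι] (h : ∀ i, IsNormalWrt (p i)) : IsNormalWrt P := by
  intro d b c hc hb
  obtain ⟨i, x, rfl⟩ := ho.exists_eq b
  obtain ⟨j, hij, c', hc', hcc⟩ := ho.exists_lift_sequence i c hc d
  have h1 : o j (∑ k ∈ Finset.range (d + 1), c' k * p j ^ k * (f i j hij x) ^ (d - k)) = 0 := by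
    rw [← hb, map_sum]
    refine Finset.sum_congr rfl fun k hk => ?_
    rw [map_mul, map_mul, map_pow, map_pow, hP, ho.map_eq,
      hcc k (Nat.lt_succ_iff.mp (Finset.mem_range.mp hk))]
  obtain ⟨l, hjl, h2⟩ := ho.exists_map_eq_zero j _ h1
  rw [map_sum] at h2
  have h3 := h l d (f j l hjl (f i j hij x)) (fun k => f j l hjl (c' k))
    (by rw [hc', map_one]) (by
      rw [← h2]
      refine Finset.sum_congr rfl fun k _ => ?_
      rw [map_mul, map_mul, map_pow, map_pow, hp])
  have h4 := map_dvd (o l) h3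
  rwa [hP, ho.map_eq, ho.map_eq] at h4

end IsDirectedColimit

namespace PadicFormalScheme

variable {V : Type u} [CommRing V] {π : V}

/-! ### Limits along affine transition morphisms -/

section Limit

variable {ι : Type u} [Preorder ι] (F : ιᵒᵖ ⥤ PadicFormalScheme V π)

/-- The transition morphisms of a projective system. -/
abbrev transMap {i j : ι} (h : i ≤ j) : F.obj (.op j) ⟶ F.obj (.op i) := F.map (homOfLE h).op

theorem transMap_comp {i j k : ι} (h : i ≤ j) (h' : j ≤ k) :
    transMap F h' ≫ transMap F h = transMap F (h.trans h') := by
  rw [← F.map_comp]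
  rfl

variable [OrderBot ι]

/-- The functor of compatible families of morphisms to a projective system. -/
def coneModuli : Moduli (F.obj (.op ⊥)) where
  obj T := (Functor.const ιᵒᵖ).obj T ⟶ F
  map f σ := (Functor.const ιᵒᵖ).map f ≫ σ
  map_id σ := NatTrans.ext (funext fun i => Category.id_comp (σ.app i))
  map_comp f g σ := NatTrans.ext (funext fun i => Category.assoc f g (σ.app i))
  anchor σ := σ.app (.op ⊥)
  anchor_map _ _ := rfl
  IsTest _ := True
  isTest_of_isOpenImm _ _ _ := trivial
  isTest_of_cover _ := trivial

theorem isSheaf_coneModuli : (coneModuli F).IsSheaf := by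
  intro T K _ c σ h
  choose t ht hu using fun i => c.existsUnique_glue (fun k => (σ k).app i) fun k k' hk =>
    NatTrans.congr_app (h k k' hk) i
  refine ⟨⟨t, fun i j φ => ?_⟩, fun k => NatTrans.ext (funext fun i => ht i k), fun s hs =>
    NatTrans.ext (funext fun i => hu i _ fun k => NatTrans.congr_app (hs k) i)⟩
  refine (Category.id_comp _).trans (hu j _ fun k => ?_).symm
  have h1 : (σ k).app j = (σ k).app i ≫ F.map φ :=
    (Category.id_comp _).symm.trans ((σ k).naturality φ)
  exact (Category.assoc _ _ _).symm.trans ((congrArg (· ≫ F.map φ) (ht i k)).trans h1.symm)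

/-- A universal compatible family is a limit cone. -/
theorem nonempty_isLimit_of_isUniversal {L : PadicFormalScheme V π}
    {ξ : (Functor.const ιᵒᵖ).obj L ⟶ F} (h : (coneModuli F).IsUniversal (W := L) ξ) :
    Nonempty (IsLimit (Cone.mk L ξ)) := by
  choose l hl hlu using fun s : Cone F => h.existsUnique s.pt s.π trivial
  refine ⟨⟨l, fun s i => NatTrans.congr_app (hl s) i, fun s m hm => hlu s m ?_⟩⟩
  exact NatTrans.ext (funext hm)

variable {F}

/-- The part of the projective system above an open subset of its least member. -/
def systemOpen (F : ιᵒᵖ ⥤ PadicFormalScheme V π) (U : (F.obj (.op ⊥)).Open) (i : ι) :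
    (F.obj (.op i)).Open := U.preimage (transMap F (bot_le : ⊥ ≤ i))

theorem preimage_systemOpen (U : (F.obj (.op ⊥)).Open) {i j : ι} (h : i ≤ j) :
    (systemOpen F U i).preimage (transMap F h) = systemOpen F U j := by
  rw [systemOpen, ← Open.preimage_comp, transMap_comp]
  rfl

theorem isAffine_systemOpen (hF : ∀ i j (φ : i ⟶ j), IsAffineMor (F.map φ))
    {U : (F.obj (.op ⊥)).Open} (hU : U.IsAffine) (i : ι) : (systemOpen F U i).IsAffine :=
  fun n => by
    have := hF _ _ (homOfLE (bot_le : ⊥ ≤ i)).op n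
    exact (hU n).preimage _

/-- The transition maps on sections over an open subset of the least member of the system. -/
def systemMap (U : (F.obj (.op ⊥)).Open) (i j : ι) (h : i ≤ j) :
    (F.obj (.op i)).sections (systemOpen F U i) →+* (F.obj (.op j)).sections (systemOpen F U j) :=
  mapLE (transMap F h) _ _ (preimage_systemOpen U h).ge

theorem preimage_systemOpen_app {T : PadicFormalScheme V π} (σ : (Functor.const ιᵒᵖ).obj T ⟶ F)
    (U : (F.obj (.op ⊥)).Open) (i : ι) :
    (systemOpen F U i).preimage (X := T) (σ.app (.op i)) = U.preimage (X := T) (σ.app (.op ⊥)) := by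
  rw [systemOpen, ← Open.preimage_comp]
  congr 1
  exact ((σ.naturality (homOfLE (bot_le : ⊥ ≤ i)).op).symm.trans (Category.id_comp _))

/-- The limit of a projective system with affine transition morphisms, over an affine open of its
least member, is the formal spectrum of the colimit of the rings of sections. -/
theorem exists_isUniversalOver_coneModuli {U : (F.obj (.op ⊥)).Open} 
    (hU : ∀ i, (systemOpen F U i).IsAffine) {B : Type u} [CommRing B]
    {o : ∀ i, (F.obj (.op i)).sections (systemOpen F U i) →+* B}
    (ho : IsDirectedColimit (systemMap U) o) {β : V →+* B}
    (hβ : ∀ i v, o i (algebraMap V _ v) = β v) :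
    ∃ (L : PadicFormalScheme V π) (ξ : (Functor.const ιᵒᵖ).obj L ⟶ F) (θ : B →+* L.sections ⊤),
      IsChart ⊤ β θ ∧ (coneModuli F).IsUniversalOver (W := L) U ξ := by
  obtain ⟨L, θ, hθ⟩ := exists_isChart_top (π := π) β
  have hg : ∀ i, (θ.comp (o i)).comp (algebraMap V _) = algebraMap V _ := fun i => by
    rw [← hθ.comp_eq, RingHom.comp_assoc]
    exact congrArg _ (RingHom.ext fun v => hβ i v)
  choose l hl _ using fun i => (isChart_id (hU i)).existsUnique_hom (θ.comp (o i)) (hg i)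
  choose e he using hl
  have he' : ∀ i r, mapLE (l i) _ ⊤ (e i) r = θ (o i r) := fun i r => congr($(he i) r)
  have hcomp : ∀ {i j : ι} (h : i ≤ j), l j ≫ transMap F h = l i := fun {i j} h => by
    have e1 : systemOpen F U j ≤ (systemOpen F U i).preimage (transMap F h) :=
      (preimage_systemOpen U h).ge
    refine (isChart_id (hU i)).hom_ext ((e j).trans (Open.preimage_mono (l j) e1)) (e i)
      fun r => ?_
    refine (mapLE_mapLE (l j) (transMap F h) e1 (e j) r).symm.trans ?_
    refine (he' j _).trans (Eq.trans ?_ (he' i r).symm)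
    exact congrArg θ (ho.map_eq i j h r)
  let ξ : (Functor.const ιᵒᵖ).obj L ⟶ F :=
    ⟨fun i => l i.unop, fun i j φ => (Category.id_comp _).trans (hcomp (leOfHom φ.unop)).symm⟩
  have eU : U.preimage (X := L) (ξ.app (.op ⊥)) = ⊤ := by
    rw [← preimage_systemOpen_app ξ U ⊥]
    exact le_antisymm le_top (e ⊥)
  refine ⟨L, ξ, θ, hθ, ⟨trivial, eU, fun T σ _ hσ => ?_⟩⟩
  have eσ : ∀ i, ⊤ ≤ (systemOpen F U i).preimage (X := T) (σ.app (.op i)) := fun i =>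
    ((preimage_systemOpen_app σ U i).trans hσ).ge
  have hnat : ∀ {i j : ι} (h : i ≤ j),
      (σ.app (.op j) : T ⟶ F.obj (.op j)) ≫ transMap F h = σ.app (.op i) := fun h =>
    (σ.naturality (homOfLE h).op).symm.trans (Category.id_comp _)
  let m : ∀ i, (F.obj (.op i)).sections (systemOpen F U i) →+* T.sections ⊤ := fun i =>
    mapLE (X := T) (σ.app (.op i)) _ ⊤ (eσ i)
  have hm : ∀ i j (h : i ≤ j) x, m j (systemMap U i j h x) = m i x := fun i j h x =>
    (mapLE_mapLE _ _ _ _ _).trans (mapLE_congr (hnat h) _ x)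
  obtain ⟨g, hg', hgu⟩ := ho.existsUnique_lift m hm
  have hgβ : g.comp β = algebraMap V _ := RingHom.ext fun v => by
    rw [RingHom.comp_apply, ← hβ ⊥, hg']
    exact mapLE_algebraMap _ _ v
  obtain ⟨k, ⟨ek, hk⟩, hku⟩ := hθ.existsUnique_hom g hgβ
  have hlk : ∀ i x, mapLE (k ≫ l i) (systemOpen F U i) ⊤ (ek.trans (Open.preimage_mono k (e i))) x =
      mapLE k ⊤ ⊤ ek (θ (o i x)) := fun i x => by
    rw [← he', mapLE_mapLE]
  refine ⟨k, NatTrans.ext (funext fun i => ?_), fun k' hk' => hku k' ?_⟩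
  · refine (isChart_id (hU i.unop)).hom_ext (f := k ≫ l i.unop)
      (ek.trans (Open.preimage_mono k (e i.unop))) (eσ i.unop) fun x => ?_
    exact (hlk i.unop x).trans (congr($hk (o i.unop x)).trans (hg' i.unop x))
  · refine ⟨le_top, hgu _ fun i x => ?_⟩
    have h1 : k' ≫ l i = σ.app (.op i) := NatTrans.congr_app hk' (.op i)
    have h2 := mapLE_mapLE k' (l i) (e i) (U'' := ⊤) le_top x
    rw [he'] at h2
    exact h2.trans (mapLE_congr h1 _ x)

end Limit

end PadicFormalScheme

namespace PadicFormalScheme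

variable {V : Type u} [CommRing V] {π : V}

theorem mapLE_id {X : PadicFormalScheme V π} {U : X.Open} (e : U ≤ U.preimage (𝟙 X))
    (x : X.sections U) : mapLE (𝟙 X) U U e x = x := by
  refine sections_ext fun n => ?_
  rw [reduction_mapLE]
  exact congr($((Scheme.Hom.appLE_eq_app (f := 𝟙 (X.obj n)) (U := U.carrier n)).trans
    (Scheme.Hom.id_app _)).hom (X.reduction U n x))

section Limit

variable {ι : Type u} [Preorder ι] [IsDirectedOrder ι] [OrderBot ι]
  {F : ιᵒᵖ ⥤ PadicFormalScheme V π}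

theorem exists_isDirectedColimit_systemMap (U : (F.obj (.op ⊥)).Open) :
    ∃ (B : Type u) (_ : CommRing B) (o : ∀ i, (F.obj (.op i)).sections (systemOpen F U i) →+* B)
      (β : V →+* B), IsDirectedColimit (systemMap U) o ∧ ∀ i v, o i (algebraMap V _ v) = β v := by
  obtain ⟨B, _, o, ho⟩ := exists_isDirectedColimit (systemMap U)
    (fun i x => (mapLE_congr (F.map_id (.op i)) _ x).trans (mapLE_id _ x))
    (fun i j k h h' x => (mapLE_mapLE _ _ _ _ x).trans (mapLE_congr (transMap_comp F h h') _ x))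
  refine ⟨B, _, o, (o ⊥).comp (algebraMap V _), ho, fun i v => ?_⟩
  refine Eq.trans (congrArg (o i) (mapLE_algebraMap _ _ v).symm) (ho.map_eq ⊥ i bot_le _)

theorem exists_isUniversal_coneModuli (hF : ∀ i j (φ : i ⟶ j), IsAffineMor (F.map φ)) :
    ∃ (L : PadicFormalScheme V π) (ξ : (Functor.const ιᵒᵖ).obj L ⟶ F),
      (coneModuli F).IsUniversal (W := L) ξ := by
  refine (isSheaf_coneModuli F).exists_isUniversal fun U hU => ?_
  obtain ⟨B, _, o, β, ho, hβ⟩ := exists_isDirectedColimit_systemMap U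
  obtain ⟨L, ξ, θ, -, h⟩ := exists_isUniversalOver_coneModuli (isAffine_systemOpen hF hU) ho hβ
  exact ⟨L, ξ, h⟩

/-- Locally, the limit is the formal spectrum of a colimit of rings of sections. -/
theorem exists_isChart_of_isUniversal (hF : ∀ i j (φ : i ⟶ j), IsAffineMor (F.map φ))
    {L : PadicFormalScheme V π} {ξ : (Functor.const ιᵒᵖ).obj L ⟶ F}
    (h : (coneModuli F).IsUniversal (W := L) ξ) (x : L.obj 0) :
    ∃ (U : (F.obj (.op ⊥)).Open) (B : Type u) (_ : CommRing B)
      (o : ∀ i, (F.obj (.op i)).sections (systemOpen F U i) →+* B) (β : V →+* B)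
      (W : L.Open) (θ : B →+* L.sections W), (∀ i, (systemOpen F U i).IsAffine) ∧
      IsDirectedColimit (systemMap U) o ∧ (∀ i v, o i (algebraMap V _ v) = β v) ∧
      x ∈ W.carrier 0 ∧ IsChart W β θ := by
  obtain ⟨U, hU, -, hx⟩ := Open.exists_isAffine_le (U := (⊤ : (F.obj (.op ⊥)).Open))
    (x := Hom.app (X := L) (ξ.app (.op ⊥)) 0 x) trivial
  obtain ⟨B, _, o, β, ho, hβ⟩ := exists_isDirectedColimit_systemMap U
  obtain ⟨L', ξ', θ, hθ, h'⟩ :=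
    exists_isUniversalOver_coneModuli (isAffine_systemOpen hF hU) ho hβ
  obtain ⟨r, -, _, hr⟩ := h.exists_comparison h'
  obtain ⟨e, θ', hθ', -⟩ := IsChart.exists_of_isOpenImm r hθ hr
  exact ⟨U, B, _, o, β, _, θ', isAffine_systemOpen hF hU, ho, hβ, hx, hθ'⟩

theorem levelTorsionFree_of_isUniversal (hF : ∀ i j (φ : i ⟶ j), IsAffineMor (F.map φ))
    (hT : ∀ i, (F.obj i).TorsionFree)
    {L : PadicFormalScheme V π} {ξ : (Functor.const ιᵒᵖ).obj L ⟶ F}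
    (h : (coneModuli F).IsUniversal (W := L) ξ) : L.LevelTorsionFree := by
  refine levelTorsionFree_of_charts fun x => ?_
  obtain ⟨U, B, _, o, β, W, θ, -, ho, hβ, hx, hθ⟩ := exists_isChart_of_isUniversal hF h x
  exact ⟨W, B, _, β, θ, hx, hθ, ho.mem_nonZeroDivisors (fun i j h => mapLE_algebraMap _ _ π)
    (fun i => hβ i π) fun i => (hT _).mem_nonZeroDivisors _⟩

theorem levelNormal_of_isUniversal (hF : ∀ i j (φ : i ⟶ j), IsAffineMor (F.map φ))
    (hT : ∀ i, (F.obj i).TorsionFree) (hN : ∀ i, (F.obj i).LevelNormal)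
    {L : PadicFormalScheme V π} {ξ : (Functor.const ιᵒᵖ).obj L ⟶ F}
    (h : (coneModuli F).IsUniversal (W := L) ξ) : L.LevelNormal := by
  refine levelNormal_of_charts fun x => ?_
  obtain ⟨U, B, _, o, β, W, θ, hU, ho, hβ, hx, hθ⟩ := exists_isChart_of_isUniversal hF h x
  exact ⟨W, B, _, β, θ, hx, hθ, ho.isNormalWrt (fun i j h => mapLE_algebraMap _ _ π)
    (fun i => hβ i π) fun i => (hN _).isNormalWrt (hU i) (hT _)⟩

/-- A projective system with affine transition morphisms has a limit. -/
theorem hasLimit_of_isAffineMor (hF : ∀ i j (φ : i ⟶ j), IsAffineMor (F.map φ)) : HasLimit F := by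
  obtain ⟨L, ξ, h⟩ := exists_isUniversal_coneModuli hF
  obtain ⟨hl⟩ := nonempty_isLimit_of_isUniversal F h
  exact ⟨⟨⟨_, hl⟩⟩⟩

/-- Torsion-freeness passes to limits. -/
theorem levelTorsionFree_of_isLimit (hF : ∀ i j (φ : i ⟶ j), IsAffineMor (F.map φ))
    (hT : ∀ i, (F.obj i).TorsionFree) {c : Cone F} (hc : IsLimit c) : c.pt.LevelTorsionFree := by
  obtain ⟨L, ξ, h⟩ := exists_isUniversal_coneModuli hF
  obtain ⟨hl⟩ := nonempty_isLimit_of_isUniversal F h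
  have := Moduli.isOpenImm_of_isIso (hc.conePointUniqueUpToIso hl)
  exact (levelTorsionFree_of_isUniversal hF hT h).of_isOpenImm (T := L)
    (hc.conePointUniqueUpToIso hl).hom

/-- Normality with respect to `π` passes to limits. -/
theorem levelNormal_of_isLimit (hF : ∀ i j (φ : i ⟶ j), IsAffineMor (F.map φ))
    (hT : ∀ i, (F.obj i).TorsionFree) (hN : ∀ i, (F.obj i).LevelNormal) {c : Cone F}
    (hc : IsLimit c) : c.pt.LevelNormal := by
  obtain ⟨L, ξ, h⟩ := exists_isUniversal_coneModuli hF
  obtain ⟨hl⟩ := nonempty_isLimit_of_isUniversal F h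
  have := Moduli.isOpenImm_of_isIso (hc.conePointUniqueUpToIso hl)
  exact (levelNormal_of_isUniversal hF hT hN h).of_isOpenImm (T := L)
    (hc.conePointUniqueUpToIso hl).hom

end Limit

end PadicFormalScheme

/-! ### Projective systems of normalised blow-ups -/

namespace PadicFormalScheme

variable {V : Type u} [CommRing V] {π : V}

section

variable {X : PadicFormalScheme V π} (hX : X.TorsionFree) {I : X.IdealSystem} (hI : I.IsOpen)
  {N : PadicFormalScheme V π} {p : N ⟶ X} (hp : IsNormalizedBlowup I p)

include hX hI hp

theorem IsNormalizedBlowup.isLocallyPrincipal : (I.pullback p).IsLocallyPrincipal :=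
  (hp.exists_isUniversal hX hI).1

theorem IsNormalizedBlowup.levelTorsionFree : N.LevelTorsionFree :=
  (hp.exists_isUniversal hX hI).2.isTest.1

theorem IsNormalizedBlowup.levelNormal : N.LevelNormal :=
  (hp.exists_isUniversal hX hI).2.isTest.2

/-- The universal property of the normalised blow-up. -/
theorem IsNormalizedBlowup.existsUnique_hom {T : PadicFormalScheme V π} (hT : T.LevelTorsionFree)
    (hT' : T.LevelNormal) (t : T ⟶ X) (ht : (I.pullback t).IsLocallyPrincipal) :
    ∃! h : T ⟶ N, h ≫ p = t := by
  obtain ⟨h, hh, hu⟩ := (hp.exists_isUniversal hX hI).2.existsUnique T ⟨t, ht⟩ ⟨hT, hT'⟩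
  exact ⟨h, congr(($hh).1), fun h' hh' => hu h' (Subtype.ext hh')⟩

theorem IsNormalizedBlowup.hom_ext {T : PadicFormalScheme V π} (hT : T.LevelTorsionFree)
    (hT' : T.LevelNormal) {f g : T ⟶ N} (h : f ≫ p = g ≫ p) : f = g :=
  (hp.existsUnique_hom hX hI hT hT' (g ≫ p) (by
    rw [I.pullback_comp]
    exact (hp.isLocallyPrincipal hX hI).pullback g)).unique h rfl

end

section System

variable {J : Type u} [Category.{u} J] {F : J ⥤ PadicFormalScheme V π}
  {I : ∀ i, (F.obj i).IdealSystem} (hF : ∀ i, (F.obj i).TorsionFree) (hI : ∀ i, (I i).IsOpen)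
  (hIF : ∀ {i j} (φ : i ⟶ j), (I j).pullback (F.map φ) = I i)

include hF hI hIF

/-- The normalised blow-ups of a compatible family of ideals form a projective system. -/
theorem exists_system_isNormalizedBlowup :
    ∃ (N : J ⥤ PadicFormalScheme V π) (p : N ⟶ F), ∀ i, IsNormalizedBlowup (I i) (p.app i) := by
  choose N p hp using fun i => exists_isNormalizedBlowup (hF i) (hI i)
  have hT := fun i => (hp i).levelTorsionFree (hF i) (hI i)
  have hN := fun i => (hp i).levelNormal (hF i) (hI i)
  choose m hm _ using fun i j (φ : i ⟶ j) => (hp j).existsUnique_hom (hF j) (hI j) (hT i) (hN i)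
    (p i ≫ F.map φ) (by
      rw [IdealSystem.pullback_comp, hIF]
      exact (hp i).isLocallyPrincipal (hF i) (hI i))
  dsimp only at hm
  refine ⟨⟨N, fun φ => m _ _ φ, fun i => ?_, fun {i j k} φ ψ => ?_⟩,
    ⟨p, fun i j φ => hm i j φ⟩, hp⟩
  · refine (hp i).hom_ext (hF i) (hI i) (hT i) (hN i) ?_
    rw [hm, F.map_id, Category.comp_id, Category.id_comp]
  · refine (hp k).hom_ext (hF k) (hI k) (hT i) (hN i) ?_
    rw [hm, F.map_comp, Category.assoc, hm, ← Category.assoc, ← hm, Category.assoc]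

variable {N : J ⥤ PadicFormalScheme V π} {p : N ⟶ F}
  (hp : ∀ i, IsNormalizedBlowup (I i) (p.app i)) {c : Cone F} {I' : c.pt.IdealSystem}
  (hI' : ∀ i, (I i).pullback (c.π.app i) = I') {M : PadicFormalScheme V π} {q : M ⟶ c.pt}
  (hc : c.pt.TorsionFree) (hI'o : I'.IsOpen) (hq : IsNormalizedBlowup I' q)

include hp hI' hc hI'o hq

omit hIF in
/-- The normalised blow-up of the limit maps to the system of normalised blow-ups. -/
theorem existsUnique_toSystem : ∃! s : (Functor.const J).obj M ⟶ N,
    ∀ i, s.app i ≫ p.app i = q ≫ c.π.app i := by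
  have hT := hq.levelTorsionFree hc hI'o
  have hN := hq.levelNormal hc hI'o
  choose s hs hsu using fun i => (hp i).existsUnique_hom (hF i) (hI i) hT hN (q ≫ c.π.app i) (by
    rw [IdealSystem.pullback_comp, hI']
    exact hq.isLocallyPrincipal hc hI'o)
  refine ⟨⟨s, fun i j φ => (Category.id_comp _).trans (hsu j _ ?_).symm⟩, hs, fun s' hs' =>
    NatTrans.ext (funext fun i => hsu i _ (hs' i))⟩
  dsimp only at hs ⊢
  rw [Category.assoc, p.naturality, ← Category.assoc, hs, Category.assoc, c.w]

omit hIF in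
/-- The limit `L` of the normalised blow-ups is torsion-free and normal, and it carries a morphism
to the limit of the system along which the ideal becomes locally principal; so it maps to the
normalised blow-up of the limit. -/
theorem nonempty_isLimit_toSystem [Nonempty J] (hlim : IsLimit c) {d : Cone N} (hd : IsLimit d)
    (hdT : d.pt.LevelTorsionFree) (hdN : d.pt.LevelNormal) {s : (Functor.const J).obj M ⟶ N}
    (hs : ∀ i, s.app i ≫ p.app i = q ≫ c.π.app i) : Nonempty (IsLimit (Cone.mk M s)) := by
  obtain ⟨i₀⟩ := ‹Nonempty J›
  let a : d.pt ⟶ c.pt := hlim.lift ((Cone.postcompose p).obj d)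
  have ha : ∀ i, a ≫ c.π.app i = d.π.app i ≫ p.app i := fun i =>
    hlim.fac ((Cone.postcompose p).obj d) i
  obtain ⟨v, hv, -⟩ := hq.existsUnique_hom hc hI'o hdT hdN a (by
    rw [← hI' i₀, ← IdealSystem.pullback_comp, ha, IdealSystem.pullback_comp]
    exact ((hp i₀).isLocallyPrincipal (hF i₀) (hI i₀)).pullback _)
  have hvs : ∀ i, v ≫ s.app i = d.π.app i := fun i =>
    (hp i).hom_ext (hF i) (hI i) hdT hdN (by
      rw [Category.assoc, hs, ← Category.assoc, hv, ha])
  let w : M ⟶ d.pt := hd.lift (Cone.mk M s)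
  have hw : ∀ i, w ≫ d.π.app i = s.app i := hd.fac (Cone.mk M s)
  have hwv : w ≫ v = 𝟙 M := by
    refine hq.hom_ext hc hI'o (hq.levelTorsionFree hc hI'o) (hq.levelNormal hc hI'o) ?_
    refine hlim.hom_ext fun i => ?_
    rw [Category.assoc w v q, hv, Category.assoc, ha, ← Category.assoc, hw, hs, Category.id_comp]
  have hvw : v ≫ w = 𝟙 d.pt := hd.hom_ext fun i => by
    rw [Category.assoc, hw, hvs, Category.id_comp]
  exact ⟨hd.ofIsoLimit (Cone.ext ⟨v, w, hvw, hwv⟩ fun i => (hvs i).symm)⟩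

end System

end PadicFormalScheme

theorem isDirectedOrder_Ici {ι : Type u} [Preorder ι] [IsDirectedOrder ι] (i₀ : ι) :
    IsDirectedOrder (Set.Ici i₀) where
  directed i j := by
    obtain ⟨k, hik, hjk⟩ := exists_ge_ge i.1 j.1
    exact ⟨⟨k, i.2.trans hik⟩, hik, hjk⟩

theorem initial_op_functor_Ici {ι : Type u} [Preorder ι] [IsDirectedOrder ι] (i₀ : ι) :
    (Functor.op (Monotone.functor (f := fun i : Set.Ici i₀ => (i : ι)) fun _ _ h => h)).Initial := by
  have := isDirectedOrder_Ici i₀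
  have : (Monotone.functor (f := fun i : Set.Ici i₀ => (i : ι)) fun _ _ h => h).Final := by
    refine Functor.final_of_exists_of_isFiltered _ (fun j => ?_) fun {j i} s s' => ⟨i, 𝟙 i, rfl⟩
    obtain ⟨k, hk, hk'⟩ := exists_ge_ge i₀ j
    exact ⟨⟨k, hk⟩, ⟨homOfLE hk'⟩⟩
  infer_instance

end

theorem mainTheorem12 {V : Type u} [CommRing V] [IsDomain V] [ValuationRing V]
    (hV : ringKrullDim V = 1) (π : V) (hπ : π ≠ 0) (hπ' : ¬ IsUnit π)
    {ι : Type u} [PartialOrder ι] [IsDirectedOrder ι]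
    (Z : ιᵒᵖ ⥤ PadicFormalScheme V π)
    (hqs : ∀ i, (Z.obj i).QuasiSeparated)
    (htf : ∀ i, (Z.obj i).TorsionFree)
    (haff : ∀ (i j : ιᵒᵖ) (φ : i ⟶ j), PadicFormalScheme.IsAffineMor (Z.map φ))
    (i₀ : ι) (I : (Z.obj (Opposite.op i₀)).IdealSystem) (hI : I.Admissible) :
    HasLimit Z ∧
    (∃ (N : (Set.Ici i₀)ᵒᵖ ⥤ PadicFormalScheme V π) (p : N ⟶ systemAbove Z i₀),
      ∀ i : Set.Ici i₀, PadicFormalScheme.IsNormalizedBlowup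
        (I.pullback (Z.map (homOfLE i.2).op)) (p.app (Opposite.op i))) ∧
    ∀ c : Cone Z, IsLimit c →
      c.pt.TorsionFree ∧
      (∃ (M : PadicFormalScheme V π) (q : M ⟶ c.pt),
        PadicFormalScheme.IsNormalizedBlowup (I.pullback (c.π.app (Opposite.op i₀))) q) ∧
      ∀ (N : (Set.Ici i₀)ᵒᵖ ⥤ PadicFormalScheme V π) (p : N ⟶ systemAbove Z i₀),
        (∀ i : Set.Ici i₀, PadicFormalScheme.IsNormalizedBlowup
          (I.pullback (Z.map (homOfLE i.2).op)) (p.app (Opposite.op i))) →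
        ∀ (M : PadicFormalScheme V π) (q : M ⟶ c.pt),
          PadicFormalScheme.IsNormalizedBlowup (I.pullback (c.π.app (Opposite.op i₀))) q →
          ∃ s : (Functor.const (Set.Ici i₀)ᵒᵖ).obj M ⟶ N,
            (∀ i : Set.Ici i₀, s.app (Opposite.op i) ≫ p.app (Opposite.op i) =
              q ≫ c.π.app (Opposite.op i.1)) ∧
            (∀ s' : (Functor.const (Set.Ici i₀)ᵒᵖ).obj M ⟶ N,
              (∀ i : Set.Ici i₀, s'.app (Opposite.op i) ≫ p.app (Opposite.op i) =
                q ≫ c.π.app (Opposite.op i.1)) → s' = s) ∧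
            Nonempty (IsLimit (Cone.mk M s)) := by
  have hdir := isDirectedOrder_Ici i₀
  have hinit := initial_op_functor_Ici i₀
  have haff' : ∀ i j (φ : i ⟶ j), PadicFormalScheme.IsAffineMor ((systemAbove Z i₀).map φ) :=
    fun i j φ => haff _ _ _
  have htf' : ∀ i, ((systemAbove Z i₀).obj i).TorsionFree := fun i => htf _
  let 𝓘 : ∀ i, ((systemAbove Z i₀).obj i).IdealSystem := fun i =>
    I.pullback (Z.map (homOfLE i.unop.2).op)
  have h𝓘 : ∀ i, (𝓘 i).IsOpen := fun i => hI.isOpen.pullback _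
  have h𝓘Z : ∀ {i j} (φ : i ⟶ j), (𝓘 j).pullback ((systemAbove Z i₀).map φ) = 𝓘 i :=
    fun {i j} φ => by
      refine (I.pullback_comp _ _).symm.trans (congrArg I.pullback ?_)
      exact (Z.map_comp _ _).symm
  have hlim : HasLimit (systemAbove Z i₀) := PadicFormalScheme.hasLimit_of_isAffineMor haff'
  refine ⟨Functor.Initial.hasLimit_of_comp (Functor.op (Monotone.functor
    (f := fun i : Set.Ici i₀ => (i : ι)) fun _ _ h => h)), ?_, fun c hc => ?_⟩
  · obtain ⟨N, p, hp⟩ := PadicFormalScheme.exists_system_isNormalizedBlowup htf' h𝓘 h𝓘Z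
    exact ⟨N, p, fun i => hp (.op i)⟩
  let c' : Cone (systemAbove Z i₀) := c.whisker _
  have hc' : IsLimit c' := (Functor.Initial.isLimitWhiskerEquiv _ c).symm hc
  have hctf : c.pt.TorsionFree :=
    (PadicFormalScheme.levelTorsionFree_of_isLimit haff' htf' hc').torsionFree
  have h𝓘c : (I.pullback (c.π.app (.op i₀))).IsOpen := hI.isOpen.pullback _
  refine ⟨hctf, PadicFormalScheme.exists_isNormalizedBlowup hctf h𝓘c, fun N p hp M q hq => ?_⟩
  have hp' : ∀ i, PadicFormalScheme.IsNormalizedBlowup (𝓘 i) (p.app i) := fun i => hp i.unop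
  have h𝓘c' : ∀ i, (𝓘 i).pullback (c'.π.app i) = I.pullback (c.π.app (.op i₀)) := fun i =>
    (I.pullback_comp _ _).symm.trans (congrArg I.pullback (c.w _))
  obtain ⟨s, hs, hsu⟩ := PadicFormalScheme.existsUnique_toSystem htf' h𝓘 hp' h𝓘c' hctf h𝓘c hq
  refine ⟨s, fun i => hs (.op i), fun s' hs' => hsu s' fun i => hs' i.unop, ?_⟩
  have hNtf := fun i => (hp' i).levelTorsionFree (htf' i) (h𝓘 i)
  have hNn := fun i => (hp' i).levelNormal (htf' i) (h𝓘 i)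
  have hNaff : ∀ i j (φ : i ⟶ j), PadicFormalScheme.IsAffineMor (N.map φ) := fun i j φ =>
    (hp' j).isAffineMor (haff' i j φ) (h𝓘 j) (htf' j) (htf' i) ((h𝓘Z φ).symm ▸ hp' i)
      (p.naturality φ)
  have hNlim : HasLimit N := PadicFormalScheme.hasLimit_of_isAffineMor hNaff
  have hd := limit.isLimit N
  exact PadicFormalScheme.nonempty_isLimit_toSystem htf' h𝓘 hp' h𝓘c' hctf h𝓘c hq hc' hd
    (PadicFormalScheme.levelTorsionFree_of_isLimit hNaff (fun i => (hNtf i).torsionFree) hd)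
    (PadicFormalScheme.levelNormal_of_isLimit hNaff (fun i => (hNtf i).torsionFree) hNn hd) hs
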